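/- Let $k$ be a commutative ring and let $A=\bigoplus_{i\in\mathbb N,\,j\in\mathbb Z}A_i^j$ be a bigraded $k$-module without 2-torsion. A map of bidegree $(s,t)$ sends $A_i^j$ to $A_{i-s}^{j+t}$; the Koszul rule is $(f\otimes g)(x\otimes y)=(-1)^{is+jt}f(x)\otimes g(y)$ for $g$ of bidegree $(s,t)$ and $x\in A_i^j$. A *derived $A_\infty$-structure* $m$ on $A$ (always strictly unital) consists of $k$-linear maps $m_{ij}:A^{\otimes j}\to A$ of bidegree $(i,2-(i+j))$, $i\ge 0$, $j\ge 1$, with $$\sum_{u=i+p,\;v=j+q-1,\;j=1+r+t}(-1)^{rq+t+pj}\,m_{ij}(1^{\otimes r}\otimes m_{pq}\otimes 1^{\otimes t})=0\qquad(u\ge 0,\ v\ge 1),$$ together with a unit $\eta:k\to A$ of bidegree $(0,0)$ such that $m_{01}\eta=0$, $m_{02}(\eta\otimes 1)=1=m_{02}(1\otimes\eta)$ and $m_{ij}(1^{\otimes r-1}\otimes\eta\otimes 1^{\otimes j-r})=0$ for $i+j\ge 3$. A *bidga* is such a structure with $m_{ij}=0$ for $i+j\ge 3$. A *morphism* $f:(A,m)\to(B,\overline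 m)$ consists of $k$-linear maps $f_{st}:A^{\otimes t}\to B$ of bidegree $(s,1-(s+t))$, $s\ge 0$, $t\ge 1$, such that for all $u\ge 0$, $v\ge 1$ $$\sum_{u=i+p,\;v=j+q-1,\;j=1+r+t}(-1)^{rq+t+pj}f_{ij}(1^{\otimes r}\otimes m_{pq}\otimes 1^{\otimes t})=\sum_{u=i+p_1+\dots+p_j,\;v=q_1+\dots+q_j}(-1)^{\epsilon}\,\overline m_{ij}(f_{p_1q_1}\otimes\dots\otimes f_{p_jq_j}),$$ $$\epsilon=u+\sum_{w=1}^{j-1}\Big(jp_w+w(q_{j-w}-p_w)+q_{j-w}\sum_{s=j-w+1}^{j}(p_s+q_s)\Big),$$ and $f_{01}\eta=\overline\eta$, $f_{ij}(1^{\otimes r-1}\otimes\eta\otimes 1^{\otimes j-r})=0$ for $i+j\ge 2$. It is an *$E_2$-equivalence* if $f_{01}$ induces an isomorphism on $H_{hor}(H_{ver}(-))$, where $H_{ver}$ is the homology of $m_{01}$ and $H_{hor}$ that of the differential induced on $H_{ver}$ by $m_{11}$. Now let $A$ be a bidga with multiplication $\mu=m_{02}$, horizontal differential $\partial=m_{11}$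 and $m_{01}=0$. For $n\ge 0$, $\kappa\ge 0$ let $C^{n,i}_\kappa(A,A)$ be the $k$-module of $k$-linear maps $A^{\otimes n}\to A$ of bidegree $(\kappa,i)$. For $f\in C^{n,i}_\kappa(A,A)$ and $g\in C^{m,j}_l(A,A)$ put $$f\circ g=\sum_{v=0}^{n-1}(-1)^{(m-1)(n-1)+v(m-1)+j(n-1)}f(1^{\otimes v}\otimes g\otimes 1^{\otimes n-v-1}),$$ $$[f,g]=f\circ g-(-1)^{(n+i-1)(m+j-1)+\kappa l}\,g\circ f,\qquad Df=(-1)^{\kappa}[\mu,f]+[\partial,f].$$ Let $HH^{s,r}_{bidga}(A,A)$ be the cohomology in degree $s$ of the complex $\big(\prod_{0\le n\le s}C^{n,r}_{s-n}(A,A),\,D\big)$. **Theorem.** If $HH^{r,2-r}_{bidga}(A,A)=0$ for all $r\ge 3$, then every derived $A_\infty$-structure $m$ on $A$ with $m_{02}=\mu$, $m_{11}=\partial$ and $m_{01}=0$ is $E_2$-equivalent to the trivial one (with $m_{02}=\mu$, $m_{11}=\partial$ and $m_{ij}=0$ for all other $(i,j)$): there is an $E_2$-equivalence from $(A,m)$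 to the trivial structure. -/

import Mathlib

/-!
Derived A-infinity algebras and the Hochschild cohomology of bidgas.

An (ℕ, ℤ)-bigraded `k`-module is a `k`-module `M` with an internal direct sum decomposition
`𝒜 (i, j)`; `i` is the horizontal degree and `j` the vertical degree.  A `k`-linear map
`A^{⊗ n} ⟶ B` is given as a multilinear map in `n` arguments.
-/

namespace DerivedAInf

open Finset

universe u v w

variable {k : Type u} [CommRing k]
variable {M : Type v} [AddCommGroup M] [Module k M]
variable {N : Type w} [AddCommGroup N] [Module k N]

/-- Linear maps `M^{⊗ n} ⟶ N`. -/
abbrev Multi (k : Type u) [CommRing k] (M : Type v) [AddCommGroup M] [Module k M]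
    (N : Type w) [AddCommGroup N] [Module k N] (n : ℕ) : Type (max v w) :=
  MultilinearMap k (fun _ : Fin n => M) N

/-- The bihomogeneous piece in horizontal degree `i : ℤ`, which is zero for `i < 0`. -/
def piece (𝒜 : ℕ × ℤ → Submodule k M) (i j : ℤ) : Submodule k M :=
  if 0 ≤ i then 𝒜 (i.toNat, j) else ⊥

/-- `f : A^{⊗ n} ⟶ B` has bidegree `(s, t)`: it maps `(A^{⊗ n})_i^j` to `B_{i-s}^{j+t}`. -/
def IsHomog (𝒜 : ℕ × ℤ → Submodule k M) (ℬ : ℕ × ℤ → Submodule k N) {n : ℕ}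
    (f : Multi k M N n) (s t : ℤ) : Prop :=
  ∀ (d : Fin n → ℕ × ℤ) (x : Fin n → M), (∀ l, x l ∈ 𝒜 (d l)) →
    f x ∈ piece ℬ ((∑ l, ((d l).1 : ℤ)) - s) ((∑ l, (d l).2) + t)

/-- The Koszul sign of moving a map of bidegree `(s, t)` past an element: on `A_i^j` this is
multiplication by `(-1)^(i s + j t)`. -/
noncomputable def signOp (𝒜 : ℕ × ℤ → Submodule k M) [DirectSum.Decomposition 𝒜] (s t : ℤ) :
    M →ₗ[k] M :=
  (DirectSum.toModule k (ℕ × ℤ) M fun d =>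
      ((d.1 : ℤ) * s + d.2 * t).negOnePow • (𝒜 d).subtype) ∘ₗ
    (DirectSum.decomposeLinearEquiv 𝒜).toLinearMap

section Insertion

variable (𝒜 : ℕ × ℤ → Submodule k M) [DirectSum.Decomposition 𝒜]

/-- The arguments `(1^{⊗ r} ⊗ g ⊗ 1^{⊗ (j-1-r)})(x 0 ⊗ x 1 ⊗ ⋯)`, where `g` has arity `q` and
bidegree `(s, t)` (with the Koszul sign on the first `r` arguments). -/
noncomputable def insArgs {j q : ℕ} (g : Multi k M M q) (s t : ℤ) (r : Fin j) (x : ℕ → M) :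
    Fin j → M :=
  fun l => if l < r then signOp 𝒜 s t (x l)
    else if l = r then g fun a : Fin q => x ((r : ℕ) + a)
    else x ((l : ℕ) + q - 1)

/-- `f (1^{⊗ r} ⊗ g ⊗ 1^{⊗ (j-1-r)})` evaluated at `x 0 ⊗ ⋯ ⊗ x (j+q-2)`, for `f` of arity `j`
and `g` of arity `q` and bidegree `(s, t)`. Only the first `j + q - 1` entries of the sequence
`x` matter. -/
noncomputable def ins {j q : ℕ} (f : Multi k M N j) (g : Multi k M M q) (s t : ℤ) (r : Fin j)
    (x : ℕ → M) : N :=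
  f (insArgs 𝒜 g s t r x)

/-- A finite tuple as a sequence (extended by zero). -/
def seq {n : ℕ} (x : Fin n → M) : ℕ → M := fun a => if h : a < n then x ⟨a, h⟩ else 0

theorem seq_update {n : ℕ} [DecidableEq (Fin n)] (x : Fin n → M) (a : Fin n) (y : M) :
    seq (Function.update x a y) = Function.update (seq x) (a : ℕ) y := by
  funext b
  by_cases hb : b < n
  · by_cases hba : b = a
    · subst hba
      simp [seq]
    · have : (⟨b, hb⟩ : Fin n) ≠ a := fun h => hba (by rw [← h])
      simp [seq, hb, Function.update_of_ne this, Function.update_of_ne hba]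
  · have : b ≠ a := fun h => hb (h ▸ a.2)
    simp [seq, hb, Function.update_of_ne this]

/-- Changing one entry of `x` changes the arguments of `f` in exactly one place, through a
linear map. -/
theorem insArgs_update {j q n : ℕ} (g : Multi k M M q) (s t : ℤ) (r : Fin j) (hn : n + 1 = j + q)
    (x : ℕ → M) (a : ℕ) (ha : a < n) :
    ∃ (b : Fin j) (L : M →ₗ[k] M), ∀ y : M,
      insArgs 𝒜 g s t r (Function.update x a y) =
        Function.update (insArgs 𝒜 g s t r x) b (L y) := by
  have hr := r.2
  rcases lt_or_ge a (r : ℕ) with h1 | h1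
  · refine ⟨⟨a, h1.trans r.2⟩, signOp 𝒜 s t, fun y => ?_⟩
    funext l
    by_cases hl : (l : ℕ) = a
    · have : l = ⟨a, h1.trans r.2⟩ := Fin.ext hl
      subst this
      simp [insArgs, Fin.lt_def, h1]
    · have hl' : l ≠ ⟨a, h1.trans r.2⟩ := fun h => hl (congrArg Fin.val h)
      rw [Function.update_of_ne hl']
      unfold insArgs
      split_ifs with h2 h3
      · rw [Function.update_of_ne hl]
      · congr 1
        funext c
        exact Function.update_of_ne (by omega) _ _
      · have h4 : (l : ℕ) ≠ r := fun h => h3 (Fin.ext h)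
        rw [Fin.lt_def] at h2
        exact Function.update_of_ne (by omega) _ _
  rcases lt_or_ge a ((r : ℕ) + q) with h2 | h2
  · refine ⟨r, g.toLinearMap (fun c : Fin q => x ((r : ℕ) + c)) ⟨a - r, by omega⟩, fun y => ?_⟩
    funext l
    by_cases hl : l = r
    · subst hl
      simp only [insArgs, lt_irrefl, if_false, if_true, Function.update_self,
        MultilinearMap.toLinearMap_apply]
      congr 1
      funext c
      by_cases hc : c = ⟨a - l, by omega⟩
      · subst hc
        simp [Nat.add_sub_cancel' h1]
      · have : (c : ℕ) ≠ a - l := fun h => hc (Fin.ext h)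
        rw [Function.update_of_ne hc, Function.update_of_ne (by omega)]
    · rw [Function.update_of_ne hl]
      have h4 : (l : ℕ) ≠ r := fun h => hl (Fin.ext h)
      simp only [insArgs, hl, if_false, Fin.lt_def]
      split_ifs with h3
      · rw [Function.update_of_ne (by omega)]
      · rw [Function.update_of_ne (by omega)]
  · refine ⟨⟨a + 1 - q, by omega⟩, LinearMap.id, fun y => ?_⟩
    funext l
    by_cases hl : (l : ℕ) = a + 1 - q
    · have : l = ⟨a + 1 - q, by omega⟩ := Fin.ext hl
      have h3 : ¬ l < r := by rw [Fin.lt_def]; omega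
      have h4 : l ≠ r := fun h => by
        have := congrArg Fin.val h
        omega
      rw [← this]
      simp only [insArgs, h3, h4, if_false, Function.update_self, LinearMap.id_apply]
      have h5 : (l : ℕ) + q - 1 = a := by omega
      rw [h5, Function.update_self]
    · have hl' : l ≠ ⟨a + 1 - q, by omega⟩ := fun h => hl (congrArg Fin.val h)
      rw [Function.update_of_ne hl']
      unfold insArgs
      split_ifs with h3 h4
      · rw [Fin.lt_def] at h3
        rw [Function.update_of_ne (by omega)]
      · congr 1
        funext c
        exact Function.update_of_ne (by omega) _ _
      · have h5 : (l : ℕ) ≠ r := fun h => h4 (Fin.ext h)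
        rw [Fin.lt_def] at h3
        exact Function.update_of_ne (by omega) _ _

/-- `f (1^{⊗ r} ⊗ g ⊗ 1^{⊗ (j-1-r)})` as a map `A^{⊗ n} ⟶ B`, `n = j + q - 1`. -/
noncomputable def insMulti {j q n : ℕ} (hn : n + 1 = j + q) (f : Multi k M N j)
    (g : Multi k M M q) (s t : ℤ) (r : Fin j) : Multi k M N n where
  toFun x := ins 𝒜 f g s t r (seq x)
  map_update_add' x a y z := by
    obtain ⟨b, L, h⟩ := insArgs_update 𝒜 g s t r hn (seq x) a a.2
    simp only [ins, seq_update, h, map_add, MultilinearMap.map_update_add]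
  map_update_smul' x a c y := by
    obtain ⟨b, L, h⟩ := insArgs_update 𝒜 g s t r hn (seq x) a a.2
    simp only [ins, seq_update, h, map_smul, MultilinearMap.map_update_smul]

theorem insArgs_eq {j q : ℕ} (g : Multi k M M q) (s t : ℤ) (r : Fin j) (x : ℕ → M) :
    insArgs 𝒜 g s t r x =
      Function.update (insArgs 𝒜 (0 : Multi k M M q) s t r x) r
        (g fun a : Fin q => x ((r : ℕ) + a)) := by
  funext l
  by_cases hl : l = r
  · subst hl
    simp [insArgs]
  · simp [insArgs, hl]

theorem insMulti_add_right {j q n : ℕ} (hn : n + 1 = j + q) (f : Multi k M N j)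
    (g g' : Multi k M M q) (s t : ℤ) (r : Fin j) :
    insMulti 𝒜 hn f (g + g') s t r = insMulti 𝒜 hn f g s t r + insMulti 𝒜 hn f g' s t r := by
  ext x
  change f _ = f _ + f _
  rw [insArgs_eq 𝒜 (g + g'), insArgs_eq 𝒜 g, insArgs_eq 𝒜 g', add_apply,
    f.map_update_add]

theorem insMulti_smul_right {j q n : ℕ} (hn : n + 1 = j + q) (f : Multi k M N j) (c : k)
    (g : Multi k M M q) (s t : ℤ) (r : Fin j) :
    insMulti 𝒜 hn f (c • g) s t r = c • insMulti 𝒜 hn f g s t r := by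
  ext x
  change f _ = c • f _
  rw [insArgs_eq 𝒜 (c • g), insArgs_eq 𝒜 g, smul_apply, f.map_update_smul]

end Insertion

section Bracket

variable (𝒜 : ℕ × ℤ → Submodule k M) [DirectSum.Decomposition 𝒜]

/-- The composition product `f ∘ g` of `f ∈ C^{n,*}_*(A,A)` and `g ∈ C^{m,j}_l(A,A)`:
`∑_v (-1)^{(m-1)(n-1) + v(m-1) + j(n-1)} f (1^{⊗ v} ⊗ g ⊗ 1^{⊗ (n-v-1)})`. -/
noncomputable def circ {n m a : ℕ} (h : a + 1 = n + m) (f : Multi k M M n)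
    (g : Multi k M M m) (j l : ℤ) : Multi k M M a :=
  ∑ v : Fin n, (((m : ℤ) - 1) * ((n : ℤ) - 1) + (v : ℤ) * ((m : ℤ) - 1)
    + j * ((n : ℤ) - 1)).negOnePow • insMulti 𝒜 h f g l j v

/-- The Lie bracket `[f, g] = f ∘ g - (-1)^{⟨f,g⟩} g ∘ f` of a fixed `f ∈ C^{n,i}_κ(A,A)` with
`g ∈ C^{m,j}_l(A,A)`, where `⟨f,g⟩ = (n+i-1)(m+j-1) + κ l`, as a linear map in `g`. -/
noncomputable def bracket {n m a : ℕ} (h : a + 1 = n + m) (f : Multi k M M n) (i κ j l : ℤ) :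
    Multi k M M m →ₗ[k] Multi k M M a where
  toFun g := circ 𝒜 h f g j l
    - (((n : ℤ) + i - 1) * ((m : ℤ) + j - 1) + κ * l).negOnePow •
      circ 𝒜 (h.trans (Nat.add_comm n m)) g f i κ
  map_add' g g' := by
    have h1 : ∀ v, insMulti 𝒜 (h.trans (Nat.add_comm n m)) (g + g') f κ i v =
        insMulti 𝒜 (h.trans (Nat.add_comm n m)) g f κ i v +
        insMulti 𝒜 (h.trans (Nat.add_comm n m)) g' f κ i v := fun v => rfl
    simp only [circ, insMulti_add_right, h1, smul_add, Finset.sum_add_distrib]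
    abel
  map_smul' c g := by
    have h1 : ∀ v, insMulti 𝒜 (h.trans (Nat.add_comm n m)) (c • g) f κ i v =
        c • insMulti 𝒜 (h.trans (Nat.add_comm n m)) g f κ i v := fun v => rfl
    simp only [circ, insMulti_smul_right, h1, RingHom.id_apply, smul_sub, Finset.smul_sum]
    congr 1
    · exact Finset.sum_congr rfl fun v _ => smul_comm _ _ _
    · refine Finset.sum_congr rfl fun v _ => ?_
      rw [smul_comm c, smul_comm c]

end Bracket

section Hochschild

variable (𝒜 : ℕ × ℤ → Submodule k M)

/-- The module `∏_n C^{n,r}_{s-n}(A,A)` of Hochschild cochains of cohomological degree `s` and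
vertical degree `r`. The component `c n` has arity `n ≥ 0` and lowers the horizontal degree by
`s - n ≥ 0`. -/
def cochains (s r : ℤ) : Submodule k ((n : ℕ) → Multi k M M n) where
  carrier := {c | ∀ n : ℕ, IsHomog 𝒜 𝒜 (c n) (s - n) r ∧ (s < n → c n = 0)}
  add_mem' {c c'} hc hc' n :=
    ⟨fun d x hx => Submodule.add_mem _ ((hc n).1 d x hx) ((hc' n).1 d x hx), fun h => by
      rw [Pi.add_apply, (hc n).2 h, (hc' n).2 h, add_zero]⟩
  zero_mem' n := ⟨fun _ _ _ => Submodule.zero_mem _, fun _ => rfl⟩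
  smul_mem' a c hc n :=
    ⟨fun d x hx => Submodule.smul_mem _ a ((hc n).1 d x hx), fun h => by
      rw [Pi.smul_apply, (hc n).2 h, smul_zero]⟩

variable [DirectSum.Decomposition 𝒜]

/-- The Hochschild differential of a bidga with multiplication `μ = m_{02}`, horizontal
differential `∂ = m_{11}` and zero vertical differential, on cochains of degree `s` and vertical
degree `r`. On `f ∈ C^{n,r}_κ(A,A)`, `κ = s - n`, it is `D f = (-1)^κ [μ, f] + [∂, f]`, where
`μ ∈ C^{2,0}_0(A,A)` and `∂ ∈ C^{1,0}_1(A,A)`. -/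
noncomputable def hochD (μ : Multi k M M 2) (del : Multi k M M 1) (s r : ℤ) :
    ((n : ℕ) → Multi k M M n) →ₗ[k] ((n : ℕ) → Multi k M M n) :=
  LinearMap.pi fun n =>
    match n with
    | 0 => bracket 𝒜 (a := 0) (by omega) del 0 1 r s ∘ₗ LinearMap.proj 0
    | n + 1 =>
      (s - n).negOnePow •
          (bracket 𝒜 (a := n + 1) (by omega) μ 0 0 r (s - n) ∘ₗ LinearMap.proj n)
        + bracket 𝒜 (a := n + 1) (by omega) del 0 1 r (s - (n + 1)) ∘ₗ LinearMap.proj (n + 1)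

/-- Hochschild cocycles of degree `s` and vertical degree `r`. -/
noncomputable def cocycles (μ : Multi k M M 2) (del : Multi k M M 1) (s r : ℤ) :
    Submodule k ((n : ℕ) → Multi k M M n) :=
  cochains 𝒜 s r ⊓ LinearMap.ker (hochD 𝒜 μ del s r)

/-- Hochschild coboundaries of degree `s` and vertical degree `r`. -/
noncomputable def coboundaries (μ : Multi k M M 2) (del : Multi k M M 1) (s r : ℤ) :
    Submodule k ((n : ℕ) → Multi k M M n) :=
  (cochains 𝒜 (s - 1) r).map (hochD 𝒜 μ del (s - 1) r)

/-- The Hochschild cohomology `HH^{s,r}_{bidga}(A,A)` of a bidga with multiplication `μ`,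
horizontal differential `del` and zero vertical differential. -/
abbrev HH (μ : Multi k M M 2) (del : Multi k M M 1) (s r : ℤ) : Type _ :=
  cocycles 𝒜 μ del s r ⧸
    (coboundaries 𝒜 μ del s r).submoduleOf (cocycles 𝒜 μ del s r)

end Hochschild

section Structures

/-- A strictly unital derived A-infinity structure on the bigraded module `𝒜`. -/
structure DAInf (𝒜 : ℕ × ℤ → Submodule k M) [DirectSum.Decomposition 𝒜] where
  /-- The structure maps `m_{ij} : A^{⊗ j} ⟶ A`, for `i ≥ 0` and `j ≥ 1`. -/
  m : (i j : ℕ) → Multi k M M j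
  /-- The image of `1` under the unit map `η : k ⟶ A`. -/
  unit : M
  /-- There are no operations of arity `0`. -/
  m_zero : ∀ i, m i 0 = 0
  m_homog : ∀ i j, IsHomog 𝒜 𝒜 (m i j) i (2 - ((i : ℤ) + j))
  /-- `∑ (-1)^{rq+t+pj} m_{ij} (1^{⊗ r} ⊗ m_{pq} ⊗ 1^{⊗ t}) = 0`, the sum being over `u = i + p`,
  `v = j + q - 1`, `j = 1 + r + t`. -/
  relation : ∀ u v : ℕ, 1 ≤ v → ∀ x : ℕ → M,
    ∑ ip ∈ antidiagonal u, ∑ jq ∈ antidiagonal (v + 1), ∑ r : Fin jq.1,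
      (-1 : ℤ) ^ ((r : ℕ) * jq.2 + (jq.1 - 1 - r) + ip.2 * jq.1) •
        ins 𝒜 (m ip.1 jq.1) (m ip.2 jq.2) ip.2 (2 - ((ip.2 : ℤ) + jq.2)) r x = 0
  unit_mem : unit ∈ 𝒜 (0, 0)
  m01_unit : m 0 1 ![unit] = 0
  unit_mul : ∀ x, m 0 2 ![unit, x] = x
  mul_unit : ∀ x, m 0 2 ![x, unit] = x
  m_unit : ∀ i j, 3 ≤ i + j → ∀ (x : Fin j → M) (l : Fin j), x l = unit → m i j x = 0

/-- A bidga is a derived A-infinity algebra with `m_{ij} = 0` for `i + j ≥ 3`. -/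
def DAInf.IsBidga {𝒜 : ℕ × ℤ → Submodule k M} [DirectSum.Decomposition 𝒜] (A : DAInf 𝒜) :
    Prop :=
  ∀ i j, 3 ≤ i + j → A.m i j = 0

/-- The arguments `(f_{p_1 q_1} ⊗ ⋯ ⊗ f_{p_j q_j})(x 0 ⊗ x 1 ⊗ ⋯)`, where `f_{st}` has bidegree
`(s, 1 - (s + t))`. Block `w` of `x` consists of `q_w` entries starting at `q_1 + ⋯ + q_{w-1}`;
it gets the Koszul sign of passing all `f_{p_a q_a}` with `a > w`. -/
noncomputable def tensorArgs (𝒜 : ℕ × ℤ → Submodule k M) [DirectSum.Decomposition 𝒜]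
    (f : (s t : ℕ) → Multi k M N t) {j : ℕ} (p q : Fin j → ℕ) (x : ℕ → M) : Fin j → N :=
  fun w => f (p w) (q w) fun l : Fin (q w) =>
    signOp 𝒜 (∑ a ∈ Finset.Ioi w, (p a : ℤ)) (∑ a ∈ Finset.Ioi w, (1 - ((p a : ℤ) + q a)))
      (x ((∑ b ∈ Finset.Iio w, q b) + l))

/-- The exponent
`ε = u + ∑_{w=1}^{j-1} (j p_w + w (q_{j-w} - p_w) + q_{j-w} ∑_{s=j-w+1}^{j} (p_s + q_s))`;
collecting terms and counting from `0`, the coefficient of `p_b + q_b` in the linear part is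
`j - 1 - b`. -/
def eps (u : ℕ) {j : ℕ} (p q : Fin j → ℕ) : ℕ :=
  u + (∑ b : Fin j, (j - 1 - (b : ℕ)) * (p b + q b))
    + ∑ b : Fin j, q b * ∑ a ∈ Finset.Ioi b, (p a + q a)

/-- A morphism of strictly unital derived A-infinity algebras. -/
structure DAInfHom {𝒜 : ℕ × ℤ → Submodule k M} [DirectSum.Decomposition 𝒜]
    {ℬ : ℕ × ℤ → Submodule k N} [DirectSum.Decomposition ℬ] (A : DAInf 𝒜) (B : DAInf ℬ) where
  /-- The components `f_{st} : A^{⊗ t} ⟶ B`, for `s ≥ 0` and `t ≥ 1`. -/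
  f : (s t : ℕ) → Multi k M N t
  /-- There are no components of arity `0`. -/
  f_zero : ∀ s, f s 0 = 0
  f_homog : ∀ s t, IsHomog 𝒜 ℬ (f s t) s (1 - ((s : ℤ) + t))
  /-- `∑ (-1)^{rq+t+pj} f_{ij} (1^{⊗ r} ⊗ m_{pq} ⊗ 1^{⊗ t})`, over `u = i + p`, `v = j + q - 1`,
  `j = 1 + r + t`, equals `∑ (-1)^ε m'_{ij} (f_{p_1 q_1} ⊗ ⋯ ⊗ f_{p_j q_j})`, over
  `u = i + p_1 + ⋯ + p_j`, `v = q_1 + ⋯ + q_j` (with all `q_w ≥ 1`). -/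
  relation : ∀ u v : ℕ, 1 ≤ v → ∀ x : ℕ → M,
    ∑ ip ∈ antidiagonal u, ∑ jq ∈ antidiagonal (v + 1), ∑ r : Fin jq.1,
      (-1 : ℤ) ^ ((r : ℕ) * jq.2 + (jq.1 - 1 - r) + ip.2 * jq.1) •
        ins 𝒜 (f ip.1 jq.1) (A.m ip.2 jq.2) ip.2 (2 - ((ip.2 : ℤ) + jq.2)) r x =
    ∑ ip ∈ antidiagonal u, ∑ j ∈ Finset.Icc 1 v,
      ∑ p ∈ Finset.Nat.antidiagonalTuple j ip.2,
        ∑ q ∈ (Finset.Nat.antidiagonalTuple j v).filter fun q => ∀ w, 1 ≤ q w,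
          (-1 : ℤ) ^ eps u p q • B.m ip.1 j (tensorArgs 𝒜 f p q x)
  f_unit : f 0 1 ![A.unit] = B.unit
  f_unit_zero : ∀ i j, 2 ≤ i + j → ∀ (x : Fin j → M) (l : Fin j), x l = A.unit → f i j x = 0

end Structures

section Homology

/-- The homology `ker d / im d` of a differential `d`. -/
abbrev Homology (d : M →ₗ[k] M) : Type _ :=
  LinearMap.ker d ⧸ (LinearMap.range d).submoduleOf (LinearMap.ker d)

/-- The map induced on homology by a chain map. -/
noncomputable def homologyMap {d : M →ₗ[k] M} {d' : N →ₗ[k] N} (g : M →ₗ[k] N)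
    (hg : ∀ x, g (d x) = d' (g x)) : Homology d →ₗ[k] Homology d' :=
  Submodule.mapQ _ _
    (g.restrict (p := LinearMap.ker d) (q := LinearMap.ker d') fun x hx => by
      rw [LinearMap.mem_ker] at hx ⊢
      rw [← hg, hx, map_zero])
    (by
      rintro ⟨x, hx⟩ ⟨y, hy⟩
      exact ⟨g y, by rw [← hg, hy]; rfl⟩)

/-- A map of arity one as a linear map. -/
def lin (f : Multi k M N 1) : M →ₗ[k] N where
  toFun x := f fun _ => x
  map_add' x y := by
    have h := f.map_update_add (fun _ => 0) 0 x y
    have e : ∀ z : M, Function.update (fun _ : Fin 1 => (0 : M)) 0 z = fun _ => z := fun z => by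
      funext l
      rw [Subsingleton.elim l 0, Function.update_self]
    simpa only [e] using h
  map_smul' c x := by
    have h := f.map_update_smul (fun _ => 0) 0 c x
    have e : ∀ z : M, Function.update (fun _ : Fin 1 => (0 : M)) 0 z = fun _ => z := fun z => by
      funext l
      rw [Subsingleton.elim l 0, Function.update_self]
    simpa only [e, RingHom.id_apply] using h

variable {𝒜 : ℕ × ℤ → Submodule k M} [DirectSum.Decomposition 𝒜]
variable {ℬ : ℕ × ℤ → Submodule k N} [DirectSum.Decomposition ℬ]

theorem insArgs_one (g : Multi k M M 1) (s t : ℤ) (r : Fin 1) (x : ℕ → M) :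
    insArgs 𝒜 g s t r x = fun _ => lin g (x 0) := by
  funext l
  obtain rfl : l = 0 := Subsingleton.elim _ _
  obtain rfl : r = 0 := Subsingleton.elim _ _
  simp only [insArgs, lt_irrefl, if_false, if_true, lin, LinearMap.coe_mk, AddHom.coe_mk]
  congr 1
  funext c
  obtain rfl : c = 0 := Subsingleton.elim _ _
  rfl

theorem ins_zero_right {j q : ℕ} (f : Multi k M N j) (s t : ℤ) (r : Fin j) (x : ℕ → M) :
    ins 𝒜 f (0 : Multi k M M q) s t r x = 0 := by
  unfold ins
  rw [insArgs_eq]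
  exact f.map_update_zero _ _

theorem ins_one (f : Multi k M N 1) (g : Multi k M M 1) (s t : ℤ) (r : Fin 1) (x : ℕ → M) :
    ins 𝒜 f g s t r x = lin f (lin g (x 0)) := by
  rw [ins, insArgs_one]
  rfl

theorem signOp_zero (x : M) : signOp 𝒜 0 0 x = x := by
  have h : (DirectSum.toModule k (ℕ × ℤ) M fun d =>
      ((d.1 : ℤ) * 0 + d.2 * 0).negOnePow • (𝒜 d).subtype) =
      (DirectSum.decomposeLinearEquiv 𝒜).symm.toLinearMap := by
    ext d y
    simp
  rw [signOp, h]
  simp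

theorem tensorArgs_one (f : (s t : ℕ) → Multi k M N t) (p : ℕ) (x : ℕ → M) :
    tensorArgs 𝒜 f ![p] ![1] x = fun _ => lin (f p 1) (x 0) := by
  funext l
  obtain rfl : l = 0 := Subsingleton.elim _ _
  have h1 : Finset.Ioi (0 : Fin 1) = ∅ := by decide
  have h2 : Finset.Iio (0 : Fin 1) = ∅ := by decide
  change f p 1 (fun l : Fin 1 => _) = f p 1 _
  congr 1
  funext c
  obtain rfl : c = 0 := Subsingleton.elim _ _
  rw [h1, h2]
  exact signOp_zero _

theorem eps_one (u p : ℕ) : eps u ![p] ![1] = u := by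
  simp [eps]

/-- The vertical and the horizontal differential commute. -/
theorem DAInf.comm_differentials (A : DAInf 𝒜) (x : M) :
    lin (A.m 1 1) (lin (A.m 0 1) x) = lin (A.m 0 1) (lin (A.m 1 1) x) := by
  have h := A.relation 1 1 le_rfl (fun _ => x)
  simp [Finset.Nat.antidiagonal_succ, A.m_zero, ins_zero_right, ins_one] at h
  rwa [neg_add_eq_zero, eq_comm] at h

theorem DAInfHom.comm_vertical {A : DAInf 𝒜} {B : DAInf ℬ} (F : DAInfHom A B) (x : M) :
    lin (F.f 0 1) (lin (A.m 0 1) x) = lin (B.m 0 1) (lin (F.f 0 1) x) := by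
  have h := F.relation 0 1 le_rfl (fun _ => x)
  simp [Finset.Nat.antidiagonal_succ, A.m_zero, ins_zero_right, ins_one,
    Finset.filter_singleton, tensorArgs_one, eps_one] at h
  exact h

theorem DAInfHom.comm_horizontal {A : DAInf 𝒜} {B : DAInf ℬ} (F : DAInfHom A B) (x : M) :
    lin (F.f 1 1) (lin (A.m 0 1) x) - lin (F.f 0 1) (lin (A.m 1 1) x) =
      - (lin (B.m 1 1) (lin (F.f 0 1) x) + lin (B.m 0 1) (lin (F.f 1 1) x)) := by
  have h := F.relation 1 1 le_rfl (fun _ => x)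
  simp [Finset.Nat.antidiagonal_succ, A.m_zero, ins_zero_right, ins_one,
    Finset.filter_singleton, tensorArgs_one, eps_one] at h
  rw [sub_eq_add_neg, add_comm, h, neg_add]
  rfl

/-- The vertical homology `H_ver(A)`. -/
abbrev DAInf.HVer (A : DAInf 𝒜) : Type _ := Homology (lin (A.m 0 1))

/-- The horizontal differential on `H_ver(A)` induced by `m_{11}`. -/
noncomputable def DAInf.dHor (A : DAInf 𝒜) : A.HVer →ₗ[k] A.HVer :=
  homologyMap (lin (A.m 1 1)) A.comm_differentials

/-- `H_hor(H_ver(A))`. -/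
abbrev DAInf.E2 (A : DAInf 𝒜) : Type _ := Homology A.dHor

/-- `H_ver(f_{01})`. -/
noncomputable def DAInfHom.hVer {A : DAInf 𝒜} {B : DAInf ℬ} (F : DAInfHom A B) :
    A.HVer →ₗ[k] B.HVer :=
  homologyMap (lin (F.f 0 1)) F.comm_vertical

theorem DAInfHom.hVer_comm {A : DAInf 𝒜} {B : DAInf ℬ} (F : DAInfHom A B) (x : A.HVer) :
    F.hVer (A.dHor x) = B.dHor (F.hVer x) := by
  obtain ⟨⟨x, hx⟩, rfl⟩ := Submodule.Quotient.mk_surjective _ x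
  refine (Submodule.Quotient.eq _).2 ⟨lin (F.f 1 1) x, ?_⟩
  have h := F.comm_horizontal x
  rw [LinearMap.mem_ker] at hx
  rw [hx, map_zero, zero_sub, neg_inj] at h
  change _ = lin (F.f 0 1) (lin (A.m 1 1) x) - lin (B.m 1 1) (lin (F.f 0 1) x)
  rw [h, add_sub_cancel_left]

/-- `H_hor(H_ver(f_{01}))`. -/
noncomputable def DAInfHom.e2Map {A : DAInf 𝒜} {B : DAInf ℬ} (F : DAInfHom A B) :
    A.E2 →ₗ[k] B.E2 :=
  homologyMap F.hVer F.hVer_comm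

/-- A morphism is an `E_2`-equivalence if `H_hor(H_ver(f_{01}))` is an isomorphism. -/
def DAInfHom.IsE2Equivalence {A : DAInf 𝒜} {B : DAInf ℬ} (F : DAInfHom A B) : Prop :=
  Function.Bijective F.e2Map

end Homology

end DerivedAInf

/-! The proof is obstruction theory, filtered by the weight `u + v` of a component of horizontal
degree `u` and arity `v`. Starting from the identity, a morphism to the trivial structure is built
one weight at a time, and the obstruction at each stage is a class in the vanishing Hochschild
cohomology.

Signs are tamed by evaluating operations on words of letters that carry formal degrees. After the
shift `hat`, Koszul signs depend only on total degree: a derived A-infinity structure is an odd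
family `m` with `act m m = 0`, where `act φ m` is the sum of all insertions of `m` into `φ`. Since
the target is a bidga with product `μ` and differential `∂`, a family `f` is a morphism exactly when
its curvature `κ(f) = f·m - ∂f - f*f` vanishes; here `f·m` is `act f m` and `*` is convolution with
`μ` (`morphism_defect`).

With `D_f φ = φ·m - (-1)^δ (∂φ + f*φ + φ*f)`, three facts carry the induction. The Bianchi identity
is `D_f κ(f) = 0` (`twistedD_curvature`). The effect of a correction is `κ(f + β) = κ(f) + D_f β -
β*β` (`curvature_add`). In lowest weight `D_f` sees only `m_02`, `m_11` and `f_01 = 1`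
(`twistedD_agree`), and there it is the Hochschild differential up to sign (`twistedD_hatCochain`).

If `κ(f)` vanishes up to weight `t + 1`, its part of weight `t + 2` is therefore a cocycle, hence `D
b` for some cochain `b`. Adding `b` to `f` in weight `t + 1` kills it, and `b*b` is of higher weight
because `t ≥ 1` (`IsMorphismUpTo.exists_succ`).

Strict units need care, because `HH` is defined by cochains that need not vanish on units. The
obstruction does vanish on units (`curvature_unit`), and `b` can be changed by coboundaries, one
argument position at a time, until it does too (`exists_normalized`).

Each component is altered at most once, so the construction has a limit. Its component `f_01` is the
identity, which makes it an `E_2`-equivalence. -/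

set_option linter.unusedSimpArgs false

namespace DerivedAInf

open Finset

universe u v w

/-! ### Sums over decompositions of a list -/

section Splits

variable {α : Type*} {M : Type*} [AddCommGroup M]

/-- The sum of `F a b` over all decompositions `l = a ++ b`. -/
def splitSum (F : List α → List α → M) : List α → M
  | [] => F [] []
  | x :: l => F [] (x :: l) + splitSum (fun a b => F (x :: a) b) l

@[simp] theorem splitSum_nil (F : List α → List α → M) : splitSum F [] = F [] [] := rfl

theorem splitSum_cons (F : List α → List α → M) (x : α) (l : List α) :
    splitSum F (x :: l) = F [] (x :: l) + splitSum (fun a b => F (x :: a) b) l := rfl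

theorem splitSum_congr {F G : List α → List α → M} {l : List α}
    (h : ∀ a b, a ++ b = l → F a b = G a b) : splitSum F l = splitSum G l := by
  induction l generalizing F G with
  | nil => exact h [] [] rfl
  | cons x l ih =>
    rw [splitSum_cons, splitSum_cons, h [] (x :: l) rfl,
      ih fun a b hab => h (x :: a) b (by rw [← hab]; rfl)]

theorem splitSum_add (F G : List α → List α → M) (l : List α) :
    splitSum (fun a b => F a b + G a b) l = splitSum F l + splitSum G l := by
  induction l generalizing F G with
  | nil => rfl
  | cons x l ih => simp only [splitSum_cons, ih]; abel

theorem map_splitSum {N : Type*} [AddCommGroup N] (φ : M →+ N) (F : List α → List α → M)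
    (l : List α) : φ (splitSum F l) = splitSum (fun a b => φ (F a b)) l := by
  induction l generalizing F with
  | nil => rfl
  | cons x l ih => simp only [splitSum_cons, map_add, ih]

theorem splitSum_zero (l : List α) : splitSum (fun _ _ => (0 : M)) l = 0 := by
  induction l with
  | nil => rfl
  | cons x l ih => simp only [splitSum_cons, ih, add_zero]

theorem splitSum_eq_zero {F : List α → List α → M} {l : List α}
    (h : ∀ a b, a ++ b = l → F a b = 0) : splitSum F l = 0 :=
  (splitSum_congr h).trans (splitSum_zero l)

theorem splitSum_neg (F : List α → List α → M) (l : List α) :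
    splitSum (fun a b => -F a b) l = -splitSum F l :=
  (map_splitSum (negAddMonoidHom : M →+ M) F l).symm

theorem splitSum_sub (F G : List α → List α → M) (l : List α) :
    splitSum (fun a b => F a b - G a b) l = splitSum F l - splitSum G l := by
  simp only [sub_eq_add_neg, splitSum_add, splitSum_neg]

theorem splitSum_smul (e : ℤˣ) (F : List α → List α → M) (l : List α) :
    splitSum (fun a b => e • F a b) l = e • splitSum F l :=
  (map_splitSum (DistribSMul.toAddMonoidHom M e) F l).symm

theorem splitSum_sum {ι : Type*} (s : Finset ι) (F : ι → List α → List α → M) (l : List α) :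
    splitSum (fun a b => ∑ i ∈ s, F i a b) l = ∑ i ∈ s, splitSum (F i) l := by
  induction l generalizing F with
  | nil => rfl
  | cons x l ih => simp only [splitSum_cons, ih, Finset.sum_add_distrib]

theorem splitSum_comm (F : List α → List α → List α → List α → M) (l l' : List α) :
    splitSum (fun a b => splitSum (fun c d => F a b c d) l') l =
      splitSum (fun c d => splitSum (fun a b => F a b c d) l) l' := by
  induction l generalizing F with
  | nil => rfl
  | cons x l ih => simp only [splitSum_cons, ih, splitSum_add]

/-- Both sides run over the decompositions of `l` into three consecutive blocks. -/
theorem splitSum_assoc (F : List α → List α → List α → M) (l : List α) :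
    splitSum (fun a b => splitSum (fun c d => F c d b) a) l =
      splitSum (fun c b => splitSum (fun d e => F c d e) b) l := by
  induction l generalizing F with
  | nil => rfl
  | cons x l ih =>
    simp only [splitSum_cons, splitSum_nil, splitSum_add, ih]
    abel

theorem splitSum_assoc' (F : List α → List α → List α → List α → M) (l : List α) :
    splitSum (fun a b => splitSum (fun c d => F a b c d) a) l =
      splitSum (fun c b => splitSum (fun d e => F (c ++ d) e c d) b) l := by
  rw [← splitSum_assoc (fun c d e => F (c ++ d) e c d)]
  exact splitSum_congr fun a b _ => splitSum_congr fun c d h => by rw [h]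

/-- The cut falls either to the left or to the right of the marked letter `y`. This separates
operations that reach the letter from those that do not. -/
theorem splitSum_append_cons (F : List α → List α → M) (a : List α) (y : α) (e : List α) :
    splitSum F (a ++ y :: e) = splitSum (fun a1 a2 => F a1 (a2 ++ y :: e)) a +
      splitSum (fun e1 e2 => F (a ++ y :: e1) e2) e := by
  induction a generalizing F with
  | nil => rfl
  | cons x a ih => simp only [List.cons_append, splitSum_cons, ih]; abel

theorem splitSum_eq_sum (F : List α → List α → M) (l : List α) :
    splitSum F l = ∑ n ∈ range (l.length + 1), F (l.take n) (l.drop n) := by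
  induction l generalizing F with
  | nil => simp
  | cons x l ih =>
    rw [splitSum_cons, ih, List.length_cons, Finset.sum_range_succ' _ (l.length + 1), add_comm]
    rfl

/-- Only the decomposition with first part of length `n` contributes. -/
theorem splitSum_eq_single {F : List α → List α → M} {l : List α} (n : ℕ) (hn : n ≤ l.length)
    (h : ∀ a b, a ++ b = l → a.length ≠ n → F a b = 0) :
    splitSum F l = F (l.take n) (l.drop n) := by
  rw [splitSum_eq_sum]
  refine Finset.sum_eq_single_of_mem n (by simpa using Nat.lt_succ_of_le hn) fun m hm hmn => ?_
  refine h _ _ (List.take_append_drop m l) ?_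
  rw [List.length_take]
  simp at hm
  omega

end Splits

/-! ### Reindexing of sums over antidiagonals -/

section Antidiagonal

variable {M : Type*} [AddCommGroup M]

theorem sum_antidiagonal_assoc (F : ℕ → ℕ → ℕ → M) (u : ℕ) :
    ∑ x ∈ antidiagonal u, ∑ y ∈ antidiagonal x.1, F y.1 y.2 x.2 =
      ∑ x ∈ antidiagonal u, ∑ y ∈ antidiagonal x.2, F x.1 y.1 y.2 := by
  induction u generalizing F with
  | zero => simp
  | succ u ih =>
    simp only [Finset.Nat.sum_antidiagonal_succ, Finset.sum_add_distrib,
      ih fun a b c => F (a + 1) b c, add_assoc,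
      Finset.Nat.antidiagonal_zero, Finset.sum_singleton]

theorem sum_antidiagonal_swap' (F : ℕ → ℕ → M) (u : ℕ) :
    ∑ x ∈ antidiagonal u, F x.1 x.2 = ∑ x ∈ antidiagonal u, F x.2 x.1 :=
  (Finset.Nat.sum_antidiagonal_swap (f := fun x => F x.1 x.2)).symm

theorem neg_eq_negOnePow_smul (x : M) : -x = (1 : ℤ).negOnePow • x := by simp

end Antidiagonal

/-- A letter: an element with a formal horizontal degree `i` and a formal vertical degree
`j + 1`. -/
structure Letter (M : Type*) where
  /-- The horizontal degree. -/
  i : ℤ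
  /-- The shifted vertical degree. -/
  j : ℤ
  /-- The element. -/
  val : M

/-! ### Words with formal degrees, their signs, and multiadditive functions -/

section Words

variable {M : Type*}

/-- The horizontal degree of a word. -/
def hdeg (l : List (Letter M)) : ℤ := (l.map Letter.i).sum

/-- The shifted vertical degree of a word. -/
def vdeg (l : List (Letter M)) : ℤ := (l.map Letter.j).sum

@[simp] theorem hdeg_nil : hdeg ([] : List (Letter M)) = 0 := rfl
@[simp] theorem vdeg_nil : vdeg ([] : List (Letter M)) = 0 := rfl
@[simp] theorem hdeg_cons (x : Letter M) (l) : hdeg (x :: l) = x.i + hdeg l := by simp [hdeg]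
@[simp] theorem vdeg_cons (x : Letter M) (l) : vdeg (x :: l) = x.j + vdeg l := by simp [vdeg]
@[simp] theorem hdeg_append (a b : List (Letter M)) : hdeg (a ++ b) = hdeg a + hdeg b := by
  simp [hdeg]
@[simp] theorem vdeg_append (a b : List (Letter M)) : vdeg (a ++ b) = vdeg a + vdeg b := by
  simp [vdeg]

/-- The value `v` of an operation of bidegree `(-p, δ - p)` on the word `c`, as a letter. -/
def outLetter (δ : ℤ) (p : ℕ) (c : List (Letter M)) (v : M) : Letter M :=
  ⟨hdeg c - p, vdeg c + δ - p, v⟩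

@[simp] theorem outLetter_i (δ : ℤ) (p : ℕ) (c : List (Letter M)) (v : M) :
    (outLetter δ p c v).i = hdeg c - p := rfl
@[simp] theorem outLetter_j (δ : ℤ) (p : ℕ) (c : List (Letter M)) (v : M) :
    (outLetter δ p c v).j = vdeg c + δ - p := rfl
@[simp] theorem outLetter_val (δ : ℤ) (p : ℕ) (c : List (Letter M)) (v : M) :
    (outLetter δ p c v).val = v := rfl

/-- The sign of moving an odd operation past the word `a`. -/
def sgn (a : List (Letter M)) : ℤˣ := (hdeg a + vdeg a).negOnePow

@[simp] theorem sgn_nil : sgn ([] : List (Letter M)) = 1 := by simp [sgn]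

theorem sgn_append (a b : List (Letter M)) : sgn (a ++ b) = sgn a * sgn b := by
  simp only [sgn, ← Int.negOnePow_add, hdeg_append, vdeg_append]
  congr 1
  ring

theorem sgn_cons (x : Letter M) (b : List (Letter M)) :
    sgn (x :: b) = (x.i + x.j).negOnePow * sgn b := by
  simp only [sgn, ← Int.negOnePow_add, hdeg_cons, vdeg_cons]
  congr 1
  ring

theorem sgn_mul_self (a : List (Letter M)) : sgn a * sgn a = 1 := Int.units_mul_self _

/-- An operation changes total degree by `δ - 2p`, so only the parity of `δ` matters. This is why
total-degree signs are simpler than bigraded ones. -/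
theorem outLetter_sign (δ : ℤ) (p : ℕ) (c : List (Letter M)) (v : M) :
    ((outLetter δ p c v).i + (outLetter δ p c v).j).negOnePow = δ.negOnePow * sgn c := by
  simp only [sgn, ← Int.negOnePow_add, outLetter_i, outLetter_j, Int.negOnePow_eq_iff]
  grind

variable [AddCommGroup M]

/-- Additivity in every letter. -/
def IsMultiAdd {N : Type*} [AddCommGroup N] (φ : List (Letter M) → N) : Prop :=
  ∀ a i j x y e, φ (a ++ ⟨i, j, x + y⟩ :: e) = φ (a ++ ⟨i, j, x⟩ :: e) + φ (a ++ ⟨i, j, y⟩ :: e)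

/-- A multiadditive function as an additive map of one letter. -/
def IsMultiAdd.hom {N : Type*} [AddCommGroup N] {φ : List (Letter M) → N} (h : IsMultiAdd φ)
    (a : List (Letter M)) (i j : ℤ) (e : List (Letter M)) : M →+ N :=
  AddMonoidHom.mk' (fun x => φ (a ++ ⟨i, j, x⟩ :: e)) fun x y => h a i j x y e

theorem IsMultiAdd.map_zero {N : Type*} [AddCommGroup N] {φ : List (Letter M) → N}
    (h : IsMultiAdd φ) (a : List (Letter M)) (i j : ℤ) (e : List (Letter M)) :
    φ (a ++ ⟨i, j, 0⟩ :: e) = 0 := (h.hom a i j e).map_zero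

theorem IsMultiAdd.map_smul {N : Type*} [AddCommGroup N] {φ : List (Letter M) → N}
    (h : IsMultiAdd φ) (a : List (Letter M)) (i j : ℤ) (e : List (Letter M)) (s : ℤˣ) (x : M) :
    φ (a ++ ⟨i, j, s • x⟩ :: e) = s • φ (a ++ ⟨i, j, x⟩ :: e) := by
  rw [Units.smul_def, Units.smul_def]
  exact map_zsmul (h.hom a i j e) _ _

theorem IsMultiAdd.map_splitSum {N : Type*} [AddCommGroup N] {φ : List (Letter M) → N}
    (h : IsMultiAdd φ) (a : List (Letter M)) (i j : ℤ) (e : List (Letter M)) {α : Type*}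
    (F : List α → List α → M) (l : List α) :
    φ (a ++ ⟨i, j, splitSum F l⟩ :: e) = splitSum (fun b c => φ (a ++ ⟨i, j, F b c⟩ :: e)) l :=
  DerivedAInf.map_splitSum (h.hom a i j e) F l

theorem IsMultiAdd.map_sum {N : Type*} [AddCommGroup N] {φ : List (Letter M) → N}
    (h : IsMultiAdd φ) (a : List (Letter M)) (i j : ℤ) (e : List (Letter M)) {ι : Type*}
    (s : Finset ι) (F : ι → M) :
    φ (a ++ ⟨i, j, ∑ t ∈ s, F t⟩ :: e) = ∑ t ∈ s, φ (a ++ ⟨i, j, F t⟩ :: e) :=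
  _root_.map_sum (h.hom a i j e) F s

end Words

/-! ### Insertion of odd operations and the pre-Lie identity -/

section Insertions

variable {M : Type*} [AddCommGroup M]

/-- The sum of all insertions of the odd operation `g` of bidegree `(-p, 1 - p)` into `φ`. -/
def insSum (p : ℕ) (φ g : List (Letter M) → M) (l : List (Letter M)) : M :=
  splitSum (fun a b => splitSum
    (fun c e => sgn a • φ (a ++ outLetter 1 p c (g c) :: e)) b) l

/-- Relative to `y`, the inserted operation lies to the left, swallows `y`, or lies to the right; in
the last case it has moved past `a` and `y`. -/
theorem insSum_append_cons (p : ℕ) (φ g : List (Letter M) → M) (a : List (Letter M))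
    (y : Letter M) (e : List (Letter M)) :
    insSum p φ g (a ++ y :: e) = insSum p (fun l => φ (l ++ y :: e)) g a +
      splitSum (fun a1 a2 => splitSum (fun e1 e2 => sgn a1 • φ (a1 ++
        outLetter 1 p (a2 ++ y :: e1) (g (a2 ++ y :: e1)) :: e2)) e) a +
      sgn (a ++ [y]) • insSum p (fun l => φ (a ++ y :: l)) g e := by
  simp only [insSum, splitSum_append_cons, splitSum_add, ← splitSum_smul]
  congr 1
  · simp only [List.append_assoc, List.cons_append]
  · refine splitSum_congr fun e1 e2 _ => splitSum_congr fun c d _ => ?_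
    rw [smul_smul, ← sgn_append]
    simp

theorem insSum_add_left (p : ℕ) (φ φ' g : List (Letter M) → M) (l : List (Letter M)) :
    insSum p (fun l => φ l + φ' l) g l = insSum p φ g l + insSum p φ' g l := by
  simp only [insSum, smul_add, splitSum_add]

theorem insSum_sum_left {ι : Type*} (s : Finset ι) (p : ℕ) (φ : ι → List (Letter M) → M)
    (g : List (Letter M) → M) (l : List (Letter M)) :
    insSum p (fun l => ∑ t ∈ s, φ t l) g l = ∑ t ∈ s, insSum p (φ t) g l := by
  simp only [insSum, Finset.smul_sum, splitSum_sum]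

theorem insSum_smul_left (p : ℕ) (s : ℤˣ) (φ g : List (Letter M) → M) (l : List (Letter M)) :
    insSum p (fun l => s • φ l) g l = s • insSum p φ g l := by
  simp only [insSum, ← splitSum_smul, smul_comm s]

theorem insSum_sub_left (p : ℕ) (φ φ' g : List (Letter M) → M) (l : List (Letter M)) :
    insSum p (fun l => φ l - φ' l) g l = insSum p φ g l - insSum p φ' g l := by
  simp only [insSum, smul_sub, splitSum_sub]

/-- Insertions of `g` and, to the right of it, of `h`. -/
def disjointSum (p p' : ℕ) (φ g h : List (Letter M) → M) (l : List (Letter M)) : M :=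
  splitSum (fun a b => splitSum (fun c b2 => splitSum (fun d b3 => splitSum (fun c' e =>
    (sgn c * sgn d) • φ (a ++ outLetter 1 p c (g c) :: (d ++ outLetter 1 p' c' (h c') :: e)))
      b3) b2) b) l

/-- Insertions of an operation with values `v` and bidegree `(-p, 2 - p)`. -/
def evenInsSum (p : ℕ) (φ v : List (Letter M) → M) (l : List (Letter M)) : M :=
  splitSum (fun a b => splitSum (fun c e => φ (a ++ outLetter 2 p c (v c) :: e)) b) l

/-- The pre-Lie identity: `h` is either nested inside `g` or disjoint from it. Exchanging two odd
operations costs a sign, so the two orders of disjoint insertions enter with opposite signs and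
cancel after summation in `act_act`. -/
theorem insSum_insSum (p p' : ℕ) {φ : List (Letter M) → M} (hφ : IsMultiAdd φ)
    (g h : List (Letter M) → M) (l : List (Letter M)) :
    insSum p' (insSum p φ g) h l = evenInsSum (p + p') φ (insSum p' g h) l +
      disjointSum p p' φ g h l - disjointSum p' p φ h g l := by
  -- Terms with `g` to the left of `h`.
  have h1 : splitSum (fun a b => splitSum (fun c e => sgn a •
      insSum p (fun l => φ (l ++ outLetter 1 p' c (h c) :: e)) g a) b) l =
        disjointSum p p' φ g h l := by
    simp only [insSum, ← splitSum_smul]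
    rw [splitSum_congr (G := fun a b => splitSum (fun a1 a2 => splitSum (fun c a3 =>
      splitSum (fun c' e => (sgn c * sgn a3) • φ (a1 ++ outLetter 1 p c (g c) ::
        (a3 ++ outLetter 1 p' c' (h c') :: e))) b) a2) a)]
    · simp only [splitSum_assoc, disjointSum]
    · intro a b _
      rw [splitSum_comm]
      refine splitSum_congr fun a1 a2 ha => ?_
      rw [splitSum_comm]
      refine splitSum_congr fun c a3 ha2 => splitSum_congr fun c' e _ => ?_
      subst ha2 ha
      rw [smul_smul]
      congr 1
      · simp only [sgn_append]
        rw [mul_right_comm, sgn_mul_self, one_mul]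
      · simp
  -- Terms with `g` to the right of `h`. Moving `g` past the output of `h` produces the extra sign,
  -- as `h` is odd.
  have h3 : splitSum (fun a b => splitSum (fun c e => sgn a •
      sgn (a ++ [outLetter 1 p' c (h c)]) •
        insSum p (fun l => φ (a ++ outLetter 1 p' c (h c) :: l)) g e) b) l =
        - disjointSum p' p φ h g l := by
    simp only [insSum, ← splitSum_smul, disjointSum, ← splitSum_neg]
    refine splitSum_congr fun a b _ => splitSum_congr fun c e _ => splitSum_congr fun d e2 _ =>
      splitSum_congr fun c' e3 _ => ?_
    rw [smul_smul, smul_smul, ← Units.neg_smul]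
    congr 1
    rw [sgn_append, sgn_cons, outLetter_sign, ← mul_assoc, ← mul_assoc, sgn_mul_self]
    simp
  -- Terms in which `g` takes the output of `h` as an argument.
  have h2 : splitSum (fun a b => splitSum (fun c e => sgn a •
      splitSum (fun a1 a2 => splitSum (fun e1 e2 => sgn a1 • φ (a1 ++
        outLetter 1 p (a2 ++ outLetter 1 p' c (h c) :: e1)
          (g (a2 ++ outLetter 1 p' c (h c) :: e1)) :: e2)) e) a) b) l =
        evenInsSum (p + p') φ (insSum p' g h) l := by
    have e1 : evenInsSum (p + p') φ (insSum p' g h) l =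
        splitSum (fun a b => splitSum (fun m e => splitSum (fun a2 m2 => splitSum (fun c e1 =>
          sgn a2 • φ (a ++ outLetter 1 p (a2 ++ outLetter 1 p' c (h c) :: e1)
          (g (a2 ++ outLetter 1 p' c (h c) :: e1)) :: e)) m2) m) b) l := by
      refine splitSum_congr fun a b _ => splitSum_congr fun m e _ => ?_
      simp only [insSum, outLetter]
      rw [hφ.map_splitSum]
      refine splitSum_congr fun a2 m2 hm => ?_
      rw [hφ.map_splitSum]
      refine splitSum_congr fun c e1 hm2 => ?_
      rw [hφ.map_smul]
      subst hm2 hm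
      simp only [hdeg_append, hdeg_cons, vdeg_append, vdeg_cons]
      rw [show hdeg a2 + (hdeg c + hdeg e1) - ((p + p' : ℕ) : ℤ) =
          hdeg a2 + (hdeg c - p' + hdeg e1) - p by push_cast; ring,
        show vdeg a2 + (vdeg c + vdeg e1) + 2 - ((p + p' : ℕ) : ℤ) =
          vdeg a2 + (vdeg c + 1 - p' + vdeg e1) + 1 - p by push_cast; ring]
    rw [e1]
    simp only [← splitSum_smul]
    rw [splitSum_congr (G := fun a b => splitSum (fun a1 a2 => splitSum (fun c e =>
      splitSum (fun e1 e2 => sgn a2 • φ (a1 ++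
        outLetter 1 p (a2 ++ outLetter 1 p' c (h c) :: e1)
          (g (a2 ++ outLetter 1 p' c (h c) :: e1)) :: e2)) e) b) a)]
    · simp only [splitSum_assoc]
    · intro a b _
      rw [splitSum_comm]
      refine splitSum_congr fun a1 a2 ha => splitSum_congr fun c e _ => splitSum_congr
        fun e1 e2 _ => ?_
      subst ha
      rw [smul_smul, sgn_append, mul_right_comm, sgn_mul_self, one_mul]
  rw [insSum]
  simp only [insSum_append_cons, smul_add, splitSum_add]
  rw [h1, h2, h3]
  abel

end Insertions

/-! ### Insertion of families of operations -/

section Families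

variable {M : Type*} [AddCommGroup M]

/-- The family of all insertions of the family `m` into the family `φ`. -/
def act (φ m : ℕ → List (Letter M) → M) (u : ℕ) (l : List (Letter M)) : M :=
  ∑ x ∈ antidiagonal u, insSum x.2 (φ x.1) (m x.2) l

theorem evenInsSum_sum {ι : Type*} (s : Finset ι) (p : ℕ) {φ : List (Letter M) → M}
    (hφ : IsMultiAdd φ) (v : ι → List (Letter M) → M) (l : List (Letter M)) :
    evenInsSum p φ (fun c => ∑ t ∈ s, v t c) l = ∑ t ∈ s, evenInsSum p φ (v t) l := by
  simp only [evenInsSum, outLetter, hφ.map_sum, splitSum_sum]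

/-- Inserting a derived A-infinity structure twice gives zero. -/
theorem act_act {φ m : ℕ → List (Letter M) → M} (hφ : ∀ i, IsMultiAdd (φ i)) (u : ℕ)
    (l : List (Letter M)) (hm : ∀ a c e, a ++ c ++ e = l → ∀ u, act m m u c = 0) :
    act (act φ m) m u l = 0 := by
  have h1 : act (act φ m) m u l = ∑ x ∈ antidiagonal u, ∑ y ∈ antidiagonal x.1,
      (evenInsSum (y.2 + x.2) (φ y.1) (insSum x.2 (m y.2) (m x.2)) l +
        disjointSum y.2 x.2 (φ y.1) (m y.2) (m x.2) l -
          disjointSum x.2 y.2 (φ y.1) (m x.2) (m y.2) l) := by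
    refine Finset.sum_congr rfl fun x _ => ?_
    change insSum x.2 (fun l => act φ m x.1 l) (m x.2) l = _
    simp only [act, insSum_sum_left]
    refine Finset.sum_congr rfl fun y _ => ?_
    rw [← insSum_insSum _ _ (hφ _)]
  rw [h1, sum_antidiagonal_assoc (fun i p q => evenInsSum (p + q) (φ i) (insSum q (m p) (m q)) l +
        disjointSum p q (φ i) (m p) (m q) l - disjointSum q p (φ i) (m q) (m p) l)]
  refine Finset.sum_eq_zero fun x _ => ?_
  -- The two sums of disjoint insertions are interchanged by swapping `p` and `q`, so they cancel.
  rw [Finset.sum_sub_distrib, Finset.sum_add_distrib,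
    sum_antidiagonal_swap' (fun p q => disjointSum q p (φ x.1) (m q) (m p) l),
    add_sub_cancel_right]
  have h2 : ∑ y ∈ antidiagonal x.2, evenInsSum (y.1 + y.2) (φ x.1)
      (insSum y.2 (m y.1) (m y.2)) l =
      evenInsSum x.2 (φ x.1) (fun c => act m m x.2 c) l := by
    simp only [act]
    rw [evenInsSum_sum _ _ (hφ _)]
    refine Finset.sum_congr rfl fun y hy => ?_
    rw [mem_antidiagonal.1 hy]
  rw [h2]
  -- In the nested terms the inner factor is `act m m` on a subword, which vanishes.
  refine splitSum_eq_zero fun a b hab => splitSum_eq_zero fun c e hce => ?_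
  simp only [hm a c e (by rw [List.append_assoc, hce, hab])]
  exact (hφ x.1).map_zero _ _ _ _

end Families

/-! ### Convolution with the product and the horizontal differential -/

section Products

variable {M : Type*} [AddCommGroup M] (μ : M →+ M →+ M) (del : M →+ M)

/-- The multiplication of letters, as an odd operation. -/
def letterMul (x y : Letter M) : M := (x.i * y.j + x.j + 1).negOnePow • μ x.val y.val

/-- The horizontal differential of a letter, as an odd operation. -/
def letterDel (x : Letter M) : M := x.j.negOnePow • del x.val

variable {μ} in
theorem mu_smul_left (s : ℤˣ) (x y : M) : μ (s • x) y = s • μ x y := by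
  simp only [Units.smul_def, map_zsmul, AddMonoidHom.zsmul_apply]

variable {μ} in
theorem mu_smul_right (s : ℤˣ) (x y : M) : μ x (s • y) = s • μ x y := by
  simp only [Units.smul_def, map_zsmul]

variable {del} in
theorem del_smul (s : ℤˣ) (x : M) : del (s • x) = s • del x := by
  simp only [Units.smul_def, map_zsmul]

theorem mu_splitSum_left {α : Type*} (F : List α → List α → M) (l : List α) (y : M) :
    μ (splitSum F l) y = splitSum (fun a b => μ (F a b) y) l :=
  map_splitSum (μ.flip y) F l

theorem mu_splitSum_right {α : Type*} (F : List α → List α → M) (l : List α) (x : M) :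
    μ x (splitSum F l) = splitSum (fun a b => μ x (F a b)) l :=
  map_splitSum (μ x) F l

/-- The convolution product of `φ` and `ψ`, of bidegrees `(-i, δ - i)` and `(-p, δ' - p)`. -/
def conv (δ δ' : ℤ) (i p : ℕ) (φ ψ : List (Letter M) → M) (l : List (Letter M)) : M :=
  splitSum (fun a b => ((hdeg a + vdeg a) * δ').negOnePow •
    letterMul μ (outLetter δ i a (φ a)) (outLetter δ' p b (ψ b))) l

/-- Insertion is a derivation of the convolution product. It acts from the right, so it must pass
`ψ` to reach `φ`; hence the sign of `δ'`. -/
theorem insSum_conv (δ δ' : ℤ) (i p q : ℕ) (φ ψ g : List (Letter M) → M)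
    (l : List (Letter M)) :
    insSum q (conv μ δ δ' i p φ ψ) g l =
      δ'.negOnePow • conv μ (δ + 1) δ' (i + q) p (insSum q φ g) ψ l +
        conv μ δ (δ' + 1) i (p + q) φ (insSum q ψ g) l := by
  simp only [insSum, conv, splitSum_append_cons, smul_add, splitSum_add]
  rw [add_comm]
  congr 1
  · simp only [letterMul, outLetter_val, mu_splitSum_left, ← splitSum_smul, splitSum_assoc',
      mu_smul_left, smul_smul]
    refine splitSum_congr fun a b _ => splitSum_congr fun c e _ => splitSum_congr
      fun e1 e2 _ => ?_
    congr 1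
    simp only [sgn, ← Int.negOnePow_add, outLetter_i, outLetter_j, Int.negOnePow_eq_iff,
      hdeg_append, vdeg_append, hdeg_cons, vdeg_cons]
    push_cast
    grind
  · simp only [letterMul, outLetter_val, mu_splitSum_right, ← splitSum_smul,
      mu_smul_right, smul_smul]
    refine (splitSum_congr fun a b _ => splitSum_comm _ _ _).trans ?_
    rw [splitSum_assoc']
    refine splitSum_congr fun a b _ => splitSum_congr fun a1 a2 h => splitSum_congr
      fun c e h2 => ?_
    subst h h2
    congr 1
    simp only [sgn, ← Int.negOnePow_add, outLetter_i, outLetter_j, Int.negOnePow_eq_iff,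
      hdeg_append, vdeg_append, hdeg_cons, vdeg_cons]
    push_cast
    grind

/-- After the shift the product is odd. Associativity therefore holds up to the sign of moving one
product past the other and past `φ`. -/
theorem conv_assoc (hμ : ∀ x y z, μ (μ x y) z = μ x (μ y z)) (δ δ' δ'' : ℤ) (i p q : ℕ)
    (φ ψ χ : List (Letter M) → M) (l : List (Letter M)) :
    conv μ (δ + δ' + 1) δ'' (i + p) q (conv μ δ δ' i p φ ψ) χ l =
      - δ.negOnePow • conv μ δ (δ' + δ'' + 1) i (p + q) φ (conv μ δ' δ'' p q ψ χ) l := by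
  simp only [conv, letterMul, outLetter_val, mu_splitSum_left, mu_splitSum_right, ← splitSum_smul,
    splitSum_assoc', mu_smul_left, mu_smul_right, smul_smul, hμ]
  refine splitSum_congr fun a b _ => splitSum_congr fun c e h => ?_
  subst h
  congr 1
  rw [← neg_one_mul, ← Int.negOnePow_one]
  simp only [← Int.negOnePow_add, outLetter_i, outLetter_j, Int.negOnePow_eq_iff,
      hdeg_append, vdeg_append]
  push_cast
  grind

/-- The Leibniz rule: the odd differential passes the odd product, giving `-1`, and then `φ`, giving
`(-1)^δ`. -/
theorem letterDel_conv (δ δ' : ℤ) (i p : ℕ) (φ ψ : List (Letter M) → M) (l : List (Letter M))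
    (hφ : ∀ a b, a ++ b = l → ∀ y, del (μ (φ a) y) =
      μ (del (φ a)) y + (hdeg a - i).negOnePow • μ (φ a) (del y)) :
    letterDel del (outLetter (δ + δ' + 1) (i + p) l (conv μ δ δ' i p φ ψ l)) =
      - conv μ (δ + 1) δ' (i + 1) p (fun a => letterDel del (outLetter δ i a (φ a))) ψ l
      - δ.negOnePow • conv μ δ (δ' + 1) i (p + 1) φ
          (fun a => letterDel del (outLetter δ' p a (ψ a))) l := by
  rw [neg_eq_negOnePow_smul, sub_eq_add_neg, ← Units.neg_smul]
  simp only [conv, letterDel, letterMul, outLetter_val, map_splitSum, ← splitSum_smul,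
    ← splitSum_add, mu_smul_left, mu_smul_right, smul_smul, del_smul]
  refine splitSum_congr fun a b h => ?_
  rw [hφ a b h]
  subst h
  rw [smul_add, smul_smul, ← neg_one_mul (Int.negOnePow δ), ← Int.negOnePow_one]
  simp only [← Int.negOnePow_add, outLetter_i, outLetter_j]
  congr 2
  · simp only [Int.negOnePow_eq_iff, hdeg_append, vdeg_append]
    push_cast
    grind
  · simp only [Int.negOnePow_eq_iff, hdeg_append, vdeg_append]
    push_cast
    grind

end Products

/-! ### Curvature, the twisted differential and the Bianchi identity -/

section FamilyProducts

variable {M : Type*} [AddCommGroup M] (μ : M →+ M →+ M) (del : M →+ M)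

/-- Families of functions of words, indexed by the horizontal degree. -/
abbrev Family (M : Type*) := ℕ → List (Letter M) → M

/-- The convolution product of families. -/
def convFam (δ δ' : ℤ) (φ ψ : Family M) : Family M := fun u l =>
  ∑ x ∈ antidiagonal u, conv μ δ δ' x.1 x.2 (φ x.1) (ψ x.2) l

/-- The horizontal differential of the values of a family. -/
def delFam (δ : ℤ) (φ : Family M) : Family M
  | 0, _ => 0
  | u + 1, l => letterDel del (outLetter δ u l (φ u l))

theorem act_add (φ φ' m : Family M) : act (φ + φ') m = act φ m + act φ' m := by
  funext u l
  simp only [act, Pi.add_apply, ← Finset.sum_add_distrib, ← insSum_add_left]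
  rfl

theorem act_sub (φ φ' m : Family M) : act (φ - φ') m = act φ m - act φ' m := by
  funext u l
  simp only [act, Pi.sub_apply, ← Finset.sum_sub_distrib, ← insSum_sub_left]
  rfl

theorem act_smul (s : ℤˣ) (φ m : Family M) : act (s • φ) m = s • act φ m := by
  funext u l
  simp only [act, Pi.smul_apply, Finset.smul_sum, ← insSum_smul_left]
  rfl

theorem delFam_add (δ : ℤ) (φ φ' : Family M) :
    delFam del δ (φ + φ') = delFam del δ φ + delFam del δ φ' := by
  funext u l
  cases u <;> simp [delFam, letterDel]

theorem delFam_sub (δ : ℤ) (φ φ' : Family M) :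
    delFam del δ (φ - φ') = delFam del δ φ - delFam del δ φ' := by
  funext u l
  cases u <;> simp [delFam, letterDel, smul_sub]

theorem delFam_smul (δ : ℤ) (s : ℤˣ) (φ : Family M) :
    delFam del δ (s • φ) = s • delFam del δ φ := by
  funext u l
  cases u <;> simp [delFam, letterDel, del_smul, smul_smul, mul_comm]

theorem convFam_add_left (δ δ' : ℤ) (φ φ' ψ : Family M) :
    convFam μ δ δ' (φ + φ') ψ = convFam μ δ δ' φ ψ + convFam μ δ δ' φ' ψ := by
  funext u l
  simp [convFam, conv, letterMul, Finset.sum_add_distrib, splitSum_add]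

theorem convFam_add_right (δ δ' : ℤ) (φ ψ ψ' : Family M) :
    convFam μ δ δ' φ (ψ + ψ') = convFam μ δ δ' φ ψ + convFam μ δ δ' φ ψ' := by
  funext u l
  simp [convFam, conv, letterMul, Finset.sum_add_distrib, splitSum_add]

theorem convFam_sub_left (δ δ' : ℤ) (φ φ' ψ : Family M) :
    convFam μ δ δ' (φ - φ') ψ = convFam μ δ δ' φ ψ - convFam μ δ δ' φ' ψ := by
  funext u l
  simp [convFam, conv, letterMul, Finset.sum_sub_distrib, splitSum_sub, smul_sub]

theorem convFam_sub_right (δ δ' : ℤ) (φ ψ ψ' : Family M) :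
    convFam μ δ δ' φ (ψ - ψ') = convFam μ δ δ' φ ψ - convFam μ δ δ' φ ψ' := by
  funext u l
  simp [convFam, conv, letterMul, Finset.sum_sub_distrib, splitSum_sub, smul_sub]

theorem convFam_smul_left (δ δ' : ℤ) (s : ℤˣ) (φ ψ : Family M) :
    convFam μ δ δ' (s • φ) ψ = s • convFam μ δ δ' φ ψ := by
  funext u l
  simp only [convFam, conv, letterMul, Finset.smul_sum, Pi.smul_apply, ← splitSum_smul,
    outLetter_val, mu_smul_left, smul_smul, outLetter_i, outLetter_j]
  simp only [mul_comm, mul_left_comm]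

theorem convFam_smul_right (δ δ' : ℤ) (s : ℤˣ) (φ ψ : Family M) :
    convFam μ δ δ' φ (s • ψ) = s • convFam μ δ δ' φ ψ := by
  funext u l
  simp only [convFam, conv, letterMul, Finset.smul_sum, Pi.smul_apply, ← splitSum_smul,
    outLetter_val, mu_smul_right, smul_smul, outLetter_i, outLetter_j]
  simp only [mul_comm, mul_left_comm]

theorem conv_sum_left {ι : Type*} (s : Finset ι) (δ δ' : ℤ) (i p : ℕ)
    (φ : ι → List (Letter M) → M) (ψ : List (Letter M) → M) (l : List (Letter M)) :
    conv μ δ δ' i p (fun l => ∑ t ∈ s, φ t l) ψ l = ∑ t ∈ s, conv μ δ δ' i p (φ t) ψ l := by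
  simp [conv, letterMul, Finset.smul_sum, splitSum_sum]

theorem conv_sum_right {ι : Type*} (s : Finset ι) (δ δ' : ℤ) (i p : ℕ)
    (φ : List (Letter M) → M) (ψ : ι → List (Letter M) → M) (l : List (Letter M)) :
    conv μ δ δ' i p φ (fun l => ∑ t ∈ s, ψ t l) l = ∑ t ∈ s, conv μ δ δ' i p φ (ψ t) l := by
  simp [conv, letterMul, Finset.smul_sum, splitSum_sum]

/-- This is `insSum_conv` summed over all ways to distribute the horizontal degree among `φ`, `ψ`
and `m`; only reindexing of triples is added. -/
theorem act_convFam (δ δ' : ℤ) (φ ψ m : Family M) :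
    act (convFam μ δ δ' φ ψ) m = δ'.negOnePow • convFam μ (δ + 1) δ' (act φ m) ψ +
      convFam μ δ (δ' + 1) φ (act ψ m) := by
  funext u l
  have h : act (convFam μ δ δ' φ ψ) m u l = ∑ x ∈ antidiagonal u, ∑ y ∈ antidiagonal x.1,
      (δ'.negOnePow • conv μ (δ + 1) δ' (y.1 + x.2) y.2 (insSum x.2 (φ y.1) (m x.2)) (ψ y.2) l +
        conv μ δ (δ' + 1) y.1 (y.2 + x.2) (φ y.1) (insSum x.2 (ψ y.2) (m x.2)) l) := by
    refine Finset.sum_congr rfl fun x _ => ?_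
    change insSum x.2 (fun l => convFam μ δ δ' φ ψ x.1 l) (m x.2) l = _
    simp only [convFam, insSum_sum_left]
    exact Finset.sum_congr rfl fun y _ => insSum_conv _ _ _ _ _ _ _ _ _ _
  rw [h]
  simp only [Finset.sum_add_distrib, ← Finset.smul_sum]
  rw [Pi.add_apply, Pi.add_apply, Pi.smul_apply, Pi.smul_apply]
  congr 1
  · congr 1
    rw [sum_antidiagonal_assoc (fun a b c => conv μ (δ + 1) δ' (a + c) b
      (insSum c (φ a) (m c)) (ψ b) l)]
    have h2 : ∀ x ∈ antidiagonal u,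
        conv μ (δ + 1) δ' x.1 x.2 (act φ m x.1) (ψ x.2) l = ∑ y ∈ antidiagonal x.1,
          conv μ (δ + 1) δ' (y.1 + y.2) x.2 (insSum y.2 (φ y.1) (m y.2)) (ψ x.2) l := by
      intro x _
      change conv μ (δ + 1) δ' x.1 x.2 (fun l => act φ m x.1 l) (ψ x.2) l = _
      simp only [act, conv_sum_left]
      exact Finset.sum_congr rfl fun y hy => by rw [mem_antidiagonal.1 hy]
    rw [convFam, Finset.sum_congr rfl h2,
      sum_antidiagonal_assoc (fun a b c => conv μ (δ + 1) δ' (a + b) c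
        (insSum b (φ a) (m b)) (ψ c) l)]
    exact Finset.sum_congr rfl fun x _ => sum_antidiagonal_swap' (fun p q =>
      conv μ (δ + 1) δ' (x.1 + q) p (insSum q (φ x.1) (m q)) (ψ p) l) _
  · rw [sum_antidiagonal_assoc (fun a b c => conv μ δ (δ' + 1) a (b + c) (φ a)
      (insSum c (ψ b) (m c)) l)]
    refine Finset.sum_congr rfl fun x _ => ?_
    change _ = conv μ δ (δ' + 1) x.1 x.2 (φ x.1) (fun l => act ψ m x.2 l) l
    simp only [act, conv_sum_right]
    exact Finset.sum_congr rfl fun y hy => by rw [mem_antidiagonal.1 hy]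

theorem convFam_assoc (hμ : ∀ x y z, μ (μ x y) z = μ x (μ y z)) (δ δ' δ'' : ℤ)
    (φ ψ χ : Family M) :
    convFam μ (δ + δ' + 1) δ'' (convFam μ δ δ' φ ψ) χ =
      - δ.negOnePow • convFam μ δ (δ' + δ'' + 1) φ (convFam μ δ' δ'' ψ χ) := by
  funext u l
  have h1 : ∀ x ∈ antidiagonal u, conv μ (δ + δ' + 1) δ'' x.1 x.2 (convFam μ δ δ' φ ψ x.1)
      (χ x.2) l = ∑ y ∈ antidiagonal x.1, - δ.negOnePow • conv μ δ (δ' + δ'' + 1) y.1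
        (y.2 + x.2) (φ y.1) (conv μ δ' δ'' y.2 x.2 (ψ y.2) (χ x.2)) l := by
    intro x _
    change conv μ (δ + δ' + 1) δ'' x.1 x.2 (fun l => convFam μ δ δ' φ ψ x.1 l) (χ x.2) l = _
    simp only [convFam, conv_sum_left]
    refine Finset.sum_congr rfl fun y hy => ?_
    rw [← conv_assoc μ hμ, mem_antidiagonal.1 hy]
  rw [convFam, Finset.sum_congr rfl h1, sum_antidiagonal_assoc (fun a b c => - δ.negOnePow •
    conv μ δ (δ' + δ'' + 1) a (b + c) (φ a) (conv μ δ' δ'' b c (ψ b) (χ c)) l)]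
  rw [Pi.smul_apply, Pi.smul_apply, convFam, Finset.smul_sum]
  refine Finset.sum_congr rfl fun x _ => ?_
  change _ = - δ.negOnePow • conv μ δ (δ' + δ'' + 1) x.1 x.2 (φ x.1)
    (fun l => convFam μ δ' δ'' ψ χ x.2 l) l
  simp only [convFam, conv_sum_right, Finset.smul_sum]
  exact Finset.sum_congr rfl fun y hy => by rw [mem_antidiagonal.1 hy]

theorem act_delFam (δ : ℤ) (φ m : Family M) :
    act (delFam del δ φ) m = delFam del (δ + 1) (act φ m) := by
  funext u l
  cases u with
  | zero => simp [act, delFam, insSum, splitSum_zero]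
  | succ u =>
    simp only [delFam, act, letterDel, outLetter_val, _root_.map_sum, Finset.smul_sum,
      Finset.Nat.sum_antidiagonal_succ]
    have h0 : insSum (u + 1) (delFam del δ φ 0) (m (u + 1)) l = 0 := by
      simp only [insSum, delFam, smul_zero, splitSum_zero]
    rw [h0, zero_add]
    refine Finset.sum_congr rfl fun x hx => ?_
    rw [HasAntidiagonal.mem_antidiagonal] at hx
    simp only [insSum, delFam, letterDel, map_splitSum, ← splitSum_smul, smul_smul, del_smul,
      outLetter_val]
    refine splitSum_congr fun a b h => splitSum_congr fun c e h2 => ?_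
    subst hx h h2
    congr 1
    simp only [sgn, ← Int.negOnePow_add, outLetter_i, outLetter_j, Int.negOnePow_eq_iff,
      hdeg_append, vdeg_append, hdeg_cons, vdeg_cons]
    push_cast
    grind

/-- The Leibniz rule for products with `φ u a` on the left. -/
def LeibnizAt (φ : Family M) (l : List (Letter M)) : Prop :=
  ∀ u a b, a ++ b = l → ∀ y, del (μ (φ u a) y) =
      μ (del (φ u a)) y + (hdeg a - u).negOnePow • μ (φ u a) (del y)

theorem delFam_convFam (δ δ' : ℤ) (φ ψ : Family M) (u : ℕ) (l : List (Letter M))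
    (hφ : LeibnizAt μ del φ l) :
    delFam del (δ + δ' + 1) (convFam μ δ δ' φ ψ) u l =
      - convFam μ (δ + 1) δ' (delFam del δ φ) ψ u l
        - δ.negOnePow • convFam μ δ (δ' + 1) φ (delFam del δ' ψ) u l := by
  cases u with
  | zero => simp [convFam, conv, delFam, letterMul, splitSum_zero]
  | succ u =>
    have h1 : delFam del (δ + δ' + 1) (convFam μ δ δ' φ ψ) (u + 1) l =
        ∑ x ∈ antidiagonal u, letterDel del (outLetter (δ + δ' + 1) (x.1 + x.2) l
          (conv μ δ δ' x.1 x.2 (φ x.1) (ψ x.2) l)) := by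
      simp only [delFam, convFam, letterDel, outLetter_val, _root_.map_sum, Finset.smul_sum]
      exact Finset.sum_congr rfl fun y hy => by rw [mem_antidiagonal.1 hy]; rfl
    have h2 : convFam μ (δ + 1) δ' (delFam del δ φ) ψ (u + 1) l = ∑ x ∈ antidiagonal u,
        conv μ (δ + 1) δ' (x.1 + 1) x.2 (fun a => letterDel del (outLetter δ x.1 a (φ x.1 a)))
          (ψ x.2) l := by
      rw [convFam, Finset.Nat.sum_antidiagonal_succ]
      simp only [conv, delFam, letterMul, outLetter_val, map_zero, AddMonoidHom.zero_apply,
        smul_zero, splitSum_zero, zero_add]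
    have h3 : convFam μ δ (δ' + 1) φ (delFam del δ' ψ) (u + 1) l = ∑ x ∈ antidiagonal u,
        conv μ δ (δ' + 1) x.1 (x.2 + 1) (φ x.1)
          (fun a => letterDel del (outLetter δ' x.2 a (ψ x.2 a))) l := by
      rw [convFam, Finset.Nat.sum_antidiagonal_succ']
      simp only [conv, delFam, letterMul, outLetter_val, map_zero,
        smul_zero, splitSum_zero, zero_add]
    rw [h1, h2, h3, Finset.smul_sum, ← Finset.sum_neg_distrib, ← Finset.sum_sub_distrib]
    exact Finset.sum_congr rfl fun x _ => letterDel_conv _ _ _ _ _ _ _ _ _ (hφ x.1)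

theorem delFam_delFam (hdel : ∀ x, del (del x) = 0) (δ δ' : ℤ) (φ : Family M) :
    delFam del δ' (delFam del δ φ) = 0 := by
  funext u l
  rcases u with _ | _ | u <;> simp [delFam, letterDel, del_smul, hdel]

/-- The defect of `f` being a morphism from the structure `m` to the bidga `(μ, del)`. -/
def curvature (m f : Family M) : Family M :=
  act f m - delFam del 0 f - convFam μ 0 0 f f

/-- The differential on families of bidegree `(-u, δ - u)` twisted by `f`. -/
def twistedD (m f : Family M) (δ : ℤ) (φ : Family M) : Family M :=
  act φ m - δ.negOnePow • (delFam del δ φ + convFam μ 0 δ f φ + convFam μ δ 0 φ f)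

/-- The Bianchi identity. -/
theorem twistedD_curvature (hμ : ∀ x y z, μ (μ x y) z = μ x (μ y z))
    (hdel : ∀ x, del (del x) = 0) {m f : Family M} (hf : ∀ i, IsMultiAdd (f i)) (u : ℕ)
    (l : List (Letter M)) (hm : ∀ a c e, a ++ c ++ e = l → ∀ u, act m m u c = 0)
    (hl : LeibnizAt μ del f l) : twistedD μ del m f 1 (curvature μ del m f) u l = 0 := by
  -- All terms cancel in pairs: `(f·m)·m` and `∂∂f` vanish, insertion and `∂` are derivations of
  -- `*`, the two cubic terms cancel by shifted associativity, and `∂(f·m)` occurs twice with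
  -- opposite signs.
  have e1 := act_act hf u l hm
  have e2 := congrFun (congrFun (act_convFam μ 0 0 f f m) u) l
  have e3 := congrFun (congrFun (act_delFam del 0 f m) u) l
  have e4 := delFam_convFam μ del 0 0 f f u l hl
  have e5 := congrFun (congrFun (convFam_assoc μ hμ 0 0 0 f f f) u) l
  have e6 := congrFun (congrFun (delFam_delFam del hdel 0 1 f) u) l
  simp only [Int.negOnePow_zero, one_smul, zero_add, Pi.add_apply, Pi.neg_apply,
    Pi.zero_apply] at e2 e3 e4 e5 e6
  simp only [twistedD, curvature, act_sub, delFam_sub, convFam_sub_left, convFam_sub_right,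
    Int.negOnePow_one, Pi.sub_apply, Units.neg_smul, one_smul, Pi.neg_apply, Pi.add_apply,
    e1, e2, e3, e4, e6, e5]
  abel

/-- As for a connection, the square of the differential is the graded commutator with the curvature.
Applied to the identity, whose curvature is zero, it shows that the Hochschild differential squares
to zero. -/
theorem twistedD_twistedD (hμ : ∀ x y z, μ (μ x y) z = μ x (μ y z))
    (hdel : ∀ x, del (del x) = 0) {m f : Family M} (δ : ℤ) {φ : Family M}
    (hφ : ∀ i, IsMultiAdd (φ i)) (u : ℕ)
    (l : List (Letter M)) (hm : ∀ a c e, a ++ c ++ e = l → ∀ u, act m m u c = 0)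
    (hl : LeibnizAt μ del f l) (hl' : LeibnizAt μ del φ l) :
    twistedD μ del m f (δ + 1) (twistedD μ del m f δ φ) u l =
      - convFam μ 1 δ (curvature μ del m f) φ u l
        - δ.negOnePow • convFam μ δ 1 φ (curvature μ del m f) u l := by
  have e1 := act_act hφ u l hm
  have e2 := congrFun (congrFun (act_convFam μ 0 δ f φ m) u) l
  have e2' := congrFun (congrFun (act_convFam μ δ 0 φ f m) u) l
  have e3 := congrFun (congrFun (act_delFam del δ φ m) u) l
  have e4 := delFam_convFam μ del 0 δ f φ u l hl
  have e4' := delFam_convFam μ del δ 0 φ f u l hl'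
  have e5 := congrFun (congrFun (convFam_assoc μ hμ 0 0 δ f f φ) u) l
  have e5' := congrFun (congrFun (convFam_assoc μ hμ 0 δ 0 f φ f) u) l
  have e5'' := congrFun (congrFun (convFam_assoc μ hμ δ 0 0 φ f f) u) l
  have e6 := congrFun (congrFun (delFam_delFam del hdel δ (δ + 1) φ) u) l
  simp only [Int.negOnePow_zero, one_smul, zero_add, add_zero, Pi.add_apply, Pi.neg_apply,
    Pi.zero_apply, Pi.smul_apply] at e2 e2' e3 e4 e4' e5 e5' e5'' e6
  simp only [twistedD, curvature, act_sub, act_add, act_smul, delFam_sub, delFam_add,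
    delFam_smul, convFam_sub_left, convFam_sub_right, convFam_add_left, convFam_add_right,
    convFam_smul_left, convFam_smul_right, Int.negOnePow_succ, Pi.sub_apply, Pi.add_apply,
    Pi.smul_apply, Units.neg_smul, smul_add, Pi.neg_apply, e1, e2, e2', e3, e4, e4', e6, e5,
    e5', e5'']
  rcases Int.even_or_odd δ with hδ | hδ
  · simp only [Int.negOnePow_even _ hδ, one_smul, Units.neg_smul]
    abel
  · simp only [Int.negOnePow_odd _ hδ, one_smul, Units.neg_smul]
    abel

end FamilyProducts

/-! ### Strict units and the effect of inserting them -/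

section Units

variable {M : Type*} [AddCommGroup M]

/-- The unit as a letter. -/
def unitLetter (e : M) : Letter M := ⟨0, -1, e⟩

/-- The element `e` is a strict unit for the family of operations `m`. -/
structure IsStrictUnit (m : Family M) (e : M) : Prop where
  nil : ∀ p, m p [] = 0
  single : ∀ p, m p [unitLetter e] = 0
  left : ∀ y, m 0 [unitLetter e, y] = y.val
  right : ∀ x : Letter M, m 0 [x, unitLetter e] = -(x.i + x.j).negOnePow • x.val
  high : ∀ p a b, 2 ≤ p + (a.length + b.length) → m p (a ++ unitLetter e :: b) = 0

theorem splitSum_concat {α : Type*} (F : List α → List α → M) (a : List α) (x : α) :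
    splitSum F (a ++ [x]) = splitSum (fun b c => F b (c ++ [x])) a + F (a ++ [x]) [] := by
  rw [splitSum_append_cons, splitSum_nil]

theorem splitSum_concat_of_le_one {α : Type*} {F : List α → List α → M} (a : List α) (x : α)
    (h : ∀ b c, 2 ≤ c.length → F b c = 0) :
    splitSum F (a ++ [x]) = F a [x] + F (a ++ [x]) [] := by
  rw [splitSum_concat, splitSum_eq_single a.length le_rfl]
  · simp
  · intro b c hbc hb
    refine h _ _ ?_
    have := congrArg List.length hbc
    simp at this ⊢
    omega

theorem splitSum_cons_of_le_one {α : Type*} {F : List α → List α → M} (y : α) (e : List α)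
    (h : ∀ b c, 2 ≤ b.length → F b c = 0) :
    splitSum F (y :: e) = F [] (y :: e) + F [y] e := by
  rw [splitSum_cons, splitSum_eq_single 0 (Nat.zero_le _)]
  · simp
  · intro b c hbc hb
    refine h _ _ ?_
    simp
    omega

theorem splitSum_eq_nil {α : Type*} {F : List α → List α → M} (e : List α)
    (h : ∀ b c, 1 ≤ b.length → F b c = 0) : splitSum F e = F [] e := by
  rw [splitSum_eq_single 0 (Nat.zero_le _)]
  · simp
  · intro b c _ hb
    exact h _ _ (by omega)

omit [AddCommGroup M] in
theorem unitLetter_append_sgn (e : M) (a : List (Letter M)) :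
    sgn (a ++ [unitLetter e]) = - sgn a := by
  rw [sgn_append, sgn_cons]
  simp [unitLetter]

/-- By strict unitality an operation that swallows the unit contributes only if it is `m_02`,
multiplying the unit with a neighbour. The right and the left neighbour give the same value with
opposite signs, so a boundary term survives only at an end of the word. -/
theorem insSum_unit {m : Family M} {e : M} (he : IsStrictUnit m e) (p : ℕ)
    {φ : List (Letter M) → M} (hφ : IsMultiAdd φ) (a b : List (Letter M)) :
    insSum p φ (m p) (a ++ unitLetter e :: b) =
      insSum p (fun l => φ (l ++ unitLetter e :: b)) (m p) a -
        sgn a • insSum p (fun l => φ (a ++ unitLetter e :: l)) (m p) b +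
        if p = 0 then (if b = [] then 0 else sgn a • φ (a ++ b)) -
          (if a = [] then 0 else sgn a • φ (a ++ b)) else 0 := by
  have hzero : ∀ a1 a2 e1 e2 : List (Letter M), 2 ≤ p + (a2.length + e1.length) →
      sgn a1 • φ (a1 ++ outLetter 1 p (a2 ++ unitLetter e :: e1)
        (m p (a2 ++ unitLetter e :: e1)) :: e2) = 0 := by
    intro a1 a2 e1 e2 h
    rw [he.high p _ _ h, outLetter, hφ.map_zero, smul_zero]
  have hzero' : ∀ a1 e2 : List (Letter M),
      sgn a1 • φ (a1 ++ outLetter 1 p ([] ++ unitLetter e :: [])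
        (m p ([] ++ unitLetter e :: [])) :: e2) = 0 := by
    intro a1 e2
    rw [List.nil_append, he.single p, outLetter, hφ.map_zero, smul_zero]
  rw [insSum_append_cons, unitLetter_append_sgn, Units.neg_smul, ← sub_eq_add_neg,
    add_sub_right_comm]
  congr 1
  by_cases hp : p = 0
  swap
  · rw [if_neg hp]
    refine splitSum_eq_zero fun a1 a2 _ => splitSum_eq_zero fun e1 e2 _ => ?_
    by_cases h : 2 ≤ p + (a2.length + e1.length)
    · exact hzero _ _ _ _ h
    · obtain rfl : a2 = [] := List.length_eq_zero_iff.1 (by omega)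
      obtain rfl : e1 = [] := List.length_eq_zero_iff.1 (by omega)
      exact hzero' _ _
  · subst hp
    -- The unit multiplied with the letter to its right.
    have hl : ∀ a1 : List (Letter M), splitSum (fun e1 e2 => sgn a1 • φ (a1 ++
        outLetter 1 0 ([] ++ unitLetter e :: e1) (m 0 ([] ++ unitLetter e :: e1)) :: e2)) b =
        if b = [] then 0 else sgn a1 • φ (a1 ++ b) := by
      intro a1
      rcases b with _ | ⟨y, b⟩
      · exact hzero' _ _
      · rw [splitSum_cons_of_le_one _ _ fun e1 e2 h => hzero _ _ _ _ (by simpa using h),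
          hzero', zero_add, if_neg (List.cons_ne_nil _ _), List.nil_append, he.left]
        simp [outLetter, unitLetter]
    -- The letter to the left multiplied with the unit.
    have hr : ∀ (a1 : List (Letter M)) (x : Letter M), splitSum (fun e1 e2 => sgn a1 • φ (a1 ++
        outLetter 1 0 ([x] ++ unitLetter e :: e1) (m 0 ([x] ++ unitLetter e :: e1)) :: e2)) b =
        - sgn (a1 ++ [x]) • φ (a1 ++ x :: b) := by
      intro a1 x
      rw [splitSum_eq_nil _ fun e1 e2 h => hzero _ _ _ _ (by simp; omega)]
      rw [List.singleton_append, he.right]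
      simp only [outLetter, hφ.map_smul]
      rw [smul_smul, sgn_append, sgn_cons]
      simp [unitLetter]
    rw [if_pos rfl]
    rcases List.eq_nil_or_concat' a with rfl | ⟨a, x, rfl⟩
    · rw [splitSum_nil, hl]
      simp
    · rw [splitSum_concat_of_le_one, hl, hr, if_neg (show ¬ (a ++ [x] = []) by simp), add_comm, sub_eq_add_neg,
        Units.neg_smul]
      · simp
      · intro b1 c hc
        exact splitSum_eq_zero fun e1 e2 _ => hzero _ _ _ _ (by omega)

theorem act_unit {m : Family M} {e : M} (he : IsStrictUnit m e)
    {φ : Family M} (hφ : ∀ i, IsMultiAdd (φ i)) (u : ℕ) (a b : List (Letter M)) :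
    act φ m u (a ++ unitLetter e :: b) =
      act (fun i l => φ i (l ++ unitLetter e :: b)) m u a -
        sgn a • act (fun i l => φ i (a ++ unitLetter e :: l)) m u b +
        ((if b = [] then 0 else sgn a • φ u (a ++ b)) -
          (if a = [] then 0 else sgn a • φ u (a ++ b))) := by
  simp only [act, insSum_unit he _ (hφ _), Finset.sum_add_distrib, Finset.sum_sub_distrib,
    Finset.smul_sum]
  congr 1
  rw [Finset.sum_eq_single_of_mem (u, 0) (by simp)]
  · simp
  · rintro ⟨i, p⟩ h hne
    rw [if_neg]
    rintro rfl
    simp at h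
    simp [h] at hne

/-- The identity family. -/
def idFam : Family M
  | 0, [x] => x.val
  | _, _ => 0

theorem idFam_succ (u : ℕ) (l : List (Letter M)) : idFam (u + 1) l = 0 := by
  cases l <;> rfl

theorem idFam_of_length_ne (u : ℕ) {l : List (Letter M)} (h : l.length ≠ 1) :
    idFam u l = 0 := by
  rcases u with _ | u
  · rcases l with _ | ⟨x, _ | ⟨y, l⟩⟩
    · rfl
    · simp at h
    · rfl
  · exact idFam_succ _ _

variable (μ : M →+ M →+ M) (del : M →+ M)

theorem convFam_idFam_left (δ : ℤ) (φ : Family M) (u : ℕ) (x : Letter M) (l : List (Letter M)) :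
    convFam μ 0 δ idFam φ u (x :: l) =
      ((x.i + x.j) * δ).negOnePow • letterMul μ x (outLetter δ u l (φ u l)) := by
  rw [convFam, Finset.sum_eq_single_of_mem (0, u) (by simp)]
  · rw [conv, splitSum_eq_single 1 (by simp)]
    · simp [idFam, outLetter]
    · intro a b _ h
      simp [letterMul, idFam_of_length_ne _ h]
  · rintro ⟨i, p⟩ h hne
    rcases i with _ | i
    · simp at h
      simp [h] at hne
    · simp [conv, letterMul, idFam_succ, splitSum_zero]

theorem convFam_idFam_left_nil (δ : ℤ) (φ : Family M) (u : ℕ) :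
    convFam μ 0 δ idFam φ u [] = 0 := by
  simp [convFam, conv, letterMul, idFam_of_length_ne]

theorem convFam_idFam_right (δ : ℤ) (φ : Family M) (u : ℕ) (x : Letter M)
    (l : List (Letter M)) :
    convFam μ δ 0 φ idFam u (l ++ [x]) = letterMul μ (outLetter δ u l (φ u l)) x := by
  rw [convFam, Finset.sum_eq_single_of_mem (u, 0) (by simp)]
  · rw [conv, splitSum_eq_single l.length (by simp)]
    · simp [idFam, outLetter]
    · intro a b hab h
      have := congrArg List.length hab
      rw [letterMul, outLetter_val, outLetter_val, idFam_of_length_ne (l := b)]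
      · simp
      · simp at this
        omega
  · rintro ⟨i, p⟩ h hne
    rcases p with _ | p
    · simp at h
      simp [h] at hne
    · simp [conv, letterMul, idFam_succ, splitSum_zero]

theorem convFam_idFam_right_nil (δ : ℤ) (φ : Family M) (u : ℕ) :
    convFam μ δ 0 φ idFam u [] = 0 := by
  simp [convFam, conv, letterMul, idFam_of_length_ne]

theorem letterMul_unit_left {e : M} (he : ∀ x, μ e x = x) (y : Letter M) :
    letterMul μ (unitLetter e) y = y.val := by
  simp [letterMul, unitLetter, he]

theorem letterMul_unit_right {e : M} (he : ∀ x, μ x e = x) (x : Letter M) :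
    letterMul μ x (unitLetter e) = - (x.i + x.j).negOnePow • x.val := by
  rw [← neg_one_mul, ← Int.negOnePow_one, ← Int.negOnePow_add]
  simp only [letterMul, unitLetter, he]
  congr 1
  rw [Int.negOnePow_eq_iff]
  grind

/-- The value of the differential at a word with a unit, for a function vanishing if one of
the letters before it is the unit. -/
theorem twistedD_unit {m : Family M} {e : M} (he : IsStrictUnit m e)
    (hl : ∀ x, μ e x = x) (hr : ∀ x, μ x e = x) (δ : ℤ)
    {φ : Family M} (hφ : ∀ i, IsMultiAdd (φ i)) (u : ℕ) (a b : List (Letter M))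
    (h0 : ∀ x a', a = x :: a' → φ u (a' ++ unitLetter e :: b) = 0) :
    twistedD μ del m idFam δ φ u (a ++ unitLetter e :: b) =
      act (fun i l => φ i (l ++ unitLetter e :: b)) m u a -
        sgn a • act (fun i l => φ i (a ++ unitLetter e :: l)) m u b -
        δ.negOnePow • delFam del δ φ u (a ++ unitLetter e :: b) -
        if b = [] then 0 else
          δ.negOnePow • convFam μ δ 0 φ idFam u (a ++ unitLetter e :: b) := by
  simp only [twistedD, Pi.sub_apply, Pi.smul_apply, Pi.add_apply, act_unit he hφ, smul_add]
  have h1 : δ.negOnePow • convFam μ 0 δ idFam φ u (a ++ unitLetter e :: b) =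
      if a = [] then φ u b else 0 := by
    rcases a with _ | ⟨x, a⟩
    · rw [List.nil_append, convFam_idFam_left, letterMul_unit_left _ hl, smul_smul,
        ← Int.negOnePow_add, if_pos rfl, outLetter_val]
      have : (δ + ((unitLetter e).i + (unitLetter e).j) * δ) = 0 := by
        simp [unitLetter]
      rw [this, Int.negOnePow_zero, one_smul]
    · rw [List.cons_append, convFam_idFam_left, outLetter, h0 x a rfl]
      simp [letterMul]
  have h2 : b = [] → δ.negOnePow • convFam μ δ 0 φ idFam u (a ++ unitLetter e :: b) =
      - sgn a • φ u a := by
    rintro rfl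
    rw [convFam_idFam_right, letterMul_unit_right _ hr, outLetter_sign, outLetter_val, smul_smul]
    congr 1
    rw [mul_neg, ← mul_assoc, Int.units_mul_self, one_mul]
  rw [h1]
  by_cases hb : b = []
  · rw [h2 hb, if_pos hb, if_pos hb]
    subst hb
    by_cases ha : a = []
    · subst ha
      simp
    · rw [if_neg ha, if_neg ha, List.append_nil, Units.neg_smul]
      abel
  · rw [if_neg hb, if_neg hb]
    by_cases ha : a = []
    · subst ha
      simp
      abel
    · rw [if_neg ha, if_neg ha]
      abel

theorem act_nil {m : Family M} (hm : ∀ p, m p [] = 0) {φ : Family M}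
    (hφ : ∀ i, IsMultiAdd (φ i)) (u : ℕ) : act φ m u [] = 0 := by
  refine Finset.sum_eq_zero fun x _ => ?_
  simp only [insSum, splitSum_nil, hm, outLetter, (hφ _).map_zero, smul_zero]

theorem IsMultiAdd.append_right {φ : List (Letter M) → M} (h : IsMultiAdd φ)
    (b : List (Letter M)) : IsMultiAdd fun l => φ (l ++ b) := fun a i j x y c => by
  simpa using h a i j x y (c ++ b)

theorem IsMultiAdd.append_left {φ : List (Letter M) → M} (h : IsMultiAdd φ)
    (b : List (Letter M)) : IsMultiAdd fun l => φ (b ++ l) := fun a i j x y c => by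
  simpa using h (b ++ a) i j x y c

/-- If `ψ` is `φ` with the unit inserted at position `k`, then `φ + D ψ` vanishes if the letter
at position `k` is the unit. -/
theorem add_twistedD_unit {m : Family M} {e : M} (he : IsStrictUnit m e)
    (hl : ∀ x, μ e x = x) (hr : ∀ x, μ x e = x) {φ ψ : Family M} (hφ : ∀ i, IsMultiAdd (φ i))
    (hψ : ∀ i, IsMultiAdd (ψ i)) (k u : ℕ) (a b : List (Letter M)) (ha : a.length = k)
    (hk : ∀ i a b, a.length < k → φ i (a ++ unitLetter e :: b) = 0)
    (hψφ : ∀ i a b, a.length ≤ k → ψ i (a ++ unitLetter e :: b) =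
      sgn a • φ i (a ++ unitLetter e :: unitLetter e :: b))
    (hD : twistedD μ del m idFam 0 φ u (a ++ unitLetter e :: unitLetter e :: b) = 0) :
    φ u (a ++ unitLetter e :: b) +
      twistedD μ del m idFam (-1) ψ u (a ++ unitLetter e :: b) = 0 := by
  have h1 := twistedD_unit μ del he hl hr 0 hφ u a (unitLetter e :: b)
    fun x a' h => hk _ _ _ (by rw [← ha, h]; simp)
  have h2 := twistedD_unit μ del he hl hr (-1) hψ u a b
    fun x a' h => by
      rw [hψφ _ _ _ (by rw [← ha, h]; simp), hk _ _ _ (by rw [← ha, h]; simp), smul_zero]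
  -- The second of the two adjacent units, multiplied with the first letter of `b`, leaves behind `φ
  -- u (a e b)`, the term to be cancelled.
  have h3 := act_unit he (φ := fun i l => φ i (a ++ unitLetter e :: l))
    (fun i => by simpa using (hφ i).append_left (a ++ [unitLetter e])) u [] b
  have h4 : act (fun i l => φ i (a ++ unitLetter e :: (l ++ unitLetter e :: b))) m u [] = 0 :=
    act_nil he.nil (fun i => by
      simpa using ((hφ i).append_left (a ++ [unitLetter e])).append_right (unitLetter e :: b)) u
  -- If `b` is empty there is no such neighbour; the same term then comes from multiplying by the
  -- final unit on the right.
  have h5 : convFam μ 0 0 φ idFam u (a ++ unitLetter e :: unitLetter e :: b) =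
      if b = [] then sgn a • φ u (a ++ unitLetter e :: b) else
        convFam μ 0 0 φ idFam u (a ++ unitLetter e :: unitLetter e :: b) := by
    split_ifs with hb
    · subst hb
      have := convFam_idFam_right μ 0 φ u (unitLetter e) (a ++ [unitLetter e])
      rw [List.append_assoc, List.singleton_append] at this
      rw [this, letterMul_unit_right _ hr, outLetter_sign, unitLetter_append_sgn]
      simp
    · rfl
  have h6 : act (fun i l => ψ i (l ++ unitLetter e :: b)) m u a =
      - sgn a • act (fun i l => φ i (l ++ unitLetter e :: unitLetter e :: b)) m u a := by
    simp only [act, Finset.smul_sum, insSum, ← splitSum_smul]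
    refine Finset.sum_congr rfl fun x _ => splitSum_congr fun a1 a2 h => splitSum_congr
      fun c d h' => ?_
    -- A nonempty block `c` is replaced by a single letter, so the prefix before the unit does not
    -- exceed length `k` and `hψφ` applies. An empty block contributes nothing.
    rcases Nat.eq_zero_or_pos c.length with hc | hc
    · obtain rfl := List.length_eq_zero_iff.1 hc
      rw [he.nil]
      simp only [outLetter, List.append_assoc, List.cons_append, (hφ _).map_zero,
        (hψ _).map_zero, smul_zero]
    · subst h h'
      rw [hψφ _ _ _ (by simp at ha ⊢; omega), smul_smul, smul_smul]
      congr 1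
      rw [sgn_append, sgn_cons, outLetter_sign, sgn_append, sgn_append, Int.negOnePow_one]
      simp only [neg_mul, mul_neg, one_mul]
      rw [mul_comm (sgn a1 * _) (sgn a1)]
  have h7 : (fun i l => ψ i (a ++ unitLetter e :: l)) =
      sgn a • fun i l => φ i (a ++ unitLetter e :: unitLetter e :: l) := by
    funext i l
    exact hψφ _ _ _ ha.le
  have h8 : delFam del (-1) ψ u (a ++ unitLetter e :: b) =
      sgn a • delFam del 0 φ u (a ++ unitLetter e :: unitLetter e :: b) := by
    rcases u with _ | u
    · simp [delFam]
    · simp only [delFam, letterDel, outLetter_val, hψφ _ _ _ ha.le, del_smul, smul_smul]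
      rw [mul_comm]
      congr 3
      simp [unitLetter]
      ring
  have h9 : b ≠ [] → convFam μ (-1) 0 ψ idFam u (a ++ unitLetter e :: b) =
      sgn a • convFam μ 0 0 φ idFam u (a ++ unitLetter e :: unitLetter e :: b) := by
    intro hb
    rcases List.eq_nil_or_concat' b with rfl | ⟨b, x, rfl⟩
    · exact absurd rfl hb
    have e1 := convFam_idFam_right μ (-1) ψ u x (a ++ unitLetter e :: b)
    have e2 := convFam_idFam_right μ 0 φ u x (a ++ unitLetter e :: unitLetter e :: b)
    simp only [List.append_assoc, List.cons_append] at e1 e2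
    rw [e1, e2, hψφ _ _ _ ha.le]
    simp only [letterMul, outLetter_val, mu_smul_left, smul_smul]
    rw [mul_comm]
    congr 3
    simp [unitLetter]
    ring
  simp only [List.nil_append, h4, sgn_nil, one_smul, if_true] at h3
  rw [hD, h3, h5] at h1
  rw [h2, h6, h7, act_smul, h8]
  simp only [Int.negOnePow_zero, Int.negOnePow_neg, Int.negOnePow_one, Units.neg_smul, one_smul,
    Pi.smul_apply, List.cons_ne_nil, if_false, smul_smul, sgn_mul_self] at h1 ⊢
  by_cases hb : b = []
  · simp only [if_pos hb] at h1 ⊢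
    rcases Int.units_eq_one_or (sgn a) with h | h
    · simp only [h, one_smul, Units.neg_smul, mul_one, mul_neg, neg_neg] at h1 ⊢
      linear_combination (norm := abel) h1
    · simp only [h, one_smul, Units.neg_smul, mul_one, mul_neg, neg_neg] at h1 ⊢
      linear_combination (norm := abel) - h1
  · simp only [if_neg hb, h9 hb] at h1 ⊢
    rcases Int.units_eq_one_or (sgn a) with h | h
    · simp only [h, one_smul, Units.neg_smul, mul_one, mul_neg, neg_neg] at h1 ⊢
      linear_combination (norm := abel) h1
    · simp only [h, one_smul, Units.neg_smul, mul_one, mul_neg, neg_neg] at h1 ⊢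
      linear_combination (norm := abel) - h1

end Units

/-! ### Evaluating multilinear maps at words -/

section Evaluation

variable {k : Type u} [CommRing k]
variable {M : Type v} [AddCommGroup M] [Module k M]
variable {N : Type w} [AddCommGroup N] [Module k N]

/-- Evaluation of a family of multilinear maps, one of each arity, at a word. -/
def evalWord (f : (n : ℕ) → Multi k M N n) (l : List (Letter M)) : N :=
  f l.length fun a => (l.get a).val

theorem evalWord_eq (f : (n : ℕ) → Multi k M N n) {n : ℕ} {l : List (Letter M)}
    (hl : l.length = n) (x : Fin n → M)
    (hx : ∀ (a : ℕ) (h : a < n) (h' : a < l.length), x ⟨a, h⟩ = l[a].val) :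
    f n x = evalWord f l := by
  subst hl
  rw [evalWord]
  congr 1
  funext a
  exact hx a a.2 a.2

/-- Evaluation ignores formal degrees, so changing the value of one letter is an update of one fixed
tuple. -/
theorem evalWord_cons (f : (n : ℕ) → Multi k M N n) (a : List (Letter M)) (i j i' j' : ℤ)
    (y : M) (e : List (Letter M)) :
    evalWord f (a ++ ⟨i, j, y⟩ :: e) =
      f (a ++ ⟨i', j', 0⟩ :: e).length (Function.update (fun t => ((a ++ ⟨i', j', 0⟩ :: e).get t).val)
        ⟨a.length, by simp⟩ y) := by
  symm
  refine evalWord_eq f (by simp) _ fun t h h' => ?_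
  by_cases ht : t = a.length
  · subst ht
    simp
  · rw [Function.update_of_ne (by simpa using ht)]
    simp only [List.get_eq_getElem, List.getElem_append, List.getElem_cons]
    split_ifs <;> first | rfl | omega

theorem isMultiAdd_evalWord (f : (n : ℕ) → Multi k M N n) : IsMultiAdd (evalWord f) := by
  intro a i j x y e
  rw [evalWord_cons f a i j 0 0, evalWord_cons f a i j 0 0 x, evalWord_cons f a i j 0 0 y,
    MultilinearMap.map_update_add]

theorem IsMultiAdd.smul {φ : List (Letter M) → N} (h : IsMultiAdd φ)
    (s : List (Letter M) → ℤˣ)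
    (hs : ∀ a i j x y e, s (a ++ ⟨i, j, x⟩ :: e) = s (a ++ ⟨i, j, y⟩ :: e)) :
    IsMultiAdd fun l => s l • φ l := by
  intro a i j x y e
  simp only [hs a i j (x + y) 0, hs a i j x 0, hs a i j y 0, h a i j x y e, smul_add]

variable (𝒜 : ℕ × ℤ → Submodule k M)

/-- The letter is homogeneous of its formal degree. -/
def IsHomLetter (x : Letter M) : Prop := x.val ∈ piece 𝒜 x.i (x.j + 1)

/-- All letters of the word are homogeneous of their formal degrees. -/
def IsHomWord (l : List (Letter M)) : Prop := ∀ x ∈ l, IsHomLetter 𝒜 x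

variable [DirectSum.Decomposition 𝒜]

theorem signOp_of_mem {s t i j : ℤ} {x : M} (hx : x ∈ piece 𝒜 i j) :
    signOp 𝒜 s t x = (i * s + j * t).negOnePow • x := by
  unfold piece at hx
  split_ifs at hx with hi
  · rw [signOp, LinearMap.comp_apply]
    have : (DirectSum.decomposeLinearEquiv 𝒜).toLinearMap x =
        DirectSum.lof k (ℕ × ℤ) (fun d => 𝒜 d) (i.toNat, j) ⟨x, hx⟩ :=
      DirectSum.decompose_of_mem 𝒜 hx
    rw [this, DirectSum.toModule_lof]
    simp [Int.toNat_of_nonneg hi]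
  · rw [Submodule.mem_bot] at hx
    simp [hx]

/-- The letter with the Koszul sign of an operation of bidegree `(s, t)` moved past it. -/
def signLetter (s t : ℤ) (x : Letter M) : Letter M :=
  ⟨x.i, x.j, (x.i * s + (x.j + 1) * t).negOnePow • x.val⟩

omit [DirectSum.Decomposition 𝒜] in
theorem evalWord_map_signLetter {φ : List (Letter M) → N} (h : IsMultiAdd φ) (s t : ℤ)
    (p a b : List (Letter M)) :
    φ (p ++ (a.map (signLetter s t) ++ b)) =
      (hdeg a * s + (vdeg a + a.length) * t).negOnePow • φ (p ++ (a ++ b)) := by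
  induction a generalizing p with
  | nil => simp
  | cons x a ih =>
    have h1 := ih (p ++ [x])
    simp only [List.append_assoc, List.singleton_append] at h1
    rw [List.map_cons, List.cons_append, signLetter, h.map_smul, h1, smul_smul,
      ← Int.negOnePow_add, List.cons_append]
    congr 2
    simp
    ring

/-- On homogeneous letters `signOp` is a scalar, so the Koszul signs on the first arguments collect
into one power of `-1`. The formal degrees `i'`, `j'` of the inserted letter are free and can be
matched with `outLetter` later. -/
theorem ins_eq_evalWord (f : (n : ℕ) → Multi k M N n) (g : (n : ℕ) → Multi k M M n) (s t : ℤ)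
    {j q : ℕ} (r : Fin j) (x : ℕ → M) (a c e : List (Letter M)) (i' j' : ℤ)
    (ha : a.length = r) (hc : c.length = q) (hj : a.length + 1 + e.length = j)
    (hx : ∀ (t : ℕ) (h : t < (a ++ (c ++ e)).length), x t = (a ++ (c ++ e))[t].val)
    (hom : IsHomWord 𝒜 a) :
    ins 𝒜 (f j) (g q) s t r x = (hdeg a * s + (vdeg a + a.length) * t).negOnePow •
      evalWord f (a ++ ⟨i', j', evalWord g c⟩ :: e) := by
  have h1 := evalWord_map_signLetter (isMultiAdd_evalWord f) s t [] a (⟨i', j', evalWord g c⟩ :: e)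
  rw [List.nil_append, List.nil_append] at h1
  rw [← h1]
  refine evalWord_eq f (by simp; omega) _ fun b h h' => ?_
  unfold insArgs
  simp only [Fin.lt_def, Fin.ext_iff]
  have hlen : (a ++ (c ++ e)).length = a.length + c.length + e.length := by simp; omega
  split_ifs with h2 h3
  · have hb : b < a.length := by omega
    rw [List.getElem_append_left (by simpa using hb)]
    have := hom a[b] (List.getElem_mem hb)
    rw [List.getElem_map, hx b (by omega), List.getElem_append_left hb]
    exact signOp_of_mem 𝒜 this
  · rw [List.getElem_append_right (by simp; omega)]
    simp only [List.length_map, h3, ha, Nat.sub_self, List.getElem_cons_zero]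
    refine evalWord_eq g hc _ fun d hd hd' => ?_
    rw [hx _ (by simp; omega), List.getElem_append_right (by simp; omega),
      List.getElem_append_left (by simp; omega)]
    simp [ha]
  · rw [List.getElem_append_right (by simp; omega)]
    rw [hx _ (by omega), List.getElem_append_right (by omega),
      List.getElem_append_right (by omega)]
    simp only [List.length_map, List.getElem_cons]
    rw [dif_neg (by omega)]
    congr 2
    omega

end Evaluation

/-! ### The shift that turns bigraded Koszul signs into total-degree signs -/

section Hat

variable {k : Type u} [CommRing k]
variable {M : Type v} [AddCommGroup M] [Module k M]

/-- The exponent of the sign relating operations and shifted operations. -/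
def wordExp : List (Letter M) → ℤ
  | [] => -1
  | x :: l => wordExp l + x.i * vdeg l + l.length * x.j + 1

-- The bilinear cross terms make the shift compatible with concatenation; later sign checks for
-- insertions and convolutions split words with this formula. The value `-1` on the empty word
-- normalizes single letters to exponent `0`.
omit [AddCommGroup M] in
theorem wordExp_append (a b : List (Letter M)) :
    wordExp (a ++ b) = wordExp a + wordExp b + hdeg a * vdeg b + b.length * vdeg a + 1 := by
  induction a with
  | nil => simp [wordExp]
  | cons x a ih =>
    simp only [List.cons_append, wordExp, ih, vdeg_append, hdeg_cons, vdeg_cons,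
      List.length_append]
    push_cast
    ring

omit [AddCommGroup M] in
theorem wordExp_singleton (x : Letter M) : wordExp [x] = 0 := by simp [wordExp]

omit [AddCommGroup M] in
theorem wordExp_cons (x : Letter M) (l : List (Letter M)) :
    wordExp (x :: l) = wordExp l + x.i * vdeg l + l.length * x.j + 1 := rfl

/-- The shifted version of a family of operations. -/
def hat (f : ℕ → (n : ℕ) → Multi k M M n) : Family M := fun p l =>
  (wordExp l + p * vdeg l + p.choose 2).negOnePow • evalWord (f p) l

theorem isMultiAdd_hat (f : ℕ → (n : ℕ) → Multi k M M n) (p : ℕ) : IsMultiAdd (hat f p) := by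
  refine (isMultiAdd_evalWord (f p)).smul _ fun a i j x y e => ?_
  simp [wordExp_append, wordExp_cons]

/-- The cross term `i * p` supplies the interchange sign between operations of horizontal degrees
`i` and `p`; this is the purpose of the binomial coefficient in `hat`. -/
theorem choose_two_add (i p : ℕ) :
    ((i + p).choose 2 : ℤ) = i.choose 2 + p.choose 2 + i * p := by
  induction p with
  | zero => simp
  | succ p ih =>
    rw [← add_assoc, Nat.choose_succ_succ' (i + p), Nat.choose_succ_succ' p, Nat.choose_one_right,
      Nat.choose_one_right]
    push_cast
    rw [ih]
    ring

variable (𝒜 : ℕ × ℤ → Submodule k M) [DirectSum.Decomposition 𝒜]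

/-- Insertions are indexed by starting position `r` and block length `q` instead of by arities,
which is the indexing of `splitSum`. -/
theorem sum_fin_antidiagonal (n : ℕ) (H : (j q : ℕ) → Fin j → M) :
    ∑ jq ∈ antidiagonal (n + 1), ∑ r : Fin jq.1, H jq.1 jq.2 r =
      ∑ r ∈ range (n + 1), ∑ q ∈ range (n - r + 1),
        if h : r < n + 1 - q then H (n + 1 - q) q ⟨r, h⟩ else 0 := by
  have h1 : ∀ j q, ∑ r : Fin j, H j q r =
      ∑ r ∈ range j, if h : r < j then H j q ⟨r, h⟩ else 0 := by
    intro j q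
    rw [← Fin.sum_univ_eq_sum_range (fun r => if h : r < j then H j q ⟨r, h⟩ else 0)]
    exact Finset.sum_congr rfl fun r _ => by simp
  simp only [h1]
  rw [sum_antidiagonal_swap' (fun j q => ∑ r ∈ range j, if h : r < j then H j q ⟨r, h⟩ else 0),
    Finset.Nat.sum_antidiagonal_eq_sum_range_succ
    (fun q j => ∑ r ∈ range j, if h : r < j then H j q ⟨r, h⟩ else 0)]
  refine Finset.sum_comm' fun q r => ?_
  simp only [Finset.mem_range]
  omega

/-- The sum over all insertions, with the signs of derived A-infinity structures. -/
theorem sum_ins_eq (f m : ℕ → (n : ℕ) → Multi k M M n) (i p : ℕ) {l : List (Letter M)}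
    (hl : IsHomWord 𝒜 l) (x : ℕ → M) (hx : ∀ (t : ℕ) (h : t < l.length), x t = l[t].val) :
    ∑ jq ∈ antidiagonal (l.length + 1), ∑ r : Fin jq.1,
      (-1 : ℤ) ^ ((r : ℕ) * jq.2 + (jq.1 - 1 - r) + p * jq.1) •
        ins 𝒜 (f i jq.1) (m p jq.2) p (2 - ((p : ℤ) + jq.2)) r x =
      (wordExp l + (i + p : ℕ) * vdeg l + (i + p).choose 2 + (i + p : ℕ)).negOnePow •
        insSum p (hat f i) (hat m p) l := by
  rw [sum_fin_antidiagonal _ fun j q r => (-1 : ℤ) ^ ((r : ℕ) * q + (j - 1 - r) + p * j) •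
        ins 𝒜 (f i j) (m p q) p (2 - ((p : ℤ) + q)) r x, insSum, splitSum_eq_sum, Finset.smul_sum]
  refine Finset.sum_congr rfl fun r hr => ?_
  rw [splitSum_eq_sum, Finset.smul_sum, List.length_drop]
  refine Finset.sum_congr rfl fun q hq => ?_
  rw [mem_range] at hr hq
  rw [dif_pos (by omega)]
  obtain ⟨a, ha⟩ : ∃ a, a = l.take r := ⟨_, rfl⟩
  obtain ⟨c, hc⟩ : ∃ c, c = (l.drop r).take q := ⟨_, rfl⟩
  obtain ⟨e, he⟩ : ∃ e, e = (l.drop r).drop q := ⟨_, rfl⟩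
  have hl' : l = a ++ (c ++ e) := by
    rw [ha, hc, he, List.take_append_drop, List.take_append_drop]
  have hal : a.length = r := by rw [ha, List.length_take]; omega
  have hcl : c.length = q := by rw [hc, List.length_take, List.length_drop]; omega
  rw [← ha, ← hc, ← he]
  clear ha hc he
  subst hl'
  have hlen : (a ++ (c ++ e)).length = a.length + (c.length + e.length) := by simp
  rw [ins_eq_evalWord 𝒜 (f i) (m p) p (2 - ((p : ℤ) + q)) _ x a c e
    (hdeg c - p) (vdeg c + 1 - p) hal hcl (by omega) hx fun y hy => hl y (by simp [hy])]
  have h1 : outLetter 1 p c (hat m p c) = ⟨hdeg c - p, vdeg c + 1 - p,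
    (wordExp c + p * vdeg c + p.choose 2).negOnePow • evalWord (m p) c⟩ := rfl
  rw [h1, (isMultiAdd_hat f i).map_smul, hat]
  simp only [smul_smul, Units.smul_def, ← Int.coe_negOnePow_natCast, ← Units.val_mul]
  congr 1
  congr 1
  have h2 : (a ++ (c ++ e)).length + 1 - q = r + 1 + e.length := by omega
  rw [h2, show r + 1 + e.length - 1 - r = e.length by omega, choose_two_add]
  simp only [sgn, ← Int.negOnePow_add, Int.negOnePow_eq_iff, hdeg_append, vdeg_append, hdeg_cons,
    vdeg_cons, wordExp_append, wordExp_cons, outLetter_i, outLetter_j, List.length_append,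
    List.length_cons, ← hal, ← hcl]
  push_cast
  grind

end Hat

/-! ### Decompositions with a middle block of fixed length -/

section Splits

variable {M : Type*} [AddCommGroup M]

theorem splitSum_splitSum_of_length {α : Type*} (F : List α → List α → List α → M) (q : ℕ)
    (h : ∀ a c e, c.length ≠ q → F a c e = 0) (l : List α) :
    splitSum (fun a b => splitSum (F a) b) l =
      ∑ r ∈ range (l.length + 1 - q), F (l.take r) ((l.drop r).take q) ((l.drop r).drop q) := by
  have h1 : splitSum (fun a b => splitSum (F a) b) l = ∑ r ∈ range (l.length + 1),
      if r ∈ range (l.length + 1 - q) then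
        F (l.take r) ((l.drop r).take q) ((l.drop r).drop q) else 0 := by
    rw [splitSum_eq_sum]
    refine Finset.sum_congr rfl fun r hr => ?_
    rw [mem_range] at hr
    split_ifs with hq
    · rw [mem_range] at hq
      exact splitSum_eq_single q (by rw [List.length_drop]; omega) fun c e _ hc => h _ _ _ hc
    · rw [mem_range] at hq
      refine splitSum_eq_zero fun c e hce => h _ _ _ ?_
      have := congrArg List.length hce
      simp at this
      omega
  rw [h1, ← Finset.sum_filter]
  refine Finset.sum_congr ?_ fun _ _ => rfl
  ext r
  simp only [Finset.mem_filter, mem_range]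
  omega

end Splits

/-! ### Bidgas and Hochschild cochains as functions of words -/

section Bidga

variable {k : Type u} [CommRing k]
variable {M : Type v} [AddCommGroup M] [Module k M]
variable {𝒜 : ℕ × ℤ → Submodule k M} [DirectSum.Decomposition 𝒜]

/-- The multiplication as a biadditive map. -/
def mulHom (μ : Multi k M M 2) : M →+ M →+ M :=
  AddMonoidHom.mk' (fun x => AddMonoidHom.mk' (fun y => μ ![x, y]) fun y y' => by
    have h := μ.map_update_add ![x, 0] 1 y y'
    have e : ∀ z : M, Function.update ![x, 0] 1 z = ![x, z] := fun z => by
      funext a; fin_cases a <;> rfl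
    rwa [e, e, e] at h) fun x x' => by
      ext y
      have h := μ.map_update_add ![0, y] 0 x x'
      have e : ∀ z : M, Function.update ![0, y] 0 z = ![z, y] := fun z => by
        funext a; fin_cases a <;> rfl
      rwa [e, e, e] at h

theorem mulHom_apply (μ : Multi k M M 2) (x y : M) : mulHom μ x y = μ ![x, y] := rfl

/-- The horizontal differential as an additive map. -/
def delHom (d : Multi k M M 1) : M →+ M := (lin d).toAddMonoidHom

theorem delHom_apply (d : Multi k M M 1) (x : M) : delHom d x = d fun _ => x := rfl

/-- A bidga with zero vertical differential has only two nonzero operations. -/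
theorem DAInf.IsBidga.eq_zero {A : DAInf 𝒜} (hA : A.IsBidga) (hA01 : A.m 0 1 = 0) {i j : ℕ}
    (h : i + j ≠ 2) : A.m i j = 0 := by
  rcases Nat.eq_zero_or_pos j with rfl | hj
  · exact A.m_zero i
  · rcases lt_or_ge (i + j) 3 with h3 | h3
    · obtain ⟨rfl, rfl⟩ : i = 0 ∧ j = 1 := by omega
      exact hA01
    · exact hA i j h3

theorem hat_pair (f : ℕ → (n : ℕ) → Multi k M M n) (x y : Letter M) :
    hat f 0 [x, y] = letterMul (mulHom (f 0 2)) x y := by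
  rw [hat, letterMul, mulHom_apply]
  congr 1
  · congr 1
    simp [wordExp]
  · symm
    refine evalWord_eq (f 0) (n := 2) (l := [x, y]) rfl _ fun a h h' => ?_
    rcases a with _ | _ | a
    · rfl
    · rfl
    · omega

theorem hat_single (f : ℕ → (n : ℕ) → Multi k M M n) (x : Letter M) :
    hat f 1 [x] = letterDel (delHom (f 1 1)) x := by
  rw [hat, letterDel, delHom_apply]
  congr 1
  · congr 1
    simp [wordExp]
  · symm
    refine evalWord_eq (f 1) (n := 1) (l := [x]) rfl _ fun a h h' => ?_
    obtain rfl : a = 0 := by omega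
    rfl

theorem hat_eq_zero {f : ℕ → (n : ℕ) → Multi k M M n} {p : ℕ} {l : List (Letter M)}
    (h : f p l.length = 0) : hat f p l = 0 := by
  rw [hat, evalWord, h]
  simp

/-- Hochschild cochains of degree `s` as families of functions of words. -/
def hatCochain (s δ : ℤ) (c : (n : ℕ) → Multi k M M n) : Family M := fun p l =>
  if (p : ℤ) + l.length = s then
    (wordExp l + p * (vdeg l + δ + 1)).negOnePow • evalWord c l else 0

theorem isMultiAdd_hatCochain (s δ : ℤ) (c : (n : ℕ) → Multi k M M n) (p : ℕ) :
    IsMultiAdd (hatCochain s δ c p) := by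
  have h : IsMultiAdd fun l => (wordExp l + p * (vdeg l + δ + 1)).negOnePow • evalWord c l := by
    refine (isMultiAdd_evalWord c).smul _ fun a i j x y e => ?_
    simp [wordExp_append, wordExp_cons]
  intro a i j x y e
  simp only [hatCochain, List.length_append, List.length_cons]
  split_ifs with h1
  · exact h a i j x y e
  · rw [add_zero]

variable (𝒜)

/-- The degree functions `i'` and `j'` are arbitrary because `evalWord` reads only values. They are
chosen at each use so that both sides involve the same word. -/
theorem circ_eq_splitSum (f g : (n : ℕ) → Multi k M M n) {n m a : ℕ} (h : a + 1 = n + m)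
    (j κ : ℤ) (i' j' : List (Letter M) → ℤ) {l : List (Letter M)} (hl : IsHomWord 𝒜 l)
    (hla : l.length = a) (x : Fin a → M)
    (hx : ∀ (t : ℕ) (h : t < a) (h' : t < l.length), x ⟨t, h⟩ = l[t].val) :
    circ 𝒜 h (f n) (g m) j κ x = splitSum (fun p b => splitSum (fun c e => if c.length = m then
      (((m : ℤ) - 1) * ((n : ℤ) - 1) + p.length * ((m : ℤ) - 1) + j * ((n : ℤ) - 1) +
        (hdeg p * κ + (vdeg p + p.length) * j)).negOnePow •
          evalWord f (p ++ ⟨i' c, j' c, evalWord g c⟩ :: e) else 0) b) l := by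
  rw [splitSum_splitSum_of_length _ m fun a c e hc => if_neg hc]
  have hn : l.length + 1 - m = n := by omega
  rw [hn, ← Fin.sum_univ_eq_sum_range (fun r => if ((l.drop r).take m).length = m then
      (((m : ℤ) - 1) * ((n : ℤ) - 1) + (l.take r).length * ((m : ℤ) - 1) + j * ((n : ℤ) - 1) +
        (hdeg (l.take r) * κ + (vdeg (l.take r) + (l.take r).length) * j)).negOnePow •
          evalWord f (l.take r ++ ⟨i' ((l.drop r).take m), j' ((l.drop r).take m),
            evalWord g ((l.drop r).take m)⟩ :: (l.drop r).drop m) else 0)]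
  rw [circ, _root_.sum_apply]
  refine Finset.sum_congr rfl fun r _ => ?_
  have hr := r.2
  have hlen : ((l.drop r).take m).length = m := by
    rw [List.length_take, List.length_drop]; omega
  rw [if_pos hlen]
  have h1 : (l.take r).length = r := by rw [List.length_take]; omega
  have h2 : l = l.take r ++ ((l.drop r).take m ++ (l.drop r).drop m) := by
    rw [List.take_append_drop, List.take_append_drop]
  have h3 := ins_eq_evalWord 𝒜 f g κ j r (seq x) (l.take r) ((l.drop r).take m)
    ((l.drop r).drop m) (i' ((l.drop r).take m)) (j' ((l.drop r).take m)) h1 hlen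
    (by rw [List.length_drop, List.length_drop, h1]; omega) (fun t ht => by
      have ht' : t < l.length := by rw [h2]; exact ht
      simp only [← h2]
      rw [seq, dif_pos (by omega), hx]) (fun y hy => hl y (List.mem_of_mem_take hy))
  change (((m : ℤ) - 1) * ((n : ℤ) - 1) + ((r : ℕ) : ℤ) * ((m : ℤ) - 1)
    + j * ((n : ℤ) - 1)).negOnePow • ins 𝒜 (f n) (g m) κ j r (seq x) = _
  rw [h3, smul_smul, ← Int.negOnePow_add, h1]

end Bidga

/-! ### The structure relations in terms of words -/

section Relations

variable {k : Type u} [CommRing k]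
variable {M : Type v} [AddCommGroup M] [Module k M]
variable {𝒜 : ℕ × ℤ → Submodule k M} [DirectSum.Decomposition 𝒜]

/-- The sign in `sum_ins_eq` depends only on the word and on `i + p = u`. It is common to all
summands and can be cancelled. -/
theorem act_hat_hat (A : DAInf 𝒜) (u : ℕ) {l : List (Letter M)} (hl : IsHomWord 𝒜 l) :
    act (hat A.m) (hat A.m) u l = 0 := by
  rcases Nat.eq_zero_or_pos l.length with h0 | h0
  · obtain rfl := List.length_eq_zero_iff.1 h0
    exact act_nil (fun p => hat_eq_zero (A.m_zero p)) (isMultiAdd_hat A.m) u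
  have h := A.relation u l.length h0 fun t => if h : t < l.length then l[t].val else 0
  have h1 : ∀ ip ∈ antidiagonal u, _ := fun ip (hip : ip ∈ antidiagonal u) =>
    sum_ins_eq 𝒜 A.m A.m ip.1 ip.2 hl
    (fun t => if h : t < l.length then l[t].val else 0) fun t ht => dif_pos ht
  rw [Finset.sum_congr rfl h1] at h
  have h2 : ∀ ip ∈ antidiagonal u, (wordExp l + (ip.1 + ip.2 : ℕ) * vdeg l +
      (ip.1 + ip.2).choose 2 + (ip.1 + ip.2 : ℕ)).negOnePow •
      insSum ip.2 (hat A.m ip.1) (hat A.m ip.2) l = (wordExp l + u * vdeg l +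
      u.choose 2 + u).negOnePow • insSum ip.2 (hat A.m ip.1) (hat A.m ip.2) l := by
    intro ip hip
    rw [HasAntidiagonal.mem_antidiagonal.1 hip]
  rw [Finset.sum_congr rfl h2, ← Finset.smul_sum] at h
  exact (smul_eq_zero_iff_eq _).1 h

theorem ins_zero_two {q : ℕ} (f : Multi k M M 2) (g : Multi k M M q) (s t : ℤ) (x : ℕ → M) :
    ins 𝒜 f g s t 0 x = mulHom f (g fun a => x a) (x q) := by
  rw [ins, mulHom_apply]
  congr 1
  funext a
  fin_cases a
  · simp [insArgs]
  · simp [insArgs]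

theorem ins_one_two {q : ℕ} (f : Multi k M M 2) (g : Multi k M M q) (s t : ℤ) (x : ℕ → M) :
    ins 𝒜 f g s t 1 x = mulHom f (signOp 𝒜 s t (x 0)) (g fun a => x (1 + a)) := by
  rw [ins, mulHom_apply]
  congr 1
  funext a
  fin_cases a
  · simp [insArgs]
  · simp [insArgs]

theorem ins_zero_one {q : ℕ} (f : Multi k M M 1) (g : Multi k M M q) (s t : ℤ) (x : ℕ → M) :
    ins 𝒜 f g s t 0 x = delHom f (g fun a => x a) := by
  rw [ins, delHom_apply]
  congr 1
  funext a
  fin_cases a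
  simp [insArgs]

theorem mulHom_eq (f : Multi k M M 2) (x : Fin 2 → M) : f x = mulHom f (x 0) (x 1) := by
  rw [mulHom_apply]
  congr 1
  funext a
  fin_cases a <;> rfl

theorem delHom_eq (f : Multi k M M 1) (x : Fin 1 → M) : f x = delHom f (x 0) := by
  rw [delHom_apply]
  congr 1
  funext a
  fin_cases a
  rfl

variable {A : DAInf 𝒜} (hA : A.IsBidga) (hA01 : A.m 0 1 = 0)
include hA hA01

theorem DAInf.IsBidga.mul_assoc (x y z : M) :
    mulHom (A.m 0 2) (mulHom (A.m 0 2) x y) z = mulHom (A.m 0 2) x (mulHom (A.m 0 2) y z) := by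
  have h := A.relation 0 3 (by norm_num) fun t => if t = 0 then x else if t = 1 then y else z
  have h3 := hA.eq_zero hA01 (i := 0) (j := 3) (by norm_num)
  simp [Finset.Nat.antidiagonal_succ, A.m_zero, ins_zero_right, hA01, h3, ins_zero_two, ins_one_two,
    signOp_zero, mulHom_eq (A.m 0 2)] at h
  rwa [neg_add_eq_zero] at h

theorem DAInf.IsBidga.del_del (x : M) : delHom (A.m 1 1) (delHom (A.m 1 1) x) = 0 := by
  have h := A.relation 2 1 (by norm_num) fun t => x
  have h3 := hA.eq_zero hA01 (i := 2) (j := 1) (by norm_num)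
  simp [Finset.Nat.antidiagonal_succ, A.m_zero, ins_zero_right, hA01, h3, ins_zero_one] at h
  exact h

theorem DAInf.IsBidga.leibniz {i j : ℤ} {x : M} (hx : x ∈ piece 𝒜 i j) (y : M) :
    delHom (A.m 1 1) (mulHom (A.m 0 2) x y) = mulHom (A.m 0 2) (delHom (A.m 1 1) x) y +
      i.negOnePow • mulHom (A.m 0 2) x (delHom (A.m 1 1) y) := by
  have h := A.relation 1 2 (by norm_num) fun t => if t = 0 then x else y
  have h3 := hA.eq_zero hA01 (i := 1) (j := 2) (by norm_num)
  simp [Finset.Nat.antidiagonal_succ, A.m_zero, ins_zero_right, hA01, h3, ins_zero_two, ins_one_two,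
    ins_zero_one, signOp_of_mem 𝒜 hx, mulHom_eq (A.m 0 2), delHom_eq (A.m 1 1)] at h
  rw [← neg_add, neg_add_eq_zero] at h
  exact h.symm

end Relations

/-! ### The twisted differential at the identity is the Hochschild differential -/

section Differential

variable {k : Type u} [CommRing k]
variable {M : Type v} [AddCommGroup M] [Module k M]
variable {𝒜 : ℕ × ℤ → Submodule k M} [DirectSum.Decomposition 𝒜]

theorem hatCochain_of_ne {s δ : ℤ} (c : (n : ℕ) → Multi k M M n) {p : ℕ} {l : List (Letter M)}
    (h : (p : ℤ) + l.length ≠ s) : hatCochain s δ c p l = 0 := if_neg h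

variable {A : DAInf 𝒜} (hA : A.IsBidga) (hA01 : A.m 0 1 = 0)
include hA hA01

/-- In horizontal degree zero the only operation of the bidga is the product, so the blocks of
length two give all the insertions. -/
theorem insSum_hat_zero (s δ : ℤ) (c : (n : ℕ) → Multi k M M n) (u n : ℕ) {l : List (Letter M)}
    (hl : IsHomWord 𝒜 l) (hn : l.length = n + 1) (hs : (u : ℤ) + n = s) (x : Fin (n + 1) → M)
    (hx : ∀ (t : ℕ) (h : t < n + 1) (h' : t < l.length), x ⟨t, h⟩ = l[t].val) :
    insSum 0 (hatCochain s δ c u) (hat A.m 0) l =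
      (wordExp l + u * (vdeg l + δ)).negOnePow •
        circ 𝒜 (a := n + 1) (n := n) (m := 2) (by omega) (c n) (A.m 0 2) 0 0 x := by
  rw [circ_eq_splitSum 𝒜 c (A.m 0) _ 0 0 hdeg (fun c => vdeg c + 1) hl hn x hx, insSum,
    ← splitSum_smul]
  refine splitSum_congr fun a b hab => ?_
  rw [← splitSum_smul]
  refine splitSum_congr fun d e hde => ?_
  subst hde hab
  simp only [List.length_append] at hn
  split_ifs with hd
  · have h1 : outLetter 1 0 d (hat A.m 0 d) =
        ⟨hdeg d, vdeg d + 1, (wordExp d).negOnePow • evalWord (A.m 0) d⟩ := by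
      simp [outLetter, hat]
    rw [h1, (isMultiAdd_hatCochain s δ c u).map_smul, hatCochain, if_pos]
    · simp only [smul_smul]
      congr 1
      simp only [sgn, ← Int.negOnePow_add, Int.negOnePow_eq_iff, hdeg_append, vdeg_append,
        hdeg_cons, vdeg_cons, wordExp_append, wordExp_cons, List.length_append, List.length_cons]
      have : (n : ℤ) = a.length + e.length + 1 := by omega
      rw [this, hd]
      push_cast
      grind
    · simp
      omega
  · rw [hat_eq_zero (hA.eq_zero hA01 (by omega)), outLetter,
      (isMultiAdd_hatCochain s δ c u).map_zero, smul_zero, smul_zero]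

theorem insSum_hat_one (s δ : ℤ) (c : (n : ℕ) → Multi k M M n) (u n : ℕ) {l : List (Letter M)}
    (hl : IsHomWord 𝒜 l) (hn : l.length = n) (hs : (u : ℤ) + n = s) (x : Fin n → M)
    (hx : ∀ (t : ℕ) (h : t < n) (h' : t < l.length), x ⟨t, h⟩ = l[t].val) :
    insSum 1 (hatCochain s δ c u) (hat A.m 1) l =
      (wordExp l + u * (vdeg l + δ + 1) + vdeg l).negOnePow •
        circ 𝒜 (a := n) (n := n) (m := 1) (by omega) (c n) (A.m 1 1) 0 1 x := by
  rw [circ_eq_splitSum 𝒜 c (A.m 1) _ 0 1 (fun c => hdeg c - 1) (fun c => vdeg c + 1 - 1) hl hn x hx,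
    insSum, ← splitSum_smul]
  refine splitSum_congr fun a b hab => ?_
  rw [← splitSum_smul]
  refine splitSum_congr fun d e hde => ?_
  subst hde hab
  simp only [List.length_append] at hn
  split_ifs with hd
  · have h1 : outLetter 1 1 d (hat A.m 1 d) =
        ⟨hdeg d - 1, vdeg d + 1 - 1, (wordExp d + vdeg d).negOnePow • evalWord (A.m 1) d⟩ := by
      simp [outLetter, hat]
    obtain ⟨y, rfl⟩ := List.length_eq_one_iff.1 hd
    rw [h1, (isMultiAdd_hatCochain s δ c u).map_smul, hatCochain, if_pos]
    · simp only [smul_smul]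
      congr 1
      simp only [sgn, ← Int.negOnePow_add, Int.negOnePow_eq_iff, hdeg_append, vdeg_append,
        hdeg_cons, vdeg_cons, wordExp_append, wordExp_cons, List.length_append, List.length_cons,
        wordExp, hdeg_nil, vdeg_nil, List.length_nil]
      have : (n : ℤ) = a.length + e.length + 1 := by simp at hn; omega
      rw [this]
      push_cast
      grind
    · simp at hn ⊢
      omega
  · rw [hat_eq_zero (hA.eq_zero hA01 (by omega)), outLetter,
      (isMultiAdd_hatCochain s δ c u).map_zero, smul_zero, smul_zero]

omit hA hA01 in
theorem letterDel_hatCochain (s δ : ℤ) (c : (n : ℕ) → Multi k M M n) (u n : ℕ)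
    {l : List (Letter M)}
    (hl : IsHomWord 𝒜 l) (hn : l.length = n) (hs : (u : ℤ) + n = s) (x : Fin n → M) (r : ℤ)
    (hx : ∀ (t : ℕ) (h : t < n) (h' : t < l.length), x ⟨t, h⟩ = l[t].val) :
    letterDel (delHom (A.m 1 1)) (outLetter δ u l (hatCochain s δ c u l)) =
      (wordExp l + u * (vdeg l + δ) + vdeg l + δ).negOnePow •
        circ 𝒜 (a := n) (n := 1) (m := n) (by omega) (A.m 1 1) (c n) r (s - n) x := by
  rw [circ_eq_splitSum 𝒜 (A.m 1) c _ r (s - n) (fun c => 0) (fun c => 0) hl hn x hx,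
    splitSum_splitSum_of_length _ n fun a c e hc => if_neg hc, hn, Nat.add_sub_cancel_left,
    Finset.sum_range_one]
  rw [if_pos (by simp [hn])]
  simp only [List.take_zero, List.drop_zero, List.nil_append]
  have h1 : l.take n = l := by rw [← hn, List.take_length]
  have h2 : l.drop n = [] := by rw [← hn, List.drop_length]
  rw [h1, h2, ← evalWord_eq (A.m 1) (n := 1) (x := fun _ => evalWord c l) rfl, ← delHom_apply,
    letterDel, outLetter_val, hatCochain, if_pos (by omega), del_smul]
  · simp only [smul_smul]
    congr 1
    simp only [← Int.negOnePow_add, Int.negOnePow_eq_iff, outLetter_j]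
    simp
    grind
  · intro a h h'
    obtain rfl : a = 0 := by omega
    rfl

omit hA hA01 in
theorem convFam_hatCochain (s δ : ℤ) (c : (n : ℕ) → Multi k M M n) (u n : ℕ)
    {l : List (Letter M)}
    (hl : IsHomWord 𝒜 l) (hn : l.length = n + 1) (hs : (u : ℤ) + n = s) (x : Fin (n + 1) → M)
    (hx : ∀ (t : ℕ) (h : t < n + 1) (h' : t < l.length), x ⟨t, h⟩ = l[t].val) :
    convFam (mulHom (A.m 0 2)) 0 δ idFam (hatCochain s δ c) u l +
      convFam (mulHom (A.m 0 2)) δ 0 (hatCochain s δ c) idFam u l =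
      (wordExp l + u * (vdeg l + δ) + u).negOnePow •
        circ 𝒜 (a := n + 1) (n := 2) (m := n) (by omega) (A.m 0 2) (c n) (1 + δ - s) (s - n) x := by
  rw [circ_eq_splitSum 𝒜 (A.m 0) c _ (1 + δ - s) (s - n) (fun c => 0) (fun c => 0) hl hn x hx,
    splitSum_splitSum_of_length _ n fun a c e hc => if_neg hc, hn,
    show n + 1 + 1 - n = 2 by omega, Finset.sum_range_succ, Finset.sum_range_one]
  have hmul : ∀ y z : Letter M, evalWord (A.m 0) [y, z] = mulHom (A.m 0 2) y.val z.val := by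
    intro y z
    rw [mulHom_apply]
    symm
    refine evalWord_eq (A.m 0) (n := 2) (l := [y, z]) rfl _ fun a h h' => ?_
    rcases a with _ | _ | a
    · rfl
    · rfl
    · omega
  rw [smul_add, add_comm]
  congr 1
  · obtain ⟨l', y, rfl⟩ : ∃ l' y, l = l' ++ [y] :=
      ⟨_, _, (List.dropLast_append_getLast (List.ne_nil_of_length_eq_add_one hn)).symm⟩
    have hn' : l'.length = n := by simpa using hn
    rw [convFam_idFam_right]
    subst hn'
    simp only [List.take_zero, List.drop_zero, List.take_left', List.drop_left', List.nil_append,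
      if_true, hmul, letterMul, outLetter_val]
    rw [hatCochain, if_pos hs, mu_smul_left]
    simp only [smul_smul]
    congr 1
    simp only [← Int.negOnePow_add, Int.negOnePow_eq_iff, vdeg_append, vdeg_cons, wordExp_append,
      wordExp_cons, wordExp, outLetter_i, outLetter_j, vdeg_nil, hdeg_nil, List.length_nil,
      List.length_cons, Nat.cast_zero]
    push_cast
    grind
  · obtain ⟨y, l', rfl⟩ := List.exists_of_length_succ l hn
    have hn' : l'.length = n := by simpa using hn
    rw [convFam_idFam_left]
    subst hn'
    simp only [List.take_succ_cons, List.take_zero, List.drop_succ_cons, List.drop_zero,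
      List.take_length, List.drop_length, if_true, List.cons_append, List.nil_append, hmul,
      letterMul, outLetter_val]
    rw [hatCochain, if_pos hs, mu_smul_right]
    simp only [smul_smul]
    congr 1
    simp only [← Int.negOnePow_add, Int.negOnePow_eq_iff, vdeg_cons, hdeg_cons,
      wordExp_cons, outLetter_i, outLetter_j, vdeg_nil, hdeg_nil, List.length_nil,
      List.length_cons, Nat.cast_zero, add_zero, ← hs, add_sub_cancel_right]
    push_cast
    clear hx hmul hl hn hs
    grind

-- The four compositions in `(-1)^κ [μ, c] + [∂, c]` are matched with the four terms of the twisted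
-- differential; only four identities of signs remain to be checked.
omit hA hA01 in
theorem differential_signs {D A S B₁ B₂ w₁ w₂ w₃ w₄ : ℤˣ} (C₁ C₂ C₃ C₄ : M)
    (h₁ : w₁ = -(A * (S * B₁))) (h₂ : w₂ = -(A * B₂)) (h₃ : D * w₃ = -A) (h₄ : D * w₄ = -(A * S)) :
    w₂ • C₂ + w₁ • C₁ - D • (w₃ • C₃ + w₄ • C₄) =
      A • (S • (C₄ - B₁ • C₁) + (C₃ - B₂ • C₂)) := by
  rw [smul_add, smul_smul, smul_smul, h₁, h₂, h₃, h₄]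
  simp only [smul_add, smul_sub, smul_smul, Units.neg_smul]
  abel

omit hA01 in
theorem insSum_hat_eq_zero {φ : List (Letter M) → M} (hφ : IsMultiAdd φ) {p : ℕ} (hp : 3 ≤ p)
    (l : List (Letter M)) : insSum p φ (hat A.m p) l = 0 := by
  refine splitSum_eq_zero fun a b _ => splitSum_eq_zero fun d e _ => ?_
  rw [hat_eq_zero (hA p d.length (by omega)), outLetter, hφ.map_zero, smul_zero]

theorem insSum_hat_two {φ : List (Letter M) → M} (hφ : IsMultiAdd φ)
    (l : List (Letter M)) : insSum 2 φ (hat A.m 2) l = 0 := by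
  refine splitSum_eq_zero fun a b _ => splitSum_eq_zero fun d e _ => ?_
  rcases Nat.eq_zero_or_pos d.length with h | h
  · rw [hat_eq_zero (by rw [h]; exact A.m_zero 2), outLetter, hφ.map_zero, smul_zero]
  · rw [hat_eq_zero (hA.eq_zero hA01 (by omega)), outLetter, hφ.map_zero, smul_zero]

theorem act_hat_succ {φ : Family M} (hφ : ∀ i, IsMultiAdd (φ i)) (u : ℕ) (l : List (Letter M)) :
    act φ (hat A.m) (u + 1) l = insSum 1 (φ u) (hat A.m 1) l +
      insSum 0 (φ (u + 1)) (hat A.m 0) l := by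
  rw [act, ← Finset.sum_subset (s₁ := {(u, 1), (u + 1, 0)}), Finset.sum_pair (by simp)]
  · intro x hx
    simp only [Finset.mem_insert, Finset.mem_singleton] at hx
    rcases hx with rfl | rfl <;> simp
  · rintro ⟨i, p⟩ hx hne
    rw [HasAntidiagonal.mem_antidiagonal] at hx
    simp only [Finset.mem_insert, Finset.mem_singleton, Prod.mk.injEq] at hne hx
    rcases (by omega : p = 2 ∨ 3 ≤ p) with rfl | hp
    · exact insSum_hat_two hA hA01 (hφ _) l
    · exact insSum_hat_eq_zero hA (hφ _) hp l

/-- The differential on families of words is the Hochschild differential. -/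
theorem twistedD_hatCochain (s δ : ℤ) (c : (n : ℕ) → Multi k M M n)
    (hc : ∀ n : ℕ, s < n → c n = 0) (u n : ℕ) {l : List (Letter M)}
    (hl : IsHomWord 𝒜 l) (hn : l.length = n + 1) (hs : (u : ℤ) + n = s) :
    twistedD (mulHom (A.m 0 2)) (delHom (A.m 1 1)) (hat A.m) idFam δ (hatCochain s δ c) u l =
      (δ + 1).negOnePow • hatCochain (s + 1) (δ + 1)
        (hochD 𝒜 (A.m 0 2) (A.m 1 1) s (1 + δ - s) c) u l := by
  obtain ⟨x, hx⟩ : ∃ x : Fin (n + 1) → M, ∀ (t : ℕ) (h : t < n + 1) (h' : t < l.length),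
    x ⟨t, h⟩ = l[t].val := ⟨fun t => (l.get (t.cast hn.symm)).val, fun _ _ _ => rfl⟩
  rw [hatCochain, if_pos (by omega), ← evalWord_eq _ hn _ hx]
  have hD : hochD 𝒜 (A.m 0 2) (A.m 1 1) s (1 + δ - s) c (n + 1) =
      (s - n).negOnePow • (circ 𝒜 (a := n + 1) (n := 2) (m := n) (by omega) (A.m 0 2) (c n)
          (1 + δ - s) (s - n) - ((((2 : ℕ) : ℤ) + 0 - 1) * ((n : ℤ) + (1 + δ - s) - 1)
            + 0 * (s - n)).negOnePow •
          circ 𝒜 (a := n + 1) (n := n) (m := 2) (by omega) (c n) (A.m 0 2) 0 0) +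
      (circ 𝒜 (a := n + 1) (n := 1) (m := n + 1) (by omega) (A.m 1 1) (c (n + 1))
          (1 + δ - s) (s - (n + 1)) - ((((1 : ℕ) : ℤ) + 0 - 1) * (((n + 1 : ℕ) : ℤ) +
            (1 + δ - s) - 1) + 1 * (s - (n + 1))).negOnePow •
          circ 𝒜 (a := n + 1) (n := n + 1) (m := 1) (by omega) (c (n + 1)) (A.m 1 1) 0 1) := rfl
  rw [hD]
  have e1 := insSum_hat_zero hA hA01 s δ c u n hl hn hs _ hx
  have e2 := convFam_hatCochain (A := A) s δ c u n hl hn hs _ hx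
  cases u with
  | zero =>
    have hact : act (hatCochain s δ c) (hat A.m) 0 l =
        insSum 0 (hatCochain s δ c 0) (hat A.m 0) l := by
      simp [act]
    -- In horizontal degree `0` the differential `∂` cannot contribute, and correspondingly the
    -- component of arity `n + 1 > s` is zero.
    have h0 : c (n + 1) = 0 := hc _ (by push_cast at hs ⊢; omega)
    have h1 : (circ 𝒜 (a := n + 1) (n := 1) (m := n + 1) (by omega) (A.m 1 1) (c (n + 1))
          (1 + δ - s) (s - (n + 1)) - ((((1 : ℕ) : ℤ) + 0 - 1) * (((n + 1 : ℕ) : ℤ) +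
            (1 + δ - s) - 1) + 1 * (s - (n + 1))).negOnePow •
          circ 𝒜 (a := n + 1) (n := n + 1) (m := 1) (by omega) (c (n + 1)) (A.m 1 1) 0 1) = 0 := by
      rw [h0]
      exact (bracket 𝒜 _ (A.m 1 1) 0 1 _ _).map_zero
    rw [h1]
    simp only [add_apply, sub_apply, smul_apply, zero_apply]
    rw [twistedD]
    simp only [Pi.sub_apply, Pi.smul_apply, Pi.add_apply, hact]
    rw [add_assoc (delFam _ _ _ _ _), e1, e2, delFam, smul_smul]
    -- The two slots belonging to `∂` are filled with zero, so `w₂`, `w₃` and `B₂` are chosen merely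
    -- to satisfy the sign conditions.
    have h := differential_signs (D := δ.negOnePow)
      (A := (δ + 1).negOnePow * (wordExp l + (0 : ℕ) * (vdeg l + (δ + 1) + 1)).negOnePow)
      (S := (s - n).negOnePow)
      (B₁ := ((((2 : ℕ) : ℤ) + 0 - 1) * ((n : ℤ) + (1 + δ - s) - 1) + 0 * (s - n)).negOnePow)
      (B₂ := 1)
      (w₁ := (wordExp l + (0 : ℕ) * (vdeg l + δ)).negOnePow)
      (w₂ := -((δ + 1).negOnePow * (wordExp l + (0 : ℕ) * (vdeg l + (δ + 1) + 1)).negOnePow * 1))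
      (w₃ := δ.negOnePow * -((δ + 1).negOnePow *
        (wordExp l + (0 : ℕ) * (vdeg l + (δ + 1) + 1)).negOnePow))
      (w₄ := (wordExp l + (0 : ℕ) * (vdeg l + δ) + (0 : ℕ)).negOnePow)
      (circ 𝒜 (a := n + 1) (n := n) (m := 2) (by omega) (c n) (A.m 0 2) 0 0 x) 0 0
      (circ 𝒜 (a := n + 1) (n := 2) (m := n) (by omega) (A.m 0 2) (c n) (1 + δ - s) (s - n) x)
      ?_ rfl ?_ ?_
    · simpa only [smul_zero, zero_add, sub_zero, add_zero] using h
    · rw [← neg_one_mul, ← Int.negOnePow_one]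
      simp only [← Int.negOnePow_add, Int.negOnePow_eq_iff, ← hs]
      push_cast
      grind
    · rw [← mul_assoc, Int.units_mul_self, one_mul]
    · rw [← neg_one_mul, ← Int.negOnePow_one]
      simp only [← Int.negOnePow_add, Int.negOnePow_eq_iff, ← hs]
      push_cast
      grind
  | succ u =>
    have e3 := insSum_hat_one hA hA01 s δ c u (n + 1) hl hn (by push_cast at hs ⊢; omega) _ hx
    have e4 := letterDel_hatCochain (A := A) s δ c u (n + 1) hl hn (by push_cast at hs ⊢; omega) _
      (1 + δ - s) hx
    push_cast at e4
    simp only [add_apply, sub_apply, smul_apply]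
    rw [twistedD]
    simp only [Pi.sub_apply, Pi.smul_apply, Pi.add_apply,
      act_hat_succ hA hA01 (isMultiAdd_hatCochain s δ c)]
    rw [add_assoc (delFam _ _ _ _ _), e1, e2, e3, delFam, e4, smul_smul]
    refine differential_signs _ _ _ _ ?_ ?_ ?_ ?_
    all_goals
      rw [← neg_one_mul, ← Int.negOnePow_one]
      simp only [← Int.negOnePow_add, Int.negOnePow_eq_iff, ← hs]
      push_cast
      grind

/-- A cochain of degree `s` only contributes to the differential in degree `s + 1`. -/
theorem twistedD_hatCochain_of_ne (s δ : ℤ) (c : (n : ℕ) → Multi k M M n)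
    (u : ℕ) {l : List (Letter M)} (hs : (u : ℤ) + l.length ≠ s + 1) :
    twistedD (mulHom (A.m 0 2)) (delHom (A.m 1 1)) (hat A.m) idFam δ (hatCochain s δ c) u l =
      0 := by
  have h1 : act (hatCochain s δ c) (hat A.m) u l = 0 := by
    refine Finset.sum_eq_zero fun x hx => splitSum_eq_zero fun a b hab =>
      splitSum_eq_zero fun d e hde => ?_
    rw [HasAntidiagonal.mem_antidiagonal] at hx
    subst hde hab
    by_cases h : x.2 + d.length = 2
    · rw [hatCochain_of_ne, smul_zero]
      simp only [List.length_append, List.length_cons] at hs ⊢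
      push_cast at hs ⊢
      omega
    · rw [hat_eq_zero (hA.eq_zero hA01 h), outLetter, (isMultiAdd_hatCochain s δ c _).map_zero,
        smul_zero]
  have h2 : delFam (delHom (A.m 1 1)) δ (hatCochain s δ c) u l = 0 := by
    cases u with
    | zero => rfl
    | succ u =>
      rw [delFam, hatCochain_of_ne _ (by push_cast at hs; omega)]
      simp [letterDel]
  have h3 : convFam (mulHom (A.m 0 2)) 0 δ idFam (hatCochain s δ c) u l = 0 := by
    rcases l with _ | ⟨y, l⟩
    · exact convFam_idFam_left_nil _ _ _ _
    · rw [convFam_idFam_left, hatCochain_of_ne _ (by simp at hs; omega)]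
      simp [letterMul]
  have h4 : convFam (mulHom (A.m 0 2)) δ 0 (hatCochain s δ c) idFam u l = 0 := by
    rcases List.eq_nil_or_concat l with rfl | ⟨l', y, rfl⟩
    · exact convFam_idFam_right_nil _ _ _ _
    · rw [List.concat_eq_append, convFam_idFam_right, hatCochain_of_ne _ (by simp at hs; omega)]
      simp [letterMul]
  simp [twistedD, h1, h2, h3, h4]

end Differential

/-! ### The morphism relations as vanishing of the curvature -/

section MorphismRelation

variable {k : Type u} [CommRing k]
variable {M : Type v} [AddCommGroup M] [Module k M]
variable {𝒜 : ℕ × ℤ → Submodule k M} [DirectSum.Decomposition 𝒜]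

theorem sum_antidiagonalTuple_one {N : Type*} [AddCommMonoid N] (n : ℕ) (F : (Fin 1 → ℕ) → N) :
    ∑ p ∈ Finset.Nat.antidiagonalTuple 1 n, F p = F ![n] := by
  rw [Finset.Nat.antidiagonalTuple_one, Finset.sum_singleton]

theorem sum_antidiagonalTuple_two {N : Type*} [AddCommMonoid N] (n : ℕ) (F : (Fin 2 → ℕ) → N) :
    ∑ p ∈ Finset.Nat.antidiagonalTuple 2 n, F p = ∑ p ∈ antidiagonal n, F ![p.1, p.2] := by
  rw [Finset.Nat.antidiagonalTuple_two, Finset.sum_map]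
  rfl

theorem eps_two (u p₀ p₁ q₀ q₁ : ℕ) :
    eps u ![p₀, p₁] ![q₀, q₁] = u + (p₀ + q₀) + q₀ * (p₁ + q₁) := by
  have h1 : Finset.Ioi (0 : Fin 2) = {1} := by decide
  have h2 : Finset.Ioi (1 : Fin 2) = ∅ := by decide
  simp [eps, Fin.sum_univ_two, h1, h2]

theorem eps_single (u p q : ℕ) : eps u ![p] ![q] = u := by
  simp [eps]

variable (𝒜) in
theorem tensorArgs_single (f : (s t : ℕ) → Multi k M M t) (p q : ℕ) (x : ℕ → M) :
    tensorArgs 𝒜 f ![p] ![q] x = fun _ => f p q fun a => x a := by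
  funext l
  obtain rfl : l = 0 := Subsingleton.elim _ _
  have h1 : Finset.Ioi (0 : Fin 1) = ∅ := by decide
  have h2 : Finset.Iio (0 : Fin 1) = ∅ := by decide
  change f p q (fun a : Fin q => _) = f p q _
  congr 1
  funext c
  rw [h1, h2]
  simp [signOp_zero]

variable (𝒜) in
theorem tensorArgs_pair (f : (s t : ℕ) → Multi k M M t) (p₀ p₁ q₀ q₁ : ℕ) (x : ℕ → M) :
    tensorArgs 𝒜 f ![p₀, p₁] ![q₀, q₁] x =
      ![f p₀ q₀ fun a => signOp 𝒜 p₁ (1 - ((p₁ : ℤ) + q₁)) (x a),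
        f p₁ q₁ fun a => x (q₀ + a)] := by
  have h1 : Finset.Ioi (0 : Fin 2) = {1} := by decide
  have h2 : Finset.Iio (0 : Fin 2) = ∅ := by decide
  have h3 : Finset.Ioi (1 : Fin 2) = ∅ := by decide
  have h4 : Finset.Iio (1 : Fin 2) = {0} := by decide
  funext l
  fin_cases l
  · change f p₀ q₀ (fun a : Fin q₀ => _) = f p₀ q₀ _
    congr 1
    funext c
    simp [h1, h2]
  · change f p₁ q₁ (fun a : Fin q₁ => _) = f p₁ q₁ _
    congr 1
    funext c
    simp [h3, h4, signOp_zero]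

/-- The right hand side of the relations of a morphism into a bidga. -/
theorem sum_tensorArgs_eq {A : DAInf 𝒜} (hA : A.IsBidga) (hA01 : A.m 0 1 = 0)
    (f : (s t : ℕ) → Multi k M M t) (hf : ∀ s, f s 0 = 0) (u v : ℕ) (hv : 1 ≤ v) (x : ℕ → M) :
    ∑ ip ∈ antidiagonal u, ∑ j ∈ Finset.Icc 1 v,
      ∑ p ∈ Finset.Nat.antidiagonalTuple j ip.2,
        ∑ q ∈ (Finset.Nat.antidiagonalTuple j v).filter fun q => ∀ w, 1 ≤ q w,
          (-1 : ℤ) ^ eps u p q • A.m ip.1 j (tensorArgs 𝒜 f p q x) =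
    (if 0 < u then (-1 : ℤ) ^ u • delHom (A.m 1 1) (f (u - 1) v fun a => x a) else 0) +
      ∑ p ∈ antidiagonal u, ∑ q ∈ antidiagonal v,
        (-1 : ℤ) ^ (u + (p.1 + q.1) + q.1 * (p.2 + q.2)) • mulHom (A.m 0 2)
          (f p.1 q.1 fun a => signOp 𝒜 p.2 (1 - ((p.2 : ℤ) + q.2)) (x a))
          (f p.2 q.2 fun a => x (q.1 + a)) := by
  -- Only `m_02` and `m_11` survive on the right, which leaves a quadratic and a linear term in `f`.
  have hz : ∀ i p : ℕ, ∀ j, i + j ≠ 2 → ∑ p ∈ Finset.Nat.antidiagonalTuple j p,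
        ∑ q ∈ (Finset.Nat.antidiagonalTuple j v).filter fun q => ∀ w, 1 ≤ q w,
          (-1 : ℤ) ^ eps u p q • A.m i j (tensorArgs 𝒜 f p q x) = 0 := fun i p j hij => by
    rw [hA.eq_zero hA01 hij]
    simp
  have h1 : ∑ j ∈ Finset.Icc 1 v, ∑ p ∈ Finset.Nat.antidiagonalTuple j u,
        ∑ q ∈ (Finset.Nat.antidiagonalTuple j v).filter fun q => ∀ w, 1 ≤ q w,
          (-1 : ℤ) ^ eps u p q • A.m 0 j (tensorArgs 𝒜 f p q x) =
      ∑ p ∈ antidiagonal u, ∑ q ∈ antidiagonal v,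
        (-1 : ℤ) ^ (u + (p.1 + q.1) + q.1 * (p.2 + q.2)) • mulHom (A.m 0 2)
          (f p.1 q.1 fun a => signOp 𝒜 p.2 (1 - ((p.2 : ℤ) + q.2)) (x a))
          (f p.2 q.2 fun a => x (q.1 + a)) := by
    rw [Finset.sum_eq_single 2 (fun j _ hj => hz 0 u j (by omega))]
    · rw [sum_antidiagonalTuple_two]
      refine Finset.sum_congr rfl fun p _ => ?_
      rw [Finset.sum_filter, sum_antidiagonalTuple_two]
      refine Finset.sum_congr rfl fun q _ => ?_
      rw [eps_two, tensorArgs_pair, ← mulHom_apply]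
      -- Dropping the condition `1 ≤ q w` changes nothing: a block of length zero contributes `f s 0
      -- = 0`.
      split_ifs with h
      · rfl
      · rw [Fin.forall_fin_two] at h
        simp only [Matrix.cons_val_zero, Matrix.cons_val_one, Matrix.cons_val_fin_one] at h
        obtain ⟨q₀, q₁⟩ := q
        dsimp only at h ⊢
        rcases (by omega : q₀ = 0 ∨ q₁ = 0) with rfl | rfl
        · simp [hf]
        · simp [hf]
    -- For `v = 1` the index `j = 2` is out of range, but `v` is then not a sum of two positive
    -- lengths either.
    · intro h
      obtain rfl : v = 1 := by
        rw [Finset.mem_Icc] at h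
        omega
      rw [sum_antidiagonalTuple_two]
      refine Finset.sum_eq_zero fun p _ => ?_
      refine Finset.sum_eq_zero fun q hq => ?_
      rw [Finset.mem_filter, Finset.Nat.mem_antidiagonalTuple, Fin.sum_univ_two,
        Fin.forall_fin_two] at hq
      omega
  rcases u with _ | u
  · rw [Finset.Nat.antidiagonal_zero, Finset.sum_singleton, h1, if_neg (by omega), zero_add]
    rfl
  · rw [Finset.Nat.sum_antidiagonal_succ, h1, if_pos (by omega), add_comm]
    congr 1
    rw [Finset.sum_eq_single (0, u)]
    · rw [Finset.sum_eq_single 1 (fun j _ hj => hz _ _ j (by omega)) fun h => absurd h (by simp [hv])]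
      rw [sum_antidiagonalTuple_one, Finset.sum_filter, sum_antidiagonalTuple_one, if_pos, eps_single,
        tensorArgs_single]
      · rfl
      · intro w
        obtain rfl : w = 0 := Subsingleton.elim _ _
        exact hv
    · rintro ⟨i, p⟩ hip hne
      rw [HasAntidiagonal.mem_antidiagonal] at hip
      refine Finset.sum_eq_zero fun j hj => hz _ _ j ?_
      rw [Finset.mem_Icc] at hj
      rintro h
      apply hne
      dsimp only at h hip ⊢
      rw [Prod.mk.injEq]
      omega
    · intro h
      simp at h

/-- The quadratic terms correspond to cuts of the word into two blocks. As in `sum_ins_eq`, the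
remaining sign depends only on the word and on `u`, so both sides of the relation can be compared.
-/
theorem sum_tensorArgs_word {A : DAInf 𝒜}
    (f : (s t : ℕ) → Multi k M M t) (u : ℕ) {l : List (Letter M)}
    (hl : IsHomWord 𝒜 l) (x : ℕ → M) (hx : ∀ (t : ℕ) (h : t < l.length), x t = l[t].val) :
    (if 0 < u then (-1 : ℤ) ^ u • delHom (A.m 1 1) (f (u - 1) l.length fun a => x a) else 0) +
      ∑ p ∈ antidiagonal u, ∑ q ∈ antidiagonal l.length,
        (-1 : ℤ) ^ (u + (p.1 + q.1) + q.1 * (p.2 + q.2)) • mulHom (A.m 0 2)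
          (f p.1 q.1 fun a => signOp 𝒜 p.2 (1 - ((p.2 : ℤ) + q.2)) (x a))
          (f p.2 q.2 fun a => x (q.1 + a)) =
    (wordExp l + u * vdeg l + u.choose 2 + u).negOnePow •
      (delFam (delHom (A.m 1 1)) 0 (hat f) u l +
        convFam (mulHom (A.m 0 2)) 0 0 (hat f) (hat f) u l) := by
  rw [smul_add]
  congr 1
  · rcases u with _ | u
    · simp [delFam]
    · rw [if_pos (by omega), Nat.add_sub_cancel, evalWord_eq (f u) rfl _ fun a h h' => hx a h, delFam,
        letterDel, outLetter_val, hat, del_smul]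
      simp only [smul_smul, Units.smul_def, ← Int.coe_negOnePow_natCast, ← Units.val_mul]
      congr 1
      congr 1
      rw [choose_two_add u 1]
      simp only [← Int.negOnePow_add, Int.negOnePow_eq_iff, outLetter_j]
      push_cast
      rw [Nat.choose_eq_zero_of_lt (by norm_num : 1 < 2)]
      push_cast
      grind
  · rw [convFam, Finset.smul_sum]
    refine Finset.sum_congr rfl fun p hp => ?_
    rw [HasAntidiagonal.mem_antidiagonal] at hp
    obtain ⟨i, p⟩ := p
    dsimp only at hp
    subst hp
    rw [conv, splitSum_eq_sum, Finset.Nat.sum_antidiagonal_eq_sum_range_succ_mk, Finset.smul_sum]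
    refine Finset.sum_congr rfl fun n hn => ?_
    rw [mem_range] at hn
    obtain ⟨a, ha⟩ : ∃ a, a = l.take n := ⟨_, rfl⟩
    obtain ⟨b, hb⟩ : ∃ b, b = l.drop n := ⟨_, rfl⟩
    have hl' : l = a ++ b := by rw [ha, hb, List.take_append_drop]
    have hal : a.length = n := by rw [ha, List.length_take]; omega
    rw [← ha, ← hb]
    clear ha hb
    subst hl' hal
    have hbl : (a ++ b).length - a.length = b.length := by simp
    dsimp only
    rw [hbl]
    have e1 := evalWord_map_signLetter (isMultiAdd_evalWord (f i)) p (1 - ((p : ℤ) + b.length))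
      [] a []
    simp only [List.nil_append, List.append_nil] at e1
    rw [← evalWord_eq (f i) (n := a.length) (by simp)
      (fun t => signOp 𝒜 p (1 - ((p : ℤ) + b.length)) (x t)) fun t ht ht' => ?_] at e1
    · rw [e1, evalWord_eq (f p) (l := b) rfl _ fun t ht ht' => ?_]
      · simp only [letterMul, outLetter_val, hat, mu_smul_left, mu_smul_right]
        simp only [smul_smul, Units.smul_def, ← Int.coe_negOnePow_natCast, ← Units.val_mul]
        congr 1
        congr 1
        rw [choose_two_add]
        simp only [← Int.negOnePow_add, Int.negOnePow_eq_iff, outLetter_j, outLetter_i,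
          wordExp_append, vdeg_append]
        push_cast
        grind
      · change x (a.length + t) = _
        rw [hx _ (by simp; omega), List.getElem_append_right (by omega)]
        congr 2
        omega
    · rw [List.getElem_map, hx _ (by simp; omega), List.getElem_append_left ht]
      exact signOp_of_mem 𝒜 (hl _ (List.mem_append_left _ (List.getElem_mem ht)))

/-- The difference of the two sides of the relations of a morphism into a bidga. -/
theorem morphism_defect {A B : DAInf 𝒜} (hA : A.IsBidga) (hA01 : A.m 0 1 = 0)
    (f : (s t : ℕ) → Multi k M M t) (hf : ∀ s, f s 0 = 0) (u : ℕ) {l : List (Letter M)}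
    (hl : IsHomWord 𝒜 l) (hl0 : 1 ≤ l.length)
    (x : ℕ → M) (hx : ∀ (t : ℕ) (h : t < l.length), x t = l[t].val) :
    ∑ ip ∈ antidiagonal u, ∑ jq ∈ antidiagonal (l.length + 1), ∑ r : Fin jq.1,
      (-1 : ℤ) ^ ((r : ℕ) * jq.2 + (jq.1 - 1 - r) + ip.2 * jq.1) •
        ins 𝒜 (f ip.1 jq.1) (B.m ip.2 jq.2) ip.2 (2 - ((ip.2 : ℤ) + jq.2)) r x -
    ∑ ip ∈ antidiagonal u, ∑ j ∈ Finset.Icc 1 l.length,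
      ∑ p ∈ Finset.Nat.antidiagonalTuple j ip.2,
        ∑ q ∈ (Finset.Nat.antidiagonalTuple j l.length).filter fun q => ∀ w, 1 ≤ q w,
          (-1 : ℤ) ^ eps u p q • A.m ip.1 j (tensorArgs 𝒜 f p q x) =
    (wordExp l + u * vdeg l + u.choose 2 + u).negOnePow •
      curvature (mulHom (A.m 0 2)) (delHom (A.m 1 1)) (hat B.m) (hat f) u l := by
  rw [sum_tensorArgs_eq hA hA01 f hf u _ hl0 x, sum_tensorArgs_word f u hl x hx, curvature,
    sub_sub, Pi.sub_apply, Pi.sub_apply, smul_sub]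
  congr 1
  rw [act, Finset.smul_sum]
  refine Finset.sum_congr rfl fun ip hip => ?_
  rw [sum_ins_eq 𝒜 f B.m ip.1 ip.2 hl x hx, HasAntidiagonal.mem_antidiagonal.1 hip]

end MorphismRelation

/-! ### Reduction of multilinear identities to homogeneous words -/

section Extension

variable {k : Type u} [CommRing k]
variable {M : Type v} [AddCommGroup M] [Module k M]
variable {N : Type w} [AddCommGroup N] [Module k N]

/-- Induction on the set of positions at which the argument is allowed to lie in the span rather
than in the generating set. -/
theorem multilinear_eq_zero_of_span {n : ℕ} (G : Multi k M N n) (S : Fin n → Set M)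
    (h : ∀ x, (∀ i, x i ∈ S i) → G x = 0) (x : Fin n → M)
    (hx : ∀ i, x i ∈ Submodule.span k (S i)) : G x = 0 := by
  suffices H : ∀ (s : Finset (Fin n)) (x : Fin n → M), (∀ i ∈ s, x i ∈ Submodule.span k (S i)) →
      (∀ i, i ∉ s → x i ∈ S i) → G x = 0 from
    H Finset.univ x (fun i _ => hx i) fun i hi => absurd (Finset.mem_univ i) hi
  intro s
  induction s using Finset.induction_on with
  | empty => exact fun x _ hx' => h x fun i => hx' i (Finset.notMem_empty i)
  | insert a s ha ih =>
    intro x hx hx'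
    have key : ∀ y ∈ Submodule.span k (S a), G (Function.update x a y) = 0 := by
      intro y hy
      induction hy using Submodule.span_induction with
      | mem y hy =>
        refine ih _ (fun i hi => ?_) fun i hi => ?_
        · rw [Function.update_of_ne (by rintro rfl; exact ha hi)]
          exact hx i (Finset.mem_insert_of_mem hi)
        · by_cases hia : i = a
          · subst hia
            rwa [Function.update_self]
          · rw [Function.update_of_ne hia]
            exact hx' i fun h => (Finset.mem_insert.1 h).elim hia hi
      | zero => exact G.map_update_zero _ _
      | add y z _ _ hy hz => rw [G.map_update_add, hy, hz, add_zero]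
      | smul c y _ hy => rw [G.map_update_smul, hy, smul_zero]
    have := key (x a) (hx a (Finset.mem_insert_self a s))
    rwa [Function.update_eq_self] at this

variable {𝒜 : ℕ × ℤ → Submodule k M}

theorem span_homogeneous [DirectSum.Decomposition 𝒜] :
    Submodule.span k {x : M | ∃ d, x ∈ 𝒜 d} = ⊤ := by
  rw [eq_top_iff, ← (DirectSum.Decomposition.isInternal 𝒜).submodule_iSup_eq_top, iSup_le_iff]
  exact fun d x hx => Submodule.subset_span ⟨d, hx⟩

theorem mem_piece {i : ℕ} {j : ℤ} {x : M} : x ∈ piece 𝒜 i j ↔ x ∈ 𝒜 (i, j) := by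
  simp [piece]

theorem piece_of_neg {i j : ℤ} (hi : i < 0) : piece 𝒜 i j = ⊥ := if_neg (by omega)

/-- A tuple of elements of given degrees as a word. -/
def tupleWord {n : ℕ} (d : Fin n → ℕ × ℤ) (x : Fin n → M) : List (Letter M) :=
  List.ofFn fun a => ⟨(d a).1, (d a).2 - 1, x a⟩

omit [AddCommGroup M] in
theorem length_tupleWord {n : ℕ} (d : Fin n → ℕ × ℤ) (x : Fin n → M) :
    (tupleWord d x).length = n := List.length_ofFn

theorem isHomWord_tupleWord {n : ℕ} {d : Fin n → ℕ × ℤ} {x : Fin n → M}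
    (h : ∀ a, x a ∈ 𝒜 (d a)) : IsHomWord 𝒜 (tupleWord d x) := by
  intro y hy
  obtain ⟨a, rfl⟩ := (List.mem_ofFn' _ _).1 hy
  rw [IsHomLetter, sub_add_cancel, mem_piece]
  exact h a

omit [AddCommGroup M] in
theorem hdeg_tupleWord {n : ℕ} (d : Fin n → ℕ × ℤ) (x : Fin n → M) :
    hdeg (tupleWord d x) = ∑ a, ((d a).1 : ℤ) := by
  rw [hdeg, tupleWord, List.map_ofFn, List.sum_ofFn]
  rfl

omit [AddCommGroup M] in
theorem vdeg_tupleWord {n : ℕ} (d : Fin n → ℕ × ℤ) (x : Fin n → M) :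
    vdeg (tupleWord d x) + n = ∑ a, (d a).2 := by
  rw [vdeg, tupleWord, List.map_ofFn, List.sum_ofFn]
  simp [Function.comp_def, Finset.sum_sub_distrib]

theorem evalWord_tupleWord (f : (n : ℕ) → Multi k M N n) {n : ℕ} (d : Fin n → ℕ × ℤ)
    (x : Fin n → M) : evalWord f (tupleWord d x) = f n x :=
  (evalWord_eq f (length_tupleWord d x) x fun a h h' => by simp [tupleWord]).symm

/-- A homogeneous word either has a zero letter or comes from a tuple of homogeneous elements. -/
theorem IsHomWord.eq_tupleWord {l : List (Letter M)} (hl : IsHomWord 𝒜 l)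
    (h0 : ∀ x ∈ l, 0 ≤ x.i) :
    ∃ (d : Fin l.length → ℕ × ℤ) (x : Fin l.length → M), (∀ a, x a ∈ 𝒜 (d a)) ∧
      l = tupleWord d x := by
  refine ⟨fun a => ((l.get a).i.toNat, (l.get a).j + 1), fun a => (l.get a).val, fun a => ?_, ?_⟩
  · have h1 := hl _ (List.get_mem l a)
    have h2 := h0 _ (List.get_mem l a)
    rw [IsHomLetter, ← Int.toNat_of_nonneg h2, mem_piece] at h1
    exact h1
  · refine List.ext_get (length_tupleWord _ _).symm fun a h h' => ?_
    have h2 := h0 _ (List.get_mem l ⟨a, h⟩)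
    simp only [tupleWord, List.get_ofFn, add_sub_cancel_right]
    change l.get ⟨a, h⟩ = ⟨((l.get ⟨a, h⟩).i.toNat : ℤ), (l.get ⟨a, h⟩).j, (l.get ⟨a, h⟩).val⟩
    rw [Int.toNat_of_nonneg h2]

/-- Formal horizontal degrees are integers, but `piece` is zero in negative degrees; such a letter
has value zero. -/
theorem IsHomWord.exists_zero {l : List (Letter M)} (hl : IsHomWord 𝒜 l)
    (h0 : ¬ ∀ x ∈ l, 0 ≤ x.i) : ∃ a i j e, l = a ++ ⟨i, j, 0⟩ :: e := by
  push Not at h0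
  obtain ⟨x, hx, hxi⟩ := h0
  obtain ⟨a, e, rfl⟩ := List.append_of_mem hx
  have := hl x hx
  rw [IsHomLetter, piece_of_neg hxi, Submodule.mem_bot] at this
  exact ⟨a, x.i, x.j, e, by rw [← this]⟩

theorem isHomog_iff {ℬ : ℕ × ℤ → Submodule k N} (f : (n : ℕ) → Multi k M N n) (n : ℕ) (s t : ℤ) :
    IsHomog 𝒜 ℬ (f n) s t ↔ ∀ l, IsHomWord 𝒜 l → l.length = n →
      evalWord f l ∈ piece ℬ (hdeg l - s) (vdeg l + n + t) := by
  constructor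
  · rintro h l hl rfl
    by_cases h0 : ∀ x ∈ l, 0 ≤ x.i
    · obtain ⟨d, x, hx, e⟩ := hl.eq_tupleWord h0
      generalize hlen : l.length = n at d x hx e ⊢
      rw [hlen] at h
      subst e
      rw [evalWord_tupleWord, hdeg_tupleWord, vdeg_tupleWord]
      exact h d x hx
    · obtain ⟨a, i, j, e, rfl⟩ := hl.exists_zero h0
      rw [(isMultiAdd_evalWord f).map_zero]
      exact Submodule.zero_mem _
  · intro h d x hx
    have := h _ (isHomWord_tupleWord hx) (length_tupleWord d x)
    rwa [evalWord_tupleWord, hdeg_tupleWord, vdeg_tupleWord] at this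

variable [DirectSum.Decomposition 𝒜]

/-- A multilinear map is zero if it vanishes on homogeneous words. -/
theorem multilinear_eq_zero_of_word (f : (n : ℕ) → Multi k M N n) (n : ℕ)
    (h : ∀ l, IsHomWord 𝒜 l → l.length = n → evalWord f l = 0) : f n = 0 := by
  ext x
  refine multilinear_eq_zero_of_span (f n) (fun _ => {x : M | ∃ d, x ∈ 𝒜 d}) (fun y hy => ?_) x
    fun i => by rw [span_homogeneous]; trivial
  choose d hd using hy
  rw [← evalWord_tupleWord f d y]
  exact h _ (isHomWord_tupleWord hd) (length_tupleWord d y)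

omit [DirectSum.Decomposition 𝒜] in
theorem isHomWord_append {a b : List (Letter M)} :
    IsHomWord 𝒜 (a ++ b) ↔ IsHomWord 𝒜 a ∧ IsHomWord 𝒜 b := by
  simp only [IsHomWord, List.mem_append, or_imp, forall_and]

omit [DirectSum.Decomposition 𝒜] in
theorem isHomWord_cons {x : Letter M} {b : List (Letter M)} :
    IsHomWord 𝒜 (x :: b) ↔ IsHomLetter 𝒜 x ∧ IsHomWord 𝒜 b := by
  simp only [IsHomWord, List.mem_cons, or_imp, forall_and, forall_eq]

omit [DirectSum.Decomposition 𝒜] in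
theorem isHomLetter_unitLetter {e : M} (he : e ∈ 𝒜 (0, 0)) : IsHomLetter 𝒜 (unitLetter e) := by
  have : (unitLetter e).j + 1 = 0 := by simp [unitLetter]
  rw [IsHomLetter, this]
  exact mem_piece (i := 0).2 he

/-- A multilinear map vanishes if one argument is the unit, if it does so on homogeneous words. -/
theorem multilinear_unit_eq_zero (f : (n : ℕ) → Multi k M N n) {n : ℕ} {e : M} (he : e ∈ 𝒜 (0, 0))
    (p : Fin n) (h : ∀ a b, IsHomWord 𝒜 (a ++ unitLetter e :: b) → a.length = p →
      (a ++ unitLetter e :: b).length = n → evalWord f (a ++ unitLetter e :: b) = 0)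
    (x : Fin n → M) (hx : x p = e) : f n x = 0 := by
  refine multilinear_eq_zero_of_span (f n)
    (Function.update (fun _ => {x : M | ∃ d, x ∈ 𝒜 d}) p {e}) (fun y hy => ?_) x fun i => ?_
  · have hp : y p = e := by simpa using hy p
    -- The degree at position `p` is forced to be `(0, 0)`, even if the element lies in several
    -- pieces, so that the letter there is literally `unitLetter e`.
    have h1 : ∀ i, ∃ d, y i ∈ 𝒜 d ∧ (i = p → d = (0, 0)) := by
      intro i
      by_cases hi : i = p
      · exact ⟨(0, 0), by rw [hi, hp]; exact he, fun _ => rfl⟩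
      · have := hy i
        rw [Function.update_of_ne hi] at this
        obtain ⟨d, hd⟩ := this
        exact ⟨d, hd, fun h => absurd h hi⟩
    choose d hd hdp using h1
    have hlen := length_tupleWord d y
    have hpl : (p : ℕ) < (tupleWord d y).length := by rw [hlen]; exact p.2
    have h2 : tupleWord d y = (tupleWord d y).take p ++ unitLetter e ::
        (tupleWord d y).drop (p + 1) := by
      have h3 : (tupleWord d y)[(p : ℕ)] = unitLetter e := by
        simp [tupleWord, hdp p rfl, hp, unitLetter]
      rw [← h3, List.getElem_cons_drop, List.take_append_drop]
    have h4 := isHomWord_tupleWord hd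
    rw [h2] at h4
    rw [← evalWord_tupleWord f d y, h2]
    refine h _ _ h4 ?_ (by rw [← h2, hlen])
    rw [List.length_take]
    omega
  · by_cases hi : i = p
    · subst hi
      rw [Function.update_self, hx]
      exact Submodule.subset_span rfl
    · rw [Function.update_of_ne hi, span_homogeneous]
      trivial

omit [DirectSum.Decomposition 𝒜] in
theorem evalWord_unit_eq_zero (f : (n : ℕ) → Multi k M N n) {e : M} (a b : List (Letter M))
    (h : ∀ (x : Fin (a ++ unitLetter e :: b).length → M) (p : Fin _), (p : ℕ) = a.length →
      x p = e → f _ x = 0) : evalWord f (a ++ unitLetter e :: b) = 0 :=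
  h _ ⟨a.length, by simp⟩ rfl (by simp [unitLetter])

end Extension

/-! ### Multilinearity of the expressions in the morphism relations -/

section Represented

variable {k : Type u} [CommRing k]
variable {M : Type v} [AddCommGroup M] [Module k M]
variable {N : Type w} [AddCommGroup N] [Module k N]

/-- A function of sequences given by a multilinear map in the first `n` entries. -/
def IsMultilinear (k : Type u) [CommRing k] {M : Type v} [AddCommGroup M] [Module k M]
    {N : Type w} [AddCommGroup N] [Module k N] (n : ℕ) (Φ : (ℕ → M) → N) : Prop :=
  ∃ G : Multi k M N n, ∀ x : ℕ → M, (G fun i => x i) = Φ x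

theorem IsMultilinear.zero (n : ℕ) : IsMultilinear k n (fun _ : ℕ → M => (0 : N)) :=
  ⟨0, fun _ => rfl⟩

theorem IsMultilinear.add {n : ℕ} {Φ Ψ : (ℕ → M) → N} (h : IsMultilinear k n Φ)
    (h' : IsMultilinear k n Ψ) : IsMultilinear k n fun x => Φ x + Ψ x := by
  obtain ⟨G, hG⟩ := h
  obtain ⟨G', hG'⟩ := h'
  exact ⟨G + G', fun x => by rw [add_apply, hG, hG']⟩

theorem IsMultilinear.zsmul {n : ℕ} {Φ : (ℕ → M) → N} (c : ℤ) (h : IsMultilinear k n Φ) :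
    IsMultilinear k n fun x => c • Φ x := by
  obtain ⟨G, hG⟩ := h
  exact ⟨c • G, fun x => by rw [smul_apply, hG]⟩

theorem IsMultilinear.sub {n : ℕ} {Φ Ψ : (ℕ → M) → N} (h : IsMultilinear k n Φ)
    (h' : IsMultilinear k n Ψ) : IsMultilinear k n fun x => Φ x - Ψ x := by
  obtain ⟨G, hG⟩ := h
  obtain ⟨G', hG'⟩ := h'
  exact ⟨G - G', fun x => by rw [sub_apply, hG, hG']⟩

theorem IsMultilinear.sum {n : ℕ} {ι : Type*} {s : Finset ι} {Φ : ι → (ℕ → M) → N}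
    (h : ∀ i ∈ s, IsMultilinear k n (Φ i)) : IsMultilinear k n fun x => ∑ i ∈ s, Φ i x := by
  classical
  induction s using Finset.induction_on with
  | empty => exact IsMultilinear.zero n
  | insert a s ha ih =>
    simp only [Finset.sum_insert ha]
    exact (h a (Finset.mem_insert_self a s)).add
      (ih fun i hi => h i (Finset.mem_insert_of_mem hi))

variable (𝒜 : ℕ × ℤ → Submodule k M) [DirectSum.Decomposition 𝒜]

theorem ins_seq {j q n : ℕ} (hn : n + 1 = j + q) (f : Multi k M N j) (g : Multi k M M q)
    (s t : ℤ) (r : Fin j) (x : ℕ → M) :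
    ins 𝒜 f g s t r (seq fun i : Fin n => x i) = ins 𝒜 f g s t r x := by
  have h : ∀ a, a < n → seq (fun i : Fin n => x i) a = x a := fun a ha => by simp [seq, ha]
  unfold ins
  congr 1
  funext l
  have hl := l.2
  have hr := r.2
  unfold insArgs
  split_ifs with h1 h2
  · rw [Fin.lt_def] at h1
    by_cases hq : (l : ℕ) < n
    · rw [h _ hq]
    · omega
  · congr 1
    funext c
    exact h _ (by omega)
  · have h3 : (l : ℕ) ≠ r := fun h => h2 (Fin.ext h)
    rw [Fin.lt_def] at h1
    exact h _ (by omega)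

theorem isMultilinear_ins {j q n : ℕ} (hn : n + 1 = j + q) (f : Multi k M N j) (g : Multi k M M q)
    (s t : ℤ) (r : Fin j) : IsMultilinear k n (ins 𝒜 f g s t r) :=
  ⟨insMulti 𝒜 hn f g s t r, fun x => ins_seq 𝒜 hn f g s t r x⟩

-- Two successive insertions into `μ` represent this map: `f` in the first slot, then `g` in the
-- last. Bidegree `(0, 0)` is used so that no sign arises; the sign operator is already contained in
-- `S`.
include 𝒜 in
theorem isMultilinear_mul (μ : Multi k M M 2) {p q n : ℕ} (hn : p + q = n) (f : Multi k M M p)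
    (g : Multi k M M q) (S : M →ₗ[k] M) : IsMultilinear k n fun x : ℕ → M =>
      mulHom μ (f fun a => S (x a)) (g fun a => x (p + a)) := by
  obtain ⟨F, hF⟩ := isMultilinear_ins 𝒜 (n := p + 1) (by omega) μ
    (f.compLinearMap fun _ => S) 0 0 0
  obtain ⟨G, hG⟩ := isMultilinear_ins 𝒜 (n := n) (by omega) F g 0 0 (Fin.last p)
  refine ⟨G, fun x => ?_⟩
  rw [hG, ins]
  have h1 : insArgs 𝒜 g 0 0 (Fin.last p) x = fun i : Fin (p + 1) =>
      (fun a : ℕ => if a < p then x a else g fun c => x (p + c)) i := by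
    funext i
    simp only [insArgs, Fin.lt_def, Fin.ext_iff, Fin.val_last, signOp_zero]
    split_ifs with h1 h2
    · rfl
    · rfl
    · omega
  rw [h1, hF fun a : ℕ => if a < p then x a else g fun c => x (p + c), ins_zero_two]
  simp

include 𝒜 in
theorem isMultilinear_del (d : Multi k M M 1) {n : ℕ} (f : Multi k M M n) :
    IsMultilinear k n fun x : ℕ → M => delHom d (f fun a => x a) := by
  obtain ⟨G, hG⟩ := isMultilinear_ins 𝒜 (n := n) (by omega) d f 0 0 0
  exact ⟨G, fun x => by rw [hG, ins_zero_one]⟩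

end Represented

/-! ### Homogeneity of families -/

section Homogeneous

variable {k : Type u} [CommRing k]
variable {M : Type v} [AddCommGroup M] [Module k M]

/-- The operations of the family have bidegree `(-u, δ - u)` (in shifted degrees). -/
def IsHomFam (𝒜 : ℕ × ℤ → Submodule k M) (δ : ℤ) (φ : Family M) : Prop :=
  ∀ u l, IsHomWord 𝒜 l → IsHomLetter 𝒜 (outLetter δ u l (φ u l))

variable {𝒜 : ℕ × ℤ → Submodule k M}

theorem smul_mem_piece {i j : ℤ} (s : ℤˣ) {x : M} (hx : x ∈ piece 𝒜 i j) : s • x ∈ piece 𝒜 i j := by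
  rcases Int.units_eq_one_or s with rfl | rfl
  · rwa [one_smul]
  · rw [Units.neg_smul, one_smul]
    exact Submodule.neg_mem _ hx

theorem splitSum_mem {α : Type*} {P : Submodule k M} {F : List α → List α → M} {l : List α}
    (h : ∀ a b, a ++ b = l → F a b ∈ P) : splitSum F l ∈ P := by
  rw [splitSum_eq_sum]
  exact Submodule.sum_mem _ fun n _ => h _ _ (List.take_append_drop n l)

theorem IsHomFam.add {δ : ℤ} {φ ψ : Family M} (h : IsHomFam 𝒜 δ φ) (h' : IsHomFam 𝒜 δ ψ) :
    IsHomFam 𝒜 δ (φ + ψ) := fun u l hl => Submodule.add_mem _ (h u l hl) (h' u l hl)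

theorem IsHomFam.sub {δ : ℤ} {φ ψ : Family M} (h : IsHomFam 𝒜 δ φ) (h' : IsHomFam 𝒜 δ ψ) :
    IsHomFam 𝒜 δ (φ - ψ) := fun u l hl => Submodule.sub_mem _ (h u l hl) (h' u l hl)

theorem IsHomFam.smul {δ : ℤ} {φ : Family M} (s : ℤˣ) (h : IsHomFam 𝒜 δ φ) :
    IsHomFam 𝒜 δ (s • φ) := fun u l hl => smul_mem_piece s (h u l hl)

theorem mem_piece_congr {i j i' j' : ℤ} {x : M} (h : x ∈ piece 𝒜 i j) (hi : i = i') (hj : j = j') :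
    x ∈ piece 𝒜 i' j' := hi ▸ hj ▸ h

theorem IsHomFam.act {δ : ℤ} {φ m : Family M} (h : IsHomFam 𝒜 δ φ) (hm : IsHomFam 𝒜 1 m) :
    IsHomFam 𝒜 (δ + 1) (act φ m) := by
  intro u l hl
  rw [IsHomLetter, outLetter_val, DerivedAInf.act]
  refine Submodule.sum_mem (piece 𝒜 _ _) fun x hx => splitSum_mem fun a b hab =>
    splitSum_mem fun c e hce => smul_mem_piece _ ?_
  rw [HasAntidiagonal.mem_antidiagonal] at hx
  subst hce hab
  rw [isHomWord_append, isHomWord_append] at hl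
  refine mem_piece_congr (h x.1 (a ++ outLetter 1 x.2 c (m x.2 c) :: e)
    (isHomWord_append.2 ⟨hl.1, isHomWord_cons.2 ⟨hm _ _ hl.2.1, hl.2.2⟩⟩)) ?_ ?_
  · simp
    omega
  · simp
    omega

theorem isHomFam_idFam : IsHomFam 𝒜 0 (idFam : Family M) := by
  intro u l hl
  by_cases h : u = 0 ∧ l.length = 1
  · obtain ⟨rfl, h⟩ := h
    obtain ⟨y, rfl⟩ := List.length_eq_one_iff.1 h
    have := (isHomWord_cons.1 hl).1
    refine mem_piece_congr this ?_ ?_ <;> simp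
  · have : idFam u l = (0 : M) := by
      rcases u with _ | u
      · exact idFam_of_length_ne _ fun h' => h ⟨rfl, h'⟩
      · exact idFam_succ _ _
    rw [IsHomLetter, outLetter_val, this]
    exact Submodule.zero_mem _

/-- The product and the differential are homogeneous. -/
structure IsHomBidga (𝒜 : ℕ × ℤ → Submodule k M) (μ : M →+ M →+ M) (del : M →+ M) : Prop where
  mul : ∀ {i j i' j' : ℤ} {x y : M}, x ∈ piece 𝒜 i j → y ∈ piece 𝒜 i' j' →
    μ x y ∈ piece 𝒜 (i + i') (j + j')
  del : ∀ {i j : ℤ} {x : M}, x ∈ piece 𝒜 i j → del x ∈ piece 𝒜 (i - 1) j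

variable {μ : M →+ M →+ M} {del : M →+ M} (hom : IsHomBidga 𝒜 μ del)
include hom

theorem IsHomFam.delFam {δ : ℤ} {φ : Family M} (h : IsHomFam 𝒜 δ φ) :
    IsHomFam 𝒜 (δ + 1) (delFam del δ φ) := by
  intro u l hl
  cases u with
  | zero => exact Submodule.zero_mem (piece 𝒜 _ _)
  | succ u =>
    refine mem_piece_congr (smul_mem_piece _ (hom.del (h u l hl))) ?_ ?_
    · simp
      omega
    · simp
      omega

theorem IsHomFam.convFam {δ δ' : ℤ} {φ ψ : Family M} (h : IsHomFam 𝒜 δ φ)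
    (h' : IsHomFam 𝒜 δ' ψ) : IsHomFam 𝒜 (δ + δ' + 1) (convFam μ δ δ' φ ψ) := by
  intro u l hl
  rw [IsHomLetter, outLetter_val, DerivedAInf.convFam]
  refine Submodule.sum_mem (piece 𝒜 _ _) fun x hx => splitSum_mem fun a b hab =>
    smul_mem_piece _ ?_
  rw [HasAntidiagonal.mem_antidiagonal] at hx
  subst hab
  rw [isHomWord_append] at hl
  refine mem_piece_congr (smul_mem_piece _ (hom.mul (h x.1 a hl.1) (h' x.2 b hl.2))) ?_ ?_
  · simp
    omega
  · simp
    omega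

theorem IsHomFam.twistedD {δ : ℤ} {φ f m : Family M} (h : IsHomFam 𝒜 δ φ) (hf : IsHomFam 𝒜 0 f)
    (hm : IsHomFam 𝒜 1 m) : IsHomFam 𝒜 (δ + 1) (twistedD μ del m f δ φ) := by
  refine (h.act hm).sub (((h.delFam hom).add ?_ |>.add ?_).smul _)
  · simpa using hf.convFam hom h
  · simpa using h.convFam hom hf

theorem IsHomFam.curvature {f m : Family M} (hf : IsHomFam 𝒜 0 f)
    (hm : IsHomFam 𝒜 1 m) : IsHomFam 𝒜 1 (curvature μ del m f) := by
  refine ((?_ : IsHomFam 𝒜 1 _).sub ?_).sub ?_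
  · simpa using hf.act hm
  · simpa using hf.delFam hom
  · simpa using hf.convFam hom hf

end Homogeneous

/-! ### Leading terms with respect to the weight `u + |l|` -/

section Weights

variable {k : Type u} [CommRing k]
variable {M : Type v} [AddCommGroup M] [Module k M]
variable {𝒜 : ℕ × ℤ → Submodule k M} {μ : M →+ M →+ M} {del : M →+ M}

/-- The family agrees on homogeneous words with `u + |l| = s`. -/
def AgreeAt (𝒜 : ℕ × ℤ → Submodule k M) (s : ℤ) (φ ψ : Family M) : Prop :=
  ∀ (u : ℕ) l, IsHomWord 𝒜 l → (u : ℤ) + l.length = s → φ u l = ψ u l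

/-- The family vanishes on homogeneous words with a zero letter. -/
def IsZeroFam (𝒜 : ℕ × ℤ → Submodule k M) (φ : Family M) : Prop :=
  ∀ (u : ℕ) (a : List (Letter M)) (i j : ℤ) (e : List (Letter M)),
    IsHomWord 𝒜 (a ++ ⟨i, j, 0⟩ :: e) → φ u (a ++ ⟨i, j, 0⟩ :: e) = 0

theorem isZeroFam_of_isMultiAdd {φ : Family M} (h : ∀ i, IsMultiAdd (φ i)) : IsZeroFam 𝒜 φ :=
  fun u a i j e _ => (h u).map_zero a i j e

theorem conv_congr {δ δ' : ℤ} {i p : ℕ} {φ φ' ψ ψ' : List (Letter M) → M} {l : List (Letter M)}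
    (h : ∀ a b, a ++ b = l → μ (φ a) (ψ b) = μ (φ' a) (ψ' b)) :
    conv μ δ δ' i p φ ψ l = conv μ δ δ' i p φ' ψ' l :=
  splitSum_congr fun a b hab => by
    simp only [letterMul, outLetter_val, outLetter_i, outLetter_j, h a b hab]

/-- Inserting an operation of weight `w` into a component of weight `r` gives weight `r + w - 1`. As
`φ` starts in weight `s` and `m` in weight `2`, weight `s + 1` involves only the leading component
of each. -/
theorem act_agree {s : ℤ} {φ φ' m m' : Family M} (hφ : IsZeroFam 𝒜 φ)
    (hφ' : IsZeroFam 𝒜 φ') (h0 : ∀ t < s, AgreeAt 𝒜 t φ 0) (h0' : ∀ t < s, AgreeAt 𝒜 t φ' 0)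
    (hs : AgreeAt 𝒜 s φ φ') (hm : IsHomFam 𝒜 1 m) (hm' : IsHomFam 𝒜 1 m')
    (hm0 : ∀ t < 2, AgreeAt 𝒜 t m 0) (hm0' : ∀ t < 2, AgreeAt 𝒜 t m' 0) (hm2 : AgreeAt 𝒜 2 m m') :
    AgreeAt 𝒜 (s + 1) (act φ m) (act φ' m') := by
  intro u l hl hs1
  refine Finset.sum_congr rfl fun x hx => splitSum_congr fun a b hab => splitSum_congr
    fun c e hce => ?_
  rw [HasAntidiagonal.mem_antidiagonal] at hx
  subst hce hab
  rw [isHomWord_append, isHomWord_append] at hl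
  simp only [List.length_append] at hs1
  congr 1
  have hw : ∀ y : Letter M, (x.1 : ℤ) + (a ++ y :: e).length = s + 2 - (x.2 + c.length) := by
    intro y
    simp only [List.length_append, List.length_cons]
    omega
  have hh : ∀ y : Letter M, IsHomLetter 𝒜 y → IsHomWord 𝒜 (a ++ y :: e) := fun y hy =>
    isHomWord_append.2 ⟨hl.1, isHomWord_cons.2 ⟨hy, hl.2.2⟩⟩
  rcases lt_trichotomy ((x.2 : ℤ) + c.length) 2 with h | h | h
  · rw [hm0 _ h _ _ hl.2.1 rfl, hm0' _ h _ _ hl.2.1 rfl]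
    change φ _ (a ++ ⟨_, _, 0⟩ :: e) = φ' _ (a ++ ⟨_, _, 0⟩ :: e)
    have h3 := hh ⟨hdeg c - x.2, vdeg c + 1 - x.2, 0⟩ (Submodule.zero_mem (piece 𝒜 _ _))
    rw [hφ _ _ _ _ _ h3, hφ' _ _ _ _ _ h3]
  · have h3 := hh _ (hm x.2 c hl.2.1)
    rw [← hm2 _ _ hl.2.1 h]
    exact hs _ _ h3 (by rw [hw]; omega)
  · rw [h0 (s + 2 - (x.2 + c.length)) (by omega) _ _ (hh _ (hm x.2 c hl.2.1)) (hw _),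
      h0' (s + 2 - (x.2 + c.length)) (by omega) _ _ (hh _ (hm' x.2 c hl.2.1)) (hw _)]
    rfl

theorem delFam_agree {s δ : ℤ} {φ φ' : Family M} (hs : AgreeAt 𝒜 s φ φ') :
    AgreeAt 𝒜 (s + 1) (delFam del δ φ) (delFam del δ φ') := by
  intro u l hl hs1
  cases u with
  | zero => rfl
  | succ u => rw [delFam, delFam, hs u l hl (by push_cast at hs1; omega)]

/-- Weights add under convolution, so the lowest weight of a product is the product of the lowest
components. -/
theorem convFam_agree {s t δ δ' : ℤ} {φ φ' ψ ψ' : Family M} (h0 : ∀ r < s, AgreeAt 𝒜 r φ 0)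
    (h0' : ∀ r < s, AgreeAt 𝒜 r φ' 0)
    (h1 : ∀ r < t, AgreeAt 𝒜 r ψ 0) (h1' : ∀ r < t, AgreeAt 𝒜 r ψ' 0)
    (hs : AgreeAt 𝒜 s φ φ') (ht : AgreeAt 𝒜 t ψ ψ') :
    AgreeAt 𝒜 (s + t) (convFam μ δ δ' φ ψ) (convFam μ δ δ' φ' ψ') := by
  intro u l hl hst
  refine Finset.sum_congr rfl fun x hx => conv_congr fun a b hab => ?_
  rw [HasAntidiagonal.mem_antidiagonal] at hx
  subst hab
  rw [isHomWord_append] at hl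
  simp only [List.length_append] at hst
  rcases lt_trichotomy ((x.1 : ℤ) + a.length) s with h | h | h
  · rw [h0 _ h _ _ hl.1 rfl, h0' _ h _ _ hl.1 rfl]
    simp
  · rw [hs _ _ hl.1 h, ht _ _ hl.2 (by omega)]
  · rw [h1 (x.2 + b.length) (by omega) _ _ hl.2 rfl, h1' (x.2 + b.length) (by omega) _ _ hl.2 rfl]
    simp

theorem AgreeAt.refl (s : ℤ) (φ : Family M) : AgreeAt 𝒜 s φ φ := fun _ _ _ _ => rfl

/-- The lowest component of the differential of a family only depends on the lowest
components. -/
theorem twistedD_agree {s δ : ℤ} {φ φ' m m' f f' : Family M} (hφ : IsZeroFam 𝒜 φ)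
    (hφ' : IsZeroFam 𝒜 φ') (h0 : ∀ t < s, AgreeAt 𝒜 t φ 0) (h0' : ∀ t < s, AgreeAt 𝒜 t φ' 0)
    (hs : AgreeAt 𝒜 s φ φ') (hm : IsHomFam 𝒜 1 m) (hm' : IsHomFam 𝒜 1 m')
    (hm0 : ∀ t < 2, AgreeAt 𝒜 t m 0) (hm0' : ∀ t < 2, AgreeAt 𝒜 t m' 0) (hm2 : AgreeAt 𝒜 2 m m')
    (hf0 : ∀ t < 1, AgreeAt 𝒜 t f 0) (hf0' : ∀ t < 1, AgreeAt 𝒜 t f' 0) (hf1 : AgreeAt 𝒜 1 f f') :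
    AgreeAt 𝒜 (s + 1) (twistedD μ del m f δ φ) (twistedD μ del m' f' δ φ') := by
  intro u l hl hu
  simp only [twistedD, Pi.sub_apply, Pi.smul_apply, Pi.add_apply]
  rw [act_agree hφ hφ' h0 h0' hs hm hm' hm0 hm0' hm2 u l hl hu, delFam_agree hs u l hl hu,
    convFam_agree h0 h0' hf0 hf0' hs hf1 u l hl hu,
    convFam_agree hf0 hf0' h0 h0' hf1 hs u l hl (by omega)]

theorem twistedD_low {s δ : ℤ} {φ m f : Family M} (hφ : IsZeroFam 𝒜 φ)
    (h0 : ∀ t < s, AgreeAt 𝒜 t φ 0) (hm : IsHomFam 𝒜 1 m)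
    (hm0 : ∀ t < 2, AgreeAt 𝒜 t m 0) (hf0 : ∀ t < 1, AgreeAt 𝒜 t f 0) (t : ℤ) (ht : t < s + 1) :
    AgreeAt 𝒜 t (twistedD μ del m f δ φ) 0 := by
  intro u l hl hu
  -- Below the leading weight, `φ` may be replaced by the zero family, regarded as starting in
  -- weight `t - 1`.
  have h := twistedD_agree (μ := μ) (del := del) (s := t - 1) (δ := δ) hφ
    (φ' := 0) (fun _ _ _ _ _ _ => rfl)
    (fun r hr => h0 r (by omega)) (fun r _ => AgreeAt.refl r 0) (h0 (t - 1) (by omega)) hm hm hm0 hm0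
    (AgreeAt.refl 2 m) hf0 hf0 (AgreeAt.refl 1 f) u l hl (by omega)
  rw [h]
  have e1 : act (0 : Family M) m u l = 0 :=
    Finset.sum_eq_zero fun x _ => splitSum_eq_zero fun a b _ => splitSum_eq_zero fun c e _ =>
      smul_zero _
  have e2 : delFam del δ (0 : Family M) u l = 0 := by cases u <;> simp [delFam, letterDel]
  have e3 : convFam μ 0 δ f 0 u l = 0 := by simp [convFam, conv, letterMul, splitSum_zero]
  have e4 : convFam μ δ 0 0 f u l = 0 := by simp [convFam, conv, letterMul, splitSum_zero]
  simp [twistedD, e1, e2, e3, e4]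

theorem convFam_low {s t δ δ' : ℤ} {φ ψ : Family M} (h0 : ∀ r < s, AgreeAt 𝒜 r φ 0)
    (h1 : ∀ r < t, AgreeAt 𝒜 r ψ 0) (w : ℤ) (hw : w < s + t) :
    AgreeAt 𝒜 w (convFam μ δ δ' φ ψ) 0 := by
  intro u l hl hu
  have h := convFam_agree (μ := μ) (δ := δ) (δ' := δ') (s := s) (t := w - s) h0 h0
    (fun r hr => h1 r (by omega)) (fun r _ => AgreeAt.refl r 0) (AgreeAt.refl s φ)
    (h1 (w - s) (by omega)) u l hl (by omega)
  rw [h]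
  simp [convFam, conv, letterMul, splitSum_zero]

/-- The curvature in weight `s` only depends on weights at most `s + 1`. -/
theorem curvature_agree {s : ℤ} {m f f' : Family M} (hm : IsHomFam 𝒜 1 m)
    (h : ∀ t ≤ s + 1, AgreeAt 𝒜 t f f') :
    AgreeAt 𝒜 s (curvature μ del m f) (curvature μ del m f') := by
  intro u l hl hu
  have e1 : act f m u l = act f' m u l := by
    refine Finset.sum_congr rfl fun x hx => splitSum_congr fun a b hab => splitSum_congr
      fun c e hce => ?_
    rw [HasAntidiagonal.mem_antidiagonal] at hx
    subst hce hab
    rw [isHomWord_append, isHomWord_append] at hl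
    simp only [List.length_append] at hu
    rw [h _ ?_ _ _ (isHomWord_append.2 ⟨hl.1, isHomWord_cons.2 ⟨hm x.2 c hl.2.1, hl.2.2⟩⟩) rfl]
    simp only [List.length_append, List.length_cons]
    omega
  have e2 : delFam del 0 f u l = delFam del 0 f' u l := by
    cases u with
    | zero => rfl
    | succ u => rw [delFam, delFam, h _ (by push_cast at hu; omega) u l hl rfl]
  have e3 : convFam μ 0 0 f f u l = convFam μ 0 0 f' f' u l := by
    refine Finset.sum_congr rfl fun x hx => conv_congr fun a b hab => ?_
    rw [HasAntidiagonal.mem_antidiagonal] at hx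
    subst hab
    rw [isHomWord_append] at hl
    simp only [List.length_append] at hu
    rw [h _ (by omega) x.1 a hl.1 rfl, h _ (by omega) x.2 b hl.2 rfl]
  simp [curvature, e1, e2, e3]

/-- The curvature of a sum. -/
theorem curvature_add (m f β : Family M) : curvature μ del m (f + β) =
    curvature μ del m f + twistedD μ del m f 0 β - convFam μ 0 0 β β := by
  simp only [curvature, twistedD, act_add, delFam_add, convFam_add_left, convFam_add_right,
    Int.negOnePow_zero, one_smul]
  abel

/-- The identity is a morphism exactly if the structures agree. -/
theorem curvature_idFam (m : Family M) (u : ℕ) (l : List (Letter M)) :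
    curvature μ del m idFam u l = m u l - delFam del 0 idFam u l -
      convFam μ 0 0 idFam idFam u l := by
  have e1 : act idFam m u l = m u l := by
    rw [act, Finset.sum_eq_single_of_mem (0, u) (by simp)]
    · rw [insSum, splitSum_eq_nil, splitSum_eq_single l.length le_rfl]
      · simp [idFam]
      · intro c e hce hc
        rw [idFam_of_length_ne, smul_zero]
        have := congrArg List.length hce
        simp at this ⊢
        rintro rfl
        simp at this
        omega
      · intro a b ha
        refine splitSum_eq_zero fun c e _ => ?_
        rw [idFam_of_length_ne, smul_zero]
        simp
        omega
    · rintro ⟨i, p⟩ hx hne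
      refine splitSum_eq_zero fun a b _ => splitSum_eq_zero fun c e _ => ?_
      rcases i with _ | i
      · simp at hx
        exact absurd (by rw [hx]) hne
      · rw [idFam_succ, smul_zero]
  simp [curvature, e1]

end Weights

/-! ### Homogeneity, units and the Hochschild complex through words -/

section Structures

variable {k : Type u} [CommRing k]
variable {M : Type v} [AddCommGroup M] [Module k M]
variable {𝒜 : ℕ × ℤ → Submodule k M}

theorem isHomFam_hat {f : ℕ → (n : ℕ) → Multi k M M n} {δ : ℤ}
    (h : ∀ p n : ℕ, IsHomog 𝒜 𝒜 (f p n) p (1 + δ - ((p : ℤ) + n))) : IsHomFam 𝒜 δ (hat f) := by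
  intro u l hl
  have := (isHomog_iff (f u) _ _ _).1 (h u l.length) l hl rfl
  refine mem_piece_congr (smul_mem_piece _ this) ?_ ?_
  · simp
  · simp
    omega

theorem isHomFam_hatCochain {c : (n : ℕ) → Multi k M M n} {s δ : ℤ}
    (h : ∀ n : ℕ, IsHomog 𝒜 𝒜 (c n) (s - n) (1 + δ - s)) : IsHomFam 𝒜 δ (hatCochain s δ c) := by
  intro u l hl
  rw [IsHomLetter, outLetter_val, hatCochain]
  split_ifs with hs
  · have := (isHomog_iff c _ _ _).1 (h l.length) l hl rfl
    refine mem_piece_congr (smul_mem_piece _ this) ?_ ?_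
    · simp
      omega
    · simp
      omega
  · exact Submodule.zero_mem _

theorem isHomog_of_hatCochain {c : (n : ℕ) → Multi k M M n} {s δ : ℤ}
    (h : IsHomFam 𝒜 δ (hatCochain s δ c)) (n : ℕ) (hn : (n : ℤ) ≤ s) :
    IsHomog 𝒜 𝒜 (c n) (s - n) (1 + δ - s) := by
  rw [isHomog_iff]
  rintro l hl rfl
  have h1 := h (s - l.length).toNat l hl
  have h2 : ((s - l.length).toNat : ℤ) = s - l.length := Int.toNat_of_nonneg (by omega)
  rw [IsHomLetter, outLetter_val, hatCochain, if_pos (by omega)] at h1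
  have h3 := smul_mem_piece (wordExp l + (s - l.length).toNat * (vdeg l + δ + 1)).negOnePow h1
  rw [smul_smul, Int.units_mul_self, one_smul] at h3
  refine mem_piece_congr h3 ?_ ?_
  · simp
    omega
  · simp
    omega

theorem eq_zero_of_hatCochain [DirectSum.Decomposition 𝒜] {c : (n : ℕ) → Multi k M M n} {s δ : ℤ}
    {n : ℕ} (hn : (n : ℤ) ≤ s)
    (h : ∀ (u : ℕ) l, IsHomWord 𝒜 l → l.length = n → (u : ℤ) + l.length = s →
      hatCochain s δ c u l = 0) : c n = 0 := by
  refine multilinear_eq_zero_of_word (𝒜 := 𝒜) c n fun l hl hln => ?_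
  subst hln
  have h2 : ((s - l.length).toNat : ℤ) = s - l.length := Int.toNat_of_nonneg (by omega)
  have h1 := h (s - l.length).toNat l hl rfl (by omega)
  rw [hatCochain, if_pos (by omega)] at h1
  exact (smul_eq_zero_iff_eq _).1 h1

/-- An element of arity zero would have horizontal degree `-s < 0`. -/
theorem arity_zero_eq_zero {c : (n : ℕ) → Multi k M M n} {s r : ℤ}
    (hc : c ∈ cochains 𝒜 s r) (hs : 1 ≤ s) : c 0 = 0 := by
  have h := (isHomog_iff c 0 _ _).1 (hc 0).1 [] (fun x hx => by simp at hx) rfl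
  rw [piece_of_neg (by simp; omega), Submodule.mem_bot] at h
  ext x
  exact (evalWord_eq c (n := 0) (l := []) rfl x fun a ha => absurd ha (by omega)).trans h

variable [DirectSum.Decomposition 𝒜]

theorem isHomBidga (A : DAInf 𝒜) : IsHomBidga 𝒜 (mulHom (A.m 0 2)) (delHom (A.m 1 1)) where
  mul {i j i' j' x y} hx hy := by
    have := (isHomog_iff (A.m 0) 2 _ _).1 (A.m_homog 0 2)
      [⟨i, j - 1, x⟩, ⟨i', j' - 1, y⟩] (isHomWord_cons.2 ⟨by simpa [IsHomLetter] using hx,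
        isHomWord_cons.2 ⟨by simpa [IsHomLetter] using hy, fun _ h => by simp at h⟩⟩) rfl
    rw [mulHom_apply, evalWord_eq (A.m 0) (n := 2) (l := [⟨i, j - 1, x⟩, ⟨i', j' - 1, y⟩]) rfl]
    · refine mem_piece_congr this ?_ ?_
      · simp
      · simp
        omega
    · intro a h h'
      rcases a with _ | _ | a
      · rfl
      · rfl
      · omega
  del {i j x} hx := by
    have := (isHomog_iff (A.m 1) 1 _ _).1 (A.m_homog 1 1)
      [⟨i, j - 1, x⟩] (isHomWord_cons.2 ⟨by simpa [IsHomLetter] using hx,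
        fun _ h => by simp at h⟩) rfl
    rw [delHom_apply, evalWord_eq (A.m 1) (n := 1) (l := [⟨i, j - 1, x⟩]) rfl]
    · refine mem_piece_congr this ?_ ?_ <;> simp
    · intro a h h'
      obtain rfl : a = 0 := by omega
      rfl

theorem isHomFam_hat_m (A : DAInf 𝒜) : IsHomFam 𝒜 1 (hat A.m) :=
  isHomFam_hat fun p n => A.m_homog p n

theorem hat_m_low (A : DAInf 𝒜) (hA01 : A.m 0 1 = 0) (t : ℤ) (ht : t < 2) :
    AgreeAt 𝒜 t (hat A.m) 0 := by
  intro u l hl hu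
  refine hat_eq_zero ?_
  generalize l.length = n at hu
  rcases n with _ | n
  · exact A.m_zero u
  · obtain ⟨rfl, rfl⟩ : n = 0 ∧ u = 0 := by omega
    exact hA01

theorem isStrictUnit_hat (A : DAInf 𝒜) : IsStrictUnit (hat A.m) A.unit where
  nil p := hat_eq_zero (A.m_zero p)
  single p := by
    rcases p with _ | _ | p
    · have : evalWord (A.m 0) [unitLetter A.unit] = A.m 0 1 ![A.unit] :=
        (evalWord_eq (A.m 0) (n := 1) (l := [unitLetter A.unit]) rfl _ fun a h h' => by
          obtain rfl : a = 0 := by omega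
          rfl).symm
      rw [hat, this, A.m01_unit, smul_zero]
    -- That `m_11` kills the unit is not among the axioms; it holds because the value would have
    -- horizontal degree `-1`.
    · have := isHomFam_hat_m A 1 [unitLetter A.unit]
        (isHomWord_cons.2 ⟨isHomLetter_unitLetter A.unit_mem, fun _ h => by simp at h⟩)
      rw [IsHomLetter, piece_of_neg (by simp [unitLetter]), Submodule.mem_bot] at this
      exact this
    · rw [hat, ← List.nil_append [unitLetter A.unit], evalWord_unit_eq_zero, smul_zero]
      exact fun x p _ hx => A.m_unit _ _ (by simp) x p hx
  left y := by
    rw [hat_pair, letterMul_unit_left]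
    exact A.unit_mul
  right x := by
    rw [hat_pair, letterMul_unit_right]
    exact A.mul_unit
  high p a b h := by
    rw [hat, evalWord_unit_eq_zero, smul_zero]
    exact fun x l _ hx => A.m_unit _ _ (by simp; omega) x l hx

omit [DirectSum.Decomposition 𝒜] in
theorem idFam_low (t : ℤ) (ht : t < 1) : AgreeAt 𝒜 t idFam 0 := by
  intro u l _ hu
  exact idFam_of_length_ne u (by omega)

omit [DirectSum.Decomposition 𝒜] in
theorem hatCochain_low {s δ : ℤ} (c : (n : ℕ) → Multi k M M n) (t : ℤ) (ht : t < s) :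
    AgreeAt 𝒜 t (hatCochain s δ c) 0 := by
  intro u l _ hu
  exact hatCochain_of_ne c (by omega)

variable {A : DAInf 𝒜} (hA : A.IsBidga) (hA01 : A.m 0 1 = 0)
include hA hA01

theorem IsHomFam.leibnizAt {δ : ℤ} {φ : Family M} (h : IsHomFam 𝒜 δ φ) {l : List (Letter M)}
    (hl : IsHomWord 𝒜 l) : LeibnizAt (mulHom (A.m 0 2)) (delHom (A.m 1 1)) φ l := by
  intro u a b hab y
  subst hab
  exact hA.leibniz hA01 (h u a (isHomWord_append.1 hl).1) y

/-- For the identity, `id*id` is the product and `∂ id` is the horizontal differential, which are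
the only operations of the bidga. Its curvature therefore measures the difference of the two
structures. -/
theorem curvature_idFam_eq (m : Family M) (u : ℕ) (l : List (Letter M)) :
    curvature (mulHom (A.m 0 2)) (delHom (A.m 1 1)) m idFam u l = m u l - hat A.m u l := by
  rw [curvature_idFam, sub_sub]
  congr 1
  by_cases h : u + l.length = 2
  · rcases u with _ | _ | u
    · obtain ⟨x, y, rfl⟩ := List.length_eq_two.1 (by simpa using h)
      rw [hat_pair, convFam_idFam_left, delFam, zero_add]
      simp [idFam, outLetter]
    · obtain ⟨x, rfl⟩ := List.length_eq_one_iff.1 (by omega : l.length = 1)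
      rw [hat_single, convFam_idFam_left, delFam, idFam_succ]
      simp [letterMul, letterDel, idFam]
    · obtain rfl : l = [] := List.length_eq_zero_iff.1 (by omega)
      rw [hat_eq_zero (A.m_zero _), convFam_idFam_left_nil, delFam, idFam_succ]
      simp [letterDel]
  · rw [hat_eq_zero (hA.eq_zero hA01 h)]
    have h1 : convFam (mulHom (A.m 0 2)) 0 0 idFam idFam u l = 0 := by
      rcases l with _ | ⟨x, l⟩
      · exact convFam_idFam_left_nil _ _ _ _
      · rw [convFam_idFam_left]
        by_cases hu : u = 0 
        · rw [idFam_of_length_ne _ fun hl => h (by simp [hl, hu])]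
          simp [letterMul]
        · obtain ⟨u, rfl⟩ := Nat.exists_eq_succ_of_ne_zero hu
          rw [idFam_succ]
          simp [letterMul]
    have h2 : delFam (delHom (A.m 1 1)) 0 idFam u l = 0 := by
      rcases u with _ | u
      · rfl
      · rw [delFam]
        by_cases hu : u = 0
        · subst hu
          rw [idFam_of_length_ne _ fun hl => h (by simp [hl])]
          simp [letterDel]
        · obtain ⟨u, rfl⟩ := Nat.exists_eq_succ_of_ne_zero hu
          rw [idFam_succ]
          simp [letterDel]
    rw [h1, h2, add_zero]

theorem curvature_idFam_hat :
    curvature (mulHom (A.m 0 2)) (delHom (A.m 1 1)) (hat A.m) idFam = 0 := by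
  funext u l
  rw [curvature_idFam_eq hA hA01, sub_self]
  rfl

omit hA hA01 in
theorem hochD_zero_apply {c : (n : ℕ) → Multi k M M n} (s r : ℤ) (h : c 0 = 0) :
    hochD 𝒜 (A.m 0 2) (A.m 1 1) s r c 0 = 0 := by
  change bracket 𝒜 _ (A.m 1 1) 0 1 _ _ (c 0) = 0
  rw [h, map_zero]

omit hA hA01 in
theorem hochD_eq_zero {c : (n : ℕ) → Multi k M M n} (s r : ℤ) {n : ℕ} (h : c n = 0)
    (h' : c (n + 1) = 0) : hochD 𝒜 (A.m 0 2) (A.m 1 1) s r c (n + 1) = 0 := by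
  change (s - n).negOnePow • bracket 𝒜 _ (A.m 0 2) 0 0 _ _ (c n) + bracket 𝒜 _ (A.m 1 1) 0 1 _ _ (c (n + 1)) = 0
  rw [h, h', map_zero, map_zero, smul_zero, add_zero]

omit hA hA01 [DirectSum.Decomposition 𝒜] in
theorem hatCochain_nil {c : (n : ℕ) → Multi k M M n} (s δ : ℤ) (h : c 0 = 0) (u : ℕ) :
    hatCochain s δ c u [] = 0 := by
  have : evalWord c ([] : List (Letter M)) = 0 := by
    change c 0 _ = 0
    rw [h]
    rfl
  rw [hatCochain, this]
  simp

omit hA hA01 [DirectSum.Decomposition 𝒜] [CommRing k] [Module k M] in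
theorem twistedD_smul (μ : M →+ M →+ M) (del : M →+ M) (m f : Family M) (δ : ℤ) (e : ℤˣ)
    (φ : Family M) : twistedD μ del m f δ (e • φ) = e • twistedD μ del m f δ φ := by
  simp only [twistedD, act_smul, delFam_smul, convFam_smul_left, convFam_smul_right, ← smul_add,
    smul_sub, smul_comm e]

/-- The differential of a family given by a cochain is given by the Hochschild differential. -/
theorem twistedD_hatCochain_eq {c : (n : ℕ) → Multi k M M n} {s : ℤ} (δ : ℤ)
    (hc : c ∈ cochains 𝒜 s (1 + δ - s)) (h0 : c 0 = 0) (u : ℕ) {l : List (Letter M)}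
    (hl : IsHomWord 𝒜 l) :
    twistedD (mulHom (A.m 0 2)) (delHom (A.m 1 1)) (hat A.m) idFam δ (hatCochain s δ c) u l =
      (δ + 1).negOnePow • hatCochain (s + 1) (δ + 1)
        (hochD 𝒜 (A.m 0 2) (A.m 1 1) s (1 + δ - s) c) u l := by
  by_cases hs : (u : ℤ) + l.length = s + 1
  · rcases l with _ | ⟨x, l⟩
    · have h1 := fun d => hatCochain_nil s δ h0 d
      have h2 := hatCochain_nil (s + 1) (δ + 1)
        (hochD_zero_apply (A := A) s (1 + δ - s) h0) u
      have h3 : delFam (delHom (A.m 1 1)) δ (hatCochain s δ c) u [] = 0 := by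
        cases u with
        | zero => rfl
        | succ u => simp [delFam, h1, letterDel]
      rw [h2, twistedD]
      simp only [Pi.sub_apply, Pi.smul_apply, Pi.add_apply]
      rw [act_nil (fun p => hat_eq_zero (A.m_zero p)) (isMultiAdd_hatCochain s δ c),
        convFam_idFam_left_nil, convFam_idFam_right_nil, h3]
      simp
    · exact twistedD_hatCochain hA hA01 s δ c (fun n => (hc n).2) u l.length hl rfl
        (by simp at hs; omega)
  · rw [twistedD_hatCochain_of_ne hA hA01 s δ c u hs, hatCochain_of_ne _ hs, smul_zero]

/-- The Hochschild differential of a cochain is a cochain. -/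
theorem hochD_mem {c : (n : ℕ) → Multi k M M n} {s δ : ℤ}
    (hc : c ∈ cochains 𝒜 s (1 + δ - s)) (h0 : c 0 = 0) :
    hochD 𝒜 (A.m 0 2) (A.m 1 1) s (1 + δ - s) c ∈ cochains 𝒜 (s + 1) (1 + δ - s) := by
  have h1 : IsHomFam 𝒜 (δ + 1) (hatCochain (s + 1) (δ + 1)
      (hochD 𝒜 (A.m 0 2) (A.m 1 1) s (1 + δ - s) c)) := by
    intro u l hl
    have h2 := ((isHomFam_hatCochain (δ := δ) fun n => (hc n).1).twistedD (isHomBidga A)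
      isHomFam_idFam (isHomFam_hat_m A)).smul (δ + 1).negOnePow u l hl
    rw [IsHomLetter, outLetter_val, Pi.smul_apply, Pi.smul_apply,
      twistedD_hatCochain_eq hA hA01 δ hc h0 u hl, smul_smul, Int.units_mul_self, one_smul] at h2
    exact h2
  have h3 : ∀ n : ℕ, s + 1 < n → hochD 𝒜 (A.m 0 2) (A.m 1 1) s (1 + δ - s) c n = 0 := by
    intro n hn
    rcases n with _ | n
    · exact hochD_zero_apply _ _ h0
    · exact hochD_eq_zero _ _ ((hc n).2 (by push_cast at hn; omega))
        ((hc (n + 1)).2 (by push_cast at hn ⊢; omega))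
  intro n
  refine ⟨?_, h3 n⟩
  rcases le_or_gt (n : ℤ) (s + 1) with hn | hn
  · have := isHomog_of_hatCochain h1 n hn
    rwa [show 1 + (δ + 1) - (s + 1) = 1 + δ - s by ring] at this
  · rw [h3 n hn]
    exact fun _ _ _ => Submodule.zero_mem _

/-- The Hochschild differential squares to zero. -/
theorem hochD_hochD {c : (n : ℕ) → Multi k M M n} {s δ : ℤ}
    (hc : c ∈ cochains 𝒜 s (1 + δ - s)) (h0 : c 0 = 0) :
    hochD 𝒜 (A.m 0 2) (A.m 1 1) (s + 1) (1 + δ - s)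
      (hochD 𝒜 (A.m 0 2) (A.m 1 1) s (1 + δ - s) c) = 0 := by
  have hmem := hochD_mem hA hA01 hc h0
  have hz := hochD_zero_apply (A := A) s (1 + δ - s) h0
  have e1 : 1 + δ - s = 1 + (δ + 1) - (s + 1) := by ring
  have hmem2 := hochD_mem hA hA01 (δ := δ + 1) (s := s + 1) (e1 ▸ hmem) hz
  rw [← e1] at hmem2
  funext n
  rcases le_or_gt (n : ℤ) (s + 1 + 1) with hn | hn
  · refine eq_zero_of_hatCochain (𝒜 := 𝒜) (δ := δ + 1 + 1) hn fun u l hl _ hu => ?_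
    have h1 := twistedD_hatCochain_eq hA hA01 (s := s + 1) (δ + 1) (e1 ▸ hmem) hz u hl
    rw [← e1] at h1
    -- The curvature of the identity of `A` is zero, so the right-hand side vanishes.
    have h2 := twistedD_twistedD (mulHom (A.m 0 2)) (delHom (A.m 1 1)) (hA.mul_assoc hA01)
      (hA.del_del hA01) (m := hat A.m) (f := idFam) δ (φ := hatCochain s δ c)
      (isMultiAdd_hatCochain s δ c) u l
      (fun a d e h u => act_hat_hat A u fun y hy => hl y (by rw [← h]; simp [hy]))
      (IsHomFam.leibnizAt hA hA01 (isHomFam_idFam (𝒜 := 𝒜)) hl)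
      (IsHomFam.leibnizAt hA hA01 (isHomFam_hatCochain fun n => (hc n).1) hl)
    rw [curvature_idFam_hat hA hA01] at h2
    simp only [convFam, conv, letterMul, Pi.zero_apply, outLetter_val, map_zero, smul_zero,
      splitSum_zero, Finset.sum_const_zero, neg_zero, sub_zero, AddMonoidHom.zero_apply] at h2
    have hψ : ∀ u l, IsHomWord 𝒜 l → twistedD (mulHom (A.m 0 2)) (delHom (A.m 1 1)) (hat A.m) idFam δ
        (hatCochain s δ c) u l = ((δ + 1).negOnePow • hatCochain (s + 1) (δ + 1)
          (hochD 𝒜 (A.m 0 2) (A.m 1 1) s (1 + δ - s) c)) u l :=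
      fun u l hl => twistedD_hatCochain_eq hA hA01 δ hc h0 u hl
    have hadd : ∀ i, IsMultiAdd (((δ + 1).negOnePow • hatCochain (s + 1) (δ + 1)
          (hochD 𝒜 (A.m 0 2) (A.m 1 1) s (1 + δ - s) c)) i) := fun i =>
      (isMultiAdd_hatCochain (s + 1) (δ + 1)
        (hochD 𝒜 (A.m 0 2) (A.m 1 1) s (1 + δ - s) c) i).smul (fun _ => (δ + 1).negOnePow)
        fun _ _ _ _ _ _ => rfl
    have hlow : ∀ t < s + 1, AgreeAt 𝒜 t ((δ + 1).negOnePow • hatCochain (s + 1) (δ + 1)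
          (hochD 𝒜 (A.m 0 2) (A.m 1 1) s (1 + δ - s) c)) 0 := fun t ht u l hl hu => by
      rw [Pi.smul_apply, Pi.smul_apply, hatCochain_low _ t ht u l hl hu]
      exact smul_zero _
    -- The inner differential equals the Hochschild differential only on homogeneous words, so it is
    -- replaced through agreement of leading terms rather than by rewriting families.
    have h3 := twistedD_agree (𝒜 := 𝒜) (μ := mulHom (A.m 0 2)) (del := delHom (A.m 1 1)) (s := s + 1)
      (δ := δ + 1) (m := hat A.m) (m' := hat A.m) (f := idFam) (f' := idFam)
      (φ := twistedD (mulHom (A.m 0 2)) (delHom (A.m 1 1)) (hat A.m) idFam δ (hatCochain s δ c))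
      (φ' := (δ + 1).negOnePow • hatCochain (s + 1) (δ + 1)
          (hochD 𝒜 (A.m 0 2) (A.m 1 1) s (1 + δ - s) c))
      (fun u a i j e h => by rw [hψ _ _ h]; exact (hadd u).map_zero a i j e)
      (isZeroFam_of_isMultiAdd hadd)
      (fun t ht u l hl hu => by rw [hψ _ _ hl]; exact hlow t ht u l hl hu) hlow
      (fun u l hl _ => hψ u l hl) (isHomFam_hat_m A) (isHomFam_hat_m A) (hat_m_low A hA01)
      (hat_m_low A hA01) (AgreeAt.refl 2 _) idFam_low idFam_low (AgreeAt.refl 1 _) u l hl hu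
    rw [h2, twistedD_smul] at h3
    rw [Pi.smul_apply, Pi.smul_apply, h1, eq_comm, smul_smul] at h3
    exact (smul_eq_zero_iff_eq _).1 h3
  · exact (hmem2 n).2 hn

end Structures

/-! ### Normalization of Hochschild cochains -/

section Normalization

variable {k : Type u} [CommRing k]
variable {M : Type v} [AddCommGroup M] [Module k M]
variable {𝒜 : ℕ × ℤ → Submodule k M}

/-- The maps vanish if one of the first `q` arguments is `e`. -/
def VanishBelow (e : M) (q : ℕ) (c : (n : ℕ) → Multi k M M n) : Prop :=
  ∀ (n : ℕ) (x : Fin n → M) (p : Fin n), (p : ℕ) < q → x p = e → c n x = 0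

theorem VanishBelow.evalWord {e : M} {q : ℕ} {c : (n : ℕ) → Multi k M M n}
    (h : VanishBelow e q c) (a b : List (Letter M)) (ha : a.length < q) :
    evalWord c (a ++ unitLetter e :: b) = 0 :=
  evalWord_unit_eq_zero c a b fun x p hp hx => h _ x p (by rw [hp]; exact ha) hx

theorem VanishBelow.hatCochain {e : M} {q : ℕ} {c : (n : ℕ) → Multi k M M n}
    (h : VanishBelow e q c) (s δ : ℤ) (u : ℕ) (a b : List (Letter M)) (ha : a.length < q) :
    hatCochain s δ c u (a ++ unitLetter e :: b) = 0 := by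
  rw [DerivedAInf.hatCochain, h.evalWord a b ha, smul_zero, ite_self]

/-- Insertion of `e` at position `q`, with a sign. -/
noncomputable def insertUnit (e : M) (q : ℕ) (c : (n : ℕ) → Multi k M M n) (n : ℕ) :
    Multi k M M n :=
  if h : q < n then
    ((n : ℤ) - 1 - q).negOnePow • (c (n + 1)).curryMid ⟨q, by omega⟩ e
  else 0

theorem insertUnit_of_lt (e : M) {q n : ℕ} (c : (n : ℕ) → Multi k M M n) (h : q < n)
    (x : Fin n → M) : insertUnit e q c n x = ((n : ℤ) - 1 - q).negOnePow •
      c (n + 1) (Fin.insertNth (⟨q, by omega⟩ : Fin (n + 1)) e x) := by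
  rw [insertUnit, dif_pos h]
  rfl

theorem insertUnit_zero (e : M) (q : ℕ) (c : (n : ℕ) → Multi k M M n) : insertUnit e q c 0 = 0 :=
  dif_neg (by omega)

/-- Insertion at position `q` does not move the earlier arguments, so vanishing there is inherited.
-/
theorem vanishBelow_insertUnit {e : M} {q : ℕ} {c : (n : ℕ) → Multi k M M n}
    (h : VanishBelow e q c) : VanishBelow e q (insertUnit e q c) := by
  intro n x p hp hx
  by_cases hn : q < n
  · rw [insertUnit_of_lt e c hn, h (n + 1) _
      ((⟨q, by omega⟩ : Fin (n + 1)).succAbove p) ?_ ?_, smul_zero]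
    · rw [Fin.succAbove_of_castSucc_lt _ _ (by simpa [Fin.lt_def] using hp)]
      exact hp
    · rw [Fin.insertNth_apply_succAbove, hx]
  · rw [insertUnit, dif_neg hn]
    rfl

theorem evalWord_insertUnit (e : M) (c : (n : ℕ) → Multi k M M n) (a b : List (Letter M))
    (hb : b ≠ []) : evalWord (insertUnit e a.length c) (a ++ b) =
      ((b.length : ℤ) - 1).negOnePow • evalWord c (a ++ unitLetter e :: b) := by
  have hb' := List.length_pos_iff.2 hb
  rw [evalWord, insertUnit_of_lt e c (by simp; omega)]
  congr 1
  · congr 1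
    simp
    ring
  · refine evalWord_eq c (by simp; omega) _ fun t h h' => ?_
    rcases lt_trichotomy t a.length with ht | ht | ht
    · have h1 : (⟨t, h⟩ : Fin ((a ++ b).length + 1)) =
          (⟨a.length, by simp⟩ : Fin ((a ++ b).length + 1)).succAbove
            ⟨t, by simp; omega⟩ := by
        rw [Fin.succAbove_of_castSucc_lt _ _ (by simpa [Fin.lt_def] using ht)]
        rfl
      rw [h1, Fin.insertNth_apply_succAbove]
      simp [List.getElem_append_left ht]
    · subst ht
      rw [Fin.insertNth_apply_same]
      simp [unitLetter]
    · obtain ⟨t, rfl⟩ : ∃ t', t = t' + 1 := ⟨t - 1, by omega⟩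
      have h1 : (⟨t + 1, h⟩ : Fin ((a ++ b).length + 1)) =
          (⟨a.length, by simp⟩ : Fin ((a ++ b).length + 1)).succAbove
            ⟨t, by omega⟩ := by
        rw [Fin.succAbove_of_le_castSucc _ _ (by rw [Fin.le_def]; exact Nat.le_of_lt_succ ht)]
        rfl
      rw [h1, Fin.insertNth_apply_succAbove]
      simp only [List.get_eq_getElem]
      rw [List.getElem_append_right (by omega), List.getElem_append_right (by omega)]
      simp only [List.getElem_cons]
      rw [dif_neg (by omega)]
      congr 2
      omega

/-- The unit has bidegree `(0, 0)`, while arity and cohomological degree both drop by one; the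
horizontal degree `s - n` is unchanged. -/
theorem insertUnit_mem {e : M} (he : e ∈ 𝒜 (0, 0)) (q : ℕ) {c : (n : ℕ) → Multi k M M n} {s r : ℤ}
    (hc : c ∈ cochains 𝒜 (s + 1) r) : insertUnit e q c ∈ cochains 𝒜 s r := by
  intro n
  constructor
  · intro d x hx
    by_cases hn : q < n
    · rw [insertUnit_of_lt e c hn]
      refine smul_mem_piece _ ?_
      have := (hc (n + 1)).1 (Fin.insertNth (⟨q, by omega⟩ : Fin (n + 1)) ((0, 0) : ℕ × ℤ) d)
        (Fin.insertNth (⟨q, by omega⟩ : Fin (n + 1)) e x) fun l => by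
          rcases Fin.eq_self_or_eq_succAbove (⟨q, by omega⟩ : Fin (n + 1)) l with rfl | ⟨l, rfl⟩
          · simpa using he
          · simpa using hx l
      rw [Fin.sum_univ_succAbove _ (⟨q, by omega⟩ : Fin (n + 1)),
        Fin.sum_univ_succAbove _ (⟨q, by omega⟩ : Fin (n + 1))] at this
      simp only [Fin.insertNth_apply_same, Fin.insertNth_apply_succAbove] at this
      refine mem_piece_congr this ?_ ?_
      · push_cast
        ring
      · ring
    · rw [insertUnit, dif_neg hn]
      exact Submodule.zero_mem _
  · intro hn
    rw [insertUnit, (hc (n + 1)).2 (by push_cast; omega)]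
    split_ifs
    · ext x
      simp
    · rfl

/-- The sign in `insertUnit` is chosen so that exactly `sgn a` remains, as `add_twistedD_unit`
demands of its contracting cochain. -/
theorem hatCochain_insertUnit (e : M) (c : (n : ℕ) → Multi k M M n) (s : ℤ) (u : ℕ)
    (a b : List (Letter M)) :
    hatCochain s (-1) (insertUnit e a.length c) u (a ++ unitLetter e :: b) =
      sgn a • hatCochain (s + 1) 0 c u (a ++ unitLetter e :: unitLetter e :: b) := by
  rw [hatCochain, hatCochain]
  by_cases h : (u : ℤ) + (a ++ unitLetter e :: b).length = s
  · rw [if_pos h, if_pos (by simp at h ⊢; omega), evalWord_insertUnit e c a _ (by simp)]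
    simp only [smul_smul]
    congr 1
    simp only [sgn, ← Int.negOnePow_add, Int.negOnePow_eq_iff, vdeg_append, hdeg_append, vdeg_cons,
      hdeg_cons, wordExp_append, wordExp_cons, List.length_cons, unitLetter]
    push_cast
    grind
  · rw [if_neg h, if_neg (by simp at h ⊢; omega), smul_zero]

theorem hatCochain_add (s δ : ℤ) (c c' : (n : ℕ) → Multi k M M n) (u : ℕ) (l : List (Letter M)) :
    hatCochain s δ (c + c') u l = hatCochain s δ c u l + hatCochain s δ c' u l := by
  simp only [hatCochain]
  split_ifs
  · rw [← smul_add]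
    rfl
  · rw [add_zero]

variable [DirectSum.Decomposition 𝒜]
variable {A : DAInf 𝒜} (hA : A.IsBidga) (hA01 : A.m 0 1 = 0)
include hA hA01

/-- One more argument of a cochain with normalized differential can be normalized. -/
theorem exists_vanishBelow_succ {t : ℤ} (ht : 1 ≤ t) (q : ℕ) {b : (n : ℕ) → Multi k M M n}
    (hb : b ∈ cochains 𝒜 (t + 1) (-t)) (hq : VanishBelow A.unit q b)
    (hD : ∀ p, VanishBelow A.unit p (hochD 𝒜 (A.m 0 2) (A.m 1 1) (t + 1) (-t) b)) :
    ∃ b' ∈ cochains 𝒜 (t + 1) (-t), hochD 𝒜 (A.m 0 2) (A.m 1 1) (t + 1) (-t) b' =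
      hochD 𝒜 (A.m 0 2) (A.m 1 1) (t + 1) (-t) b ∧ VanishBelow A.unit (q + 1) b' := by
  -- The correction is the coboundary of `c`, the cochain `b` with the unit inserted at position
  -- `q`.
  have hc := insertUnit_mem A.unit_mem q hb
  have hc0 := insertUnit_zero A.unit q b
  have hcq := vanishBelow_insertUnit hq
  generalize hcdef : insertUnit A.unit q b = c at hc hc0 hcq
  have e1 : (1 : ℤ) + -1 - t = -t := by ring
  have e2 : (1 : ℤ) + 0 - (t + 1) = -t := by ring
  have hDc := hochD_mem hA hA01 (e1.symm ▸ hc) hc0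
  have hDD := hochD_hochD hA hA01 (e1.symm ▸ hc) hc0
  have hψ := fun u (l : List (Letter M)) hl =>
    twistedD_hatCochain_eq (l := l) hA hA01 (-1) (e1.symm ▸ hc) hc0 u hl
  have hφ := fun u (l : List (Letter M)) hl =>
    twistedD_hatCochain_eq (l := l) hA hA01 0 (e2.symm ▸ hb) (arity_zero_eq_zero hb (by omega)) u hl
  rw [e1] at hDc hDD
  simp only [e1] at hψ
  simp only [e2] at hφ
  have hb' := Submodule.add_mem _ hb hDc
  refine ⟨_, hb', by rw [map_add, hDD, add_zero], ?_⟩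
  intro n x p hp hx
  rcases lt_or_ge (t + 1) n with hn | hn
  · rw [(hb' n).2 hn]
    rfl
  refine multilinear_unit_eq_zero _ A.unit_mem p (fun a d hl ha hlen => ?_) x hx
  -- With `k = a.length ≤ q`, this treats the new position `q` and the earlier ones at once. The
  -- horizontal degree `t + 1 - n` is the one in which the arity-`n` component lives.
  have h1 := add_twistedD_unit (mulHom (A.m 0 2)) (delHom (A.m 1 1)) (isStrictUnit_hat A)
    A.unit_mul A.mul_unit (isMultiAdd_hatCochain (t + 1) 0 b) (isMultiAdd_hatCochain t (-1) c)
    a.length (t + 1 - n).toNat a d rfl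
    (fun i a' d' ha' => hq.hatCochain _ _ _ _ _ (by omega))
    (fun i a' d' ha' => ?_) ?_
  · rw [hψ _ _ hl, neg_add_cancel, Int.negOnePow_zero, one_smul, ← hatCochain_add, hatCochain,
      if_pos (by rw [hlen]; omega)] at h1
    exact (smul_eq_zero_iff_eq _).1 h1
  · rcases lt_or_ge a'.length q with h | h
    · rw [hcq.hatCochain _ _ _ _ _ h, hq.hatCochain _ _ _ _ _ h, smul_zero]
    · obtain rfl : a'.length = q := by omega
      rw [← hcdef, hatCochain_insertUnit]
  · have hu := isHomLetter_unitLetter A.unit_mem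
    rw [isHomWord_append, isHomWord_cons] at hl
    rw [hφ _ _ (isHomWord_append.2 ⟨hl.1, isHomWord_cons.2 ⟨hu, isHomWord_cons.2 hl.2⟩⟩),
      (hD (a.length + 1)).hatCochain _ _ _ _ _ (by omega), smul_zero]

/-- A cochain with normalized differential is homologous to a normalized one. -/
theorem exists_normalized {t : ℤ} (ht : 1 ≤ t) {b : (n : ℕ) → Multi k M M n}
    (hb : b ∈ cochains 𝒜 (t + 1) (-t))
    (hD : ∀ p, VanishBelow A.unit p (hochD 𝒜 (A.m 0 2) (A.m 1 1) (t + 1) (-t) b)) :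
    ∃ b' ∈ cochains 𝒜 (t + 1) (-t), hochD 𝒜 (A.m 0 2) (A.m 1 1) (t + 1) (-t) b' =
      hochD 𝒜 (A.m 0 2) (A.m 1 1) (t + 1) (-t) b ∧ ∀ q, VanishBelow A.unit q b' := by
  have h : ∀ q, ∃ b' ∈ cochains 𝒜 (t + 1) (-t), hochD 𝒜 (A.m 0 2) (A.m 1 1) (t + 1) (-t) b' =
      hochD 𝒜 (A.m 0 2) (A.m 1 1) (t + 1) (-t) b ∧ VanishBelow A.unit q b' := by
    intro q
    induction q with
    | zero => exact ⟨b, hb, rfl, fun n x p hp _ => absurd hp (by omega)⟩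
    | succ q ih =>
      obtain ⟨b', hb', h1, h2⟩ := ih
      obtain ⟨b'', hb'', h3, h4⟩ := exists_vanishBelow_succ hA hA01 ht q hb' h2
        (by rw [h1]; exact hD)
      exact ⟨b'', hb'', h3.trans h1, h4⟩
  -- The components have arity at most `t + 1`, so finitely many positions suffice.
  obtain ⟨b', hb', h1, h2⟩ := h (t + 2).toNat
  refine ⟨b', hb', h1, fun q n x p _ hx => ?_⟩
  rcases lt_or_ge (t + 1) n with hn | hn
  · rw [(hb' n).2 hn]
    rfl
  · exact h2 n x p (by omega) hx

end Normalization

/-! ### Vanishing of the curvature on words with a unit -/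

section CurvatureUnit

variable {M : Type*} [AddCommGroup M] {μ : M →+ M →+ M} {del : M →+ M}

/-- The curvature of a normalized family is normalized. -/
theorem curvature_unit {m f : Family M} {e : M} (he : IsStrictUnit m e)
    (hl : ∀ x, μ e x = x) (hr : ∀ x, μ x e = x) (hf : ∀ i, IsMultiAdd (f i))
    (hnil : ∀ u, f u [] = 0) (hg : ∀ u a b, f u (a ++ unitLetter e :: b) =
      idFam u (a ++ unitLetter e :: b)) (u : ℕ) (a b : List (Letter M))
    (hw : 2 ≤ u + a.length + b.length) : curvature μ del m f u (a ++ unitLetter e :: b) = 0 := by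
  have hz : ∀ u a b, 1 ≤ u + (a.length + b.length) → f u (a ++ unitLetter e :: b) = 0 := by
    intro u a b h
    rw [hg]
    rcases u with _ | u
    · exact idFam_of_length_ne _ (by simp; omega)
    · exact idFam_succ _ _
  have h1 : act (fun i l => f i (l ++ unitLetter e :: b)) m u a = 0 :=
    Finset.sum_eq_zero fun x _ => splitSum_eq_zero fun c d _ => splitSum_eq_zero fun d d' _ => by
      dsimp only
      rw [hz _ _ _ (by simp; omega), smul_zero]
  have h2 : act (fun i l => f i (a ++ unitLetter e :: l)) m u b = 0 :=
    Finset.sum_eq_zero fun x _ => splitSum_eq_zero fun c d _ => splitSum_eq_zero fun d d' _ => by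
      dsimp only
      rw [hz _ _ _ (by simp; omega), smul_zero]
  have h3 : delFam del 0 f u (a ++ unitLetter e :: b) = 0 := by
    rcases u with _ | u
    · rfl
    · rw [delFam, hz _ _ _ (by omega)]
      simp [letterDel]
  have h4 : convFam μ 0 0 f f u (a ++ unitLetter e :: b) =
      convFam μ 0 0 idFam f u (a ++ unitLetter e :: b) +
        convFam μ 0 0 (f - idFam) idFam u (a ++ unitLetter e :: b) := by
    -- `f - id` vanishes on every word with a unit, and the unit lies in one of the two factors.
    -- This leaves only convolutions with the identity.
    have h5 : convFam μ 0 0 (f - idFam) (f - idFam) u (a ++ unitLetter e :: b) = 0 := by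
      refine Finset.sum_eq_zero fun x _ => ?_
      rw [conv, splitSum_append_cons]
      simp only [Pi.sub_apply, hg, sub_self, letterMul, outLetter_val, map_zero,
        AddMonoidHom.zero_apply, smul_zero, splitSum_zero, add_zero]
    have h6 : f = idFam + (f - idFam) := by abel
    conv_lhs => rw [h6]
    rw [convFam_add_left, convFam_add_right (φ := f - idFam), ← h6]
    simp only [Pi.add_apply, h5, add_zero]
  have h5 : convFam μ 0 0 idFam f u (a ++ unitLetter e :: b) = if a = [] then f u b else 0 := by
    rcases a with _ | ⟨x, a⟩
    · rw [List.nil_append, convFam_idFam_left, letterMul_unit_left μ hl]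
      simp
    · rw [List.cons_append, convFam_idFam_left, hz _ _ _ (by simp at hw; omega)]
      simp [letterMul]
  have h6 : convFam μ 0 0 (f - idFam) idFam u (a ++ unitLetter e :: b) =
      if b = [] then - sgn a • f u a else 0 := by
    rcases List.eq_nil_or_concat b with rfl | ⟨b, y, rfl⟩
    · rw [convFam_idFam_right, letterMul_unit_right μ hr, if_pos rfl, outLetter_sign, outLetter_val,
        Pi.sub_apply, Pi.sub_apply]
      have : idFam u a = (0 : M) := by
        rcases u with _ | u
        · exact idFam_of_length_ne _ (by simp at hw; omega)
        · exact idFam_succ _ _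
      rw [this]
      simp
    · rw [List.concat_eq_append, ← List.cons_append, ← List.append_assoc, convFam_idFam_right,
        Pi.sub_apply, Pi.sub_apply, hg]
      simp [letterMul]
  rw [curvature, Pi.sub_apply, Pi.sub_apply, Pi.sub_apply, Pi.sub_apply, act_unit he hf, h1, h2, h3,
    h4, h5, h6]
  -- The boundary terms of `act_unit` at an empty end cancel against multiplication by the unit in
  -- `id*f` or `(f - id)*id`; for nonempty `a` and `b` they cancel each other.
  by_cases ha : a = []
  · by_cases hb : b = []
    · subst ha hb
      simp [hnil]
    · simp [ha, hb]
  · by_cases hb : b = []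
    · simp [ha, hb, Units.neg_smul]
    · simp [ha, hb]

theorem curvature_nil {m f : Family M} (hm : ∀ p, m p [] = 0) (hf : ∀ i, IsMultiAdd (f i))
    (hnil : ∀ u, f u [] = 0) (u : ℕ) : curvature μ del m f u [] = 0 := by
  have h3 : delFam del 0 f u [] = 0 := by
    cases u <;> simp [delFam, letterDel, hnil]
  simp [curvature, act_nil hm hf, h3, convFam, conv, letterMul, hnil]

end CurvatureUnit

/-! ### Obstruction cocycles and the inductive construction -/

section Obstruction

variable {k : Type u} [CommRing k]
variable {M : Type v} [AddCommGroup M] [Module k M]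
variable {𝒜 : ℕ × ℤ → Submodule k M} [DirectSum.Decomposition 𝒜]

/-- The left hand side of the relations of a morphism is multilinear. -/
theorem isMultilinear_relation_left (B : DAInf 𝒜) (f : (s t : ℕ) → Multi k M M t) (u v : ℕ) :
    IsMultilinear k v fun x : ℕ → M => ∑ ip ∈ antidiagonal u, ∑ jq ∈ antidiagonal (v + 1),
      ∑ r : Fin jq.1, (-1 : ℤ) ^ ((r : ℕ) * jq.2 + (jq.1 - 1 - r) + ip.2 * jq.1) •
        ins 𝒜 (f ip.1 jq.1) (B.m ip.2 jq.2) ip.2 (2 - ((ip.2 : ℤ) + jq.2)) r x :=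
  .sum fun _ _ => .sum fun _ hjq => .sum fun _ _ =>
    (isMultilinear_ins 𝒜 (HasAntidiagonal.mem_antidiagonal.1 hjq).symm _ _ _ _ _).zsmul _

/-- The right hand side of the relations of a morphism into a bidga is multilinear. -/
theorem isMultilinear_relation_right {A : DAInf 𝒜} (hA : A.IsBidga) (hA01 : A.m 0 1 = 0)
    (f : (s t : ℕ) → Multi k M M t) (hf : ∀ s, f s 0 = 0) (u v : ℕ) (hv : 1 ≤ v) :
    IsMultilinear k v fun x : ℕ → M => ∑ ip ∈ antidiagonal u, ∑ j ∈ Finset.Icc 1 v,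
      ∑ p ∈ Finset.Nat.antidiagonalTuple j ip.2,
        ∑ q ∈ (Finset.Nat.antidiagonalTuple j v).filter fun q => ∀ w, 1 ≤ q w,
          (-1 : ℤ) ^ eps u p q • A.m ip.1 j (tensorArgs 𝒜 f p q x) := by
  simp only [sum_tensorArgs_eq hA hA01 f hf u v hv]
  refine .add ?_ (.sum fun p _ => .sum fun q hq =>
    (isMultilinear_mul 𝒜 _ (HasAntidiagonal.mem_antidiagonal.1 hq) _ _ _).zsmul _)
  split_ifs
  · exact (isMultilinear_del 𝒜 _ _).zsmul _
  · exact .zero v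

/-- The curvature comes from multilinear maps, the differences of the two sides of the relations
of a morphism. -/
theorem exists_defect {A B : DAInf 𝒜} (hA : A.IsBidga) (hA01 : A.m 0 1 = 0)
    (f : (s t : ℕ) → Multi k M M t) (hf : ∀ s, f s 0 = 0) (u : ℕ) :
    ∃ G : (n : ℕ) → Multi k M M n, G 0 = 0 ∧ (∀ l, IsHomWord 𝒜 l → 1 ≤ l.length → evalWord G l =
      (wordExp l + u * vdeg l + u.choose 2 + u).negOnePow •
        curvature (mulHom (A.m 0 2)) (delHom (A.m 1 1)) (hat B.m) (hat f) u l) ∧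
      ∀ v, 1 ≤ v → ∀ x : ℕ → M, (G v fun i => x i) =
    ∑ ip ∈ antidiagonal u, ∑ jq ∈ antidiagonal (v + 1), ∑ r : Fin jq.1,
      (-1 : ℤ) ^ ((r : ℕ) * jq.2 + (jq.1 - 1 - r) + ip.2 * jq.1) •
        ins 𝒜 (f ip.1 jq.1) (B.m ip.2 jq.2) ip.2 (2 - ((ip.2 : ℤ) + jq.2)) r x -
    ∑ ip ∈ antidiagonal u, ∑ j ∈ Finset.Icc 1 v,
      ∑ p ∈ Finset.Nat.antidiagonalTuple j ip.2,
        ∑ q ∈ (Finset.Nat.antidiagonalTuple j v).filter fun q => ∀ w, 1 ≤ q w,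
          (-1 : ℤ) ^ eps u p q • A.m ip.1 j (tensorArgs 𝒜 f p q x) := by
  have h := fun v => (isMultilinear_relation_left B f u (v + 1)).sub
    (isMultilinear_relation_right hA hA01 f hf u (v + 1) (by omega))
  choose G' hG' using h
  obtain ⟨G, hG0, hG⟩ : ∃ G : (n : ℕ) → Multi k M M n, G 0 = 0 ∧ ∀ n, G (n + 1) = G' n :=
    ⟨fun n => match n with
      | 0 => 0
      | n + 1 => G' n, rfl, fun _ => rfl⟩
  simp only [← hG] at hG'
  refine ⟨G, hG0, fun l hl h1 => ?_, fun v hv x => ?_⟩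
  · obtain ⟨x, hx⟩ : ∃ x : ℕ → M, ∀ (t : ℕ) (h : t < l.length), x t = l[t].val :=
      ⟨fun t => if h : t < l.length then l[t].val else 0, fun t ht => dif_pos ht⟩
    obtain ⟨n, hn⟩ : ∃ n, l.length = n + 1 := ⟨l.length - 1, by omega⟩
    rw [← morphism_defect hA hA01 f hf u hl h1 x hx, hn, ← hG' n x]
    exact (evalWord_eq G hn _ fun t ht ht' => hx t ht').symm
  · obtain ⟨n, rfl⟩ : ∃ n, v = n + 1 := ⟨v - 1, by omega⟩
    exact hG' n x

/-- The families of maps `f` with `f_{01} = 1` which satisfy the relations of a morphism of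
strictly unital structures for `u + v ≤ r`. -/
structure IsMorphismUpTo (A B : DAInf 𝒜) (r : ℤ) (f : (s t : ℕ) → Multi k M M t) : Prop where
  zero : ∀ s, f s 0 = 0
  homog : ∀ s t : ℕ, IsHomog 𝒜 𝒜 (f s t) s (1 - ((s : ℤ) + t))
  one : ∀ x, f 0 1 x = x 0
  unit : ∀ i j : ℕ, 2 ≤ i + j → ∀ (x : Fin j → M) (l : Fin j), x l = A.unit → f i j x = 0
  low : ∀ t ≤ r, AgreeAt 𝒜 t
    (curvature (mulHom (A.m 0 2)) (delHom (A.m 1 1)) (hat B.m) (hat f)) 0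

namespace IsMorphismUpTo

variable {A B : DAInf 𝒜} {r : ℤ} {f : (s t : ℕ) → Multi k M M t} (h : IsMorphismUpTo A B r f)
include h

theorem isHomFam : IsHomFam 𝒜 0 (hat f) :=
  isHomFam_hat fun p n => by simpa using h.homog p n

theorem nil (u : ℕ) : hat f u [] = 0 := hat_eq_zero (h.zero u)

theorem hat_low (t : ℤ) (ht : t < 1) : AgreeAt 𝒜 t (hat f) 0 := by
  intro u l _ hu
  obtain rfl : l = [] := List.length_eq_zero_iff.1 (by omega)
  exact h.nil u

theorem hat_single (x : Letter M) : hat f 0 [x] = x.val := by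
  rw [hat, ← evalWord_eq (f 0) (n := 1) (x := fun _ => x.val) rfl, h.one]
  · simp [wordExp]
  · intro a ha _
    obtain rfl : a = 0 := by omega
    rfl

theorem hat_one : AgreeAt 𝒜 1 (hat f) idFam := by
  intro u l _ hu
  rcases l with _ | ⟨x, l⟩
  · rw [h.nil, idFam_of_length_ne _ (by simp)]
  · obtain ⟨rfl, rfl⟩ : u = 0 ∧ l = [] := by
      rw [← List.length_eq_zero_iff]
      simp at hu
      omega
    exact h.hat_single x

theorem hat_unit (u : ℕ) (a b : List (Letter M)) : hat f u (a ++ unitLetter A.unit :: b) =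
    idFam u (a ++ unitLetter A.unit :: b) := by
  by_cases hw : 1 ≤ u + (a.length + b.length)
  · have h1 : idFam u (a ++ unitLetter A.unit :: b) = (0 : M) := by
      rcases u with _ | u
      · exact idFam_of_length_ne _ (by simp; omega)
      · exact idFam_succ _ _
    rw [h1, hat, evalWord_unit_eq_zero, smul_zero]
    exact fun x p _ hx => h.unit _ _ (by simp; omega) x p hx
  · obtain ⟨rfl, rfl, rfl⟩ : u = 0 ∧ a = [] ∧ b = [] := by
      rw [← List.length_eq_zero_iff, ← List.length_eq_zero_iff]
      omega
    exact h.hat_single _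

end IsMorphismUpTo

/-- A two-sided unit is determined by the product. -/
theorem unit_eq {A B : DAInf 𝒜} (h : B.m 0 2 = A.m 0 2) : B.unit = A.unit := by
  rw [← A.unit_mul B.unit, ← h, B.mul_unit]

theorem hat_m_agree {A B : DAInf 𝒜} (hA01 : A.m 0 1 = 0) (h02 : B.m 0 2 = A.m 0 2)
    (h11 : B.m 1 1 = A.m 1 1) (h01 : B.m 0 1 = 0) (t : ℤ) (ht : t ≤ 2) :
    AgreeAt 𝒜 t (hat B.m) (hat A.m) := by
  intro u l _ hu
  have : B.m u l.length = A.m u l.length := by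
    generalize l.length = n at hu
    rcases n with _ | _ | _ | n
    · rw [B.m_zero, A.m_zero]
    · rcases (by omega : u = 0 ∨ u = 1) with rfl | rfl
      · exact h01.trans hA01.symm
      · exact h11
    · obtain rfl : u = 0 := by omega
      exact h02
    · omega
  rw [hat, hat, evalWord, evalWord, this]

section Step

variable {A B : DAInf 𝒜} (hA : A.IsBidga) (hA01 : A.m 0 1 = 0) (h02 : B.m 0 2 = A.m 0 2)
  (h11 : B.m 1 1 = A.m 1 1) (h01 : B.m 0 1 = 0)
include hA hA01 h02 h11 h01

/-- The obstruction to extending a partial morphism is a normalized Hochschild cocycle. -/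
theorem IsMorphismUpTo.exists_obstruction {t : ℤ} (ht : 1 ≤ t)
    {f : (s t : ℕ) → Multi k M M t} (h : IsMorphismUpTo A B (t + 1) f) :
    ∃ c ∈ cochains 𝒜 (t + 2) (-t), hochD 𝒜 (A.m 0 2) (A.m 1 1) (t + 2) (-t) c = 0 ∧
      (∀ p, VanishBelow A.unit p c) ∧ AgreeAt 𝒜 (t + 2) (hatCochain (t + 2) 1 c)
        (curvature (mulHom (A.m 0 2)) (delHom (A.m 1 1)) (hat B.m) (hat f)) := by
  choose G hG0 hG _ using exists_defect (B := B) hA hA01 f h.zero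
  have hBunit : IsStrictUnit (hat B.m) A.unit := unit_eq h02 ▸ isStrictUnit_hat B
  -- The arity-`n` component is the defect of the relation with `u = t + 2 - n`. The sign converts
  -- the normalization of `exists_defect` into that of `hatCochain` with `δ = 1`.
  obtain ⟨c, hc⟩ : ∃ c : (n : ℕ) → Multi k M M n, ∀ n, c n = if (n : ℤ) ≤ t + 2 then
    (((t + 2 - n).toNat.choose 2 : ℕ) + (t + 2 - n)).negOnePow • G (t + 2 - n).toNat n else 0 :=
      ⟨_, fun n => rfl⟩
  have hc0 : c 0 = 0 := by rw [hc, hG0, smul_zero, ite_self]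
  have hhat : AgreeAt 𝒜 (t + 2) (hatCochain (t + 2) 1 c)
      (curvature (mulHom (A.m 0 2)) (delHom (A.m 1 1)) (hat B.m) (hat f)) := by
    intro u l hl hu
    rcases Nat.eq_zero_or_pos l.length with h0 | h0
    · obtain rfl := List.length_eq_zero_iff.1 h0
      rw [hatCochain_nil _ _ hc0, curvature_nil hBunit.nil (isMultiAdd_hat f) h.nil]
    · have hu' : t + 2 - l.length = u := by omega
      have h1 : evalWord c l = ((u.choose 2 : ℕ) + (u : ℤ)).negOnePow • evalWord (G u) l := by
        rw [evalWord, hc, if_pos (by omega), hu', Int.toNat_natCast]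
        rfl
      rw [hatCochain, if_pos hu, h1, hG u l hl h0, smul_smul, smul_smul]
      conv_rhs => rw [← one_smul ℤˣ (curvature _ _ _ _ u l)]
      congr 1
      rw [← Int.negOnePow_zero]
      simp only [← Int.negOnePow_add, Int.negOnePow_eq_iff]
      grind
  have hhom : IsHomFam 𝒜 1 (hatCochain (t + 2) 1 c) := by
    intro u l hl
    by_cases hu : (u : ℤ) + l.length = t + 2
    · rw [hhat u l hl hu]
      exact (h.isHomFam.curvature (isHomBidga A) (isHomFam_hat_m B)) u l hl
    · rw [hatCochain_of_ne c hu]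
      exact Submodule.zero_mem (piece 𝒜 _ _)
  have e1 : (1 : ℤ) + 1 - (t + 2) = -t := by ring
  have hmem : c ∈ cochains 𝒜 (t + 2) (-t) := by
    intro n
    rcases le_or_gt (n : ℤ) (t + 2) with hn | hn
    · exact ⟨e1 ▸ isHomog_of_hatCochain hhom n hn, fun hn' => absurd hn' (by omega)⟩
    · have : c n = 0 := by rw [hc, if_neg (by omega)]
      exact ⟨by rw [this]; exact fun _ _ _ => Submodule.zero_mem _, fun _ => this⟩
  refine ⟨c, hmem, ?_, fun q n x p _ hx => ?_, hhat⟩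
  · funext n
    have hD := hochD_mem hA hA01 (e1.symm ▸ hmem) hc0
    rw [e1] at hD
    rcases le_or_gt (n : ℤ) (t + 2 + 1) with hn | hn
    · refine eq_zero_of_hatCochain (𝒜 := 𝒜) (δ := 1 + 1) hn fun u l hl _ hu => ?_
      have h1 := twistedD_hatCochain_eq hA hA01 1 (e1.symm ▸ hmem) hc0 u hl
      rw [e1] at h1
      -- By the Bianchi identity the differential of the curvature vanishes. Since the curvature
      -- starts in weight `t + 2`, weight `t + 3` of that identity is the cocycle condition for `c`.
      have h2 := twistedD_agree (𝒜 := 𝒜) (μ := mulHom (A.m 0 2)) (del := delHom (A.m 1 1))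
        (s := t + 2) (δ := 1) (m := hat B.m) (m' := hat A.m) (f := hat f) (f' := idFam)
        (φ := curvature (mulHom (A.m 0 2)) (delHom (A.m 1 1)) (hat B.m) (hat f))
        (φ' := hatCochain (t + 2) 1 c) (fun u a i j e hl => ?_)
        (isZeroFam_of_isMultiAdd (isMultiAdd_hatCochain _ _ c))
        (fun r hr => h.low r (by omega)) (hatCochain_low c)
        (fun u l hl hu => (hhat u l hl hu).symm) (isHomFam_hat_m B) (isHomFam_hat_m A)
        (hat_m_low B h01) (hat_m_low A hA01) (hat_m_agree hA01 h02 h11 h01 2 le_rfl) h.hat_low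
        idFam_low h.hat_one u l hl hu
      · rw [twistedD_curvature _ _ (hA.mul_assoc hA01) (hA.del_del hA01) (isMultiAdd_hat f) u l
          (fun a d e h u => act_hat_hat B u fun y hy => hl y (by rw [← h]; simp [hy]))
          (h.isHomFam.leibnizAt hA hA01 hl), h1, eq_comm] at h2
        exact (smul_eq_zero_iff_eq _).1 h2
      -- The curvature agrees up to sign with a multilinear map, so it vanishes on words with a zero
      -- letter.
      · have h3 := hG u _ hl (by simp; omega)
        rw [(isMultiAdd_evalWord (G u)).map_zero, eq_comm] at h3
        exact (smul_eq_zero_iff_eq _).1 h3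
    · exact (hD n).2 hn
  · rcases le_or_gt (n : ℤ) (t + 2) with hn | hn
    · refine multilinear_unit_eq_zero c A.unit_mem p (fun a b hl _ hlen => ?_) x hx
      have h1 := hhat (t + 2 - n).toNat _ hl (by rw [hlen]; omega)
      rw [curvature_unit hBunit A.unit_mul A.mul_unit (isMultiAdd_hat f) h.nil h.hat_unit,
        hatCochain, if_pos (by rw [hlen]; omega)] at h1
      · exact (smul_eq_zero_iff_eq _).1 h1
      · simp at hlen
        omega
    · rw [(hmem n).2 hn]
      rfl

-- The sign with which `b` is added compensates for the different exponents in `hat` and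
-- `hatCochain`, so the correction is exactly additive on words.
omit hA hA01 h02 h11 h01 in
theorem hat_add_hatCochain (f : (s t : ℕ) → Multi k M M t) (b : (n : ℕ) → Multi k M M n) (s : ℤ) :
    (hat fun p n => f p n + if (p : ℤ) + n = s then
      ((p.choose 2 : ℕ) + (p : ℤ)).negOnePow • b n else 0) = hat f + hatCochain s 0 b := by
  funext u l
  rw [Pi.add_apply, Pi.add_apply, hat, hat, hatCochain, evalWord, evalWord]
  split_ifs with hs
  · rw [add_apply, smul_apply, smul_add, smul_smul]
    congr 2
    rw [← Int.negOnePow_add, Int.negOnePow_eq_iff]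
    grind
  · rw [add_zero, add_zero]

/-- A partial morphism extends to the next degree if the cohomology vanishes. -/
theorem IsMorphismUpTo.exists_succ {t : ℤ} (ht : 1 ≤ t)
    (hHH : Subsingleton (HH 𝒜 (A.m 0 2) (A.m 1 1) (t + 2) (-t)))
    {f : (s t : ℕ) → Multi k M M t} (h : IsMorphismUpTo A B (t + 1) f) :
    ∃ f', IsMorphismUpTo A B (t + 2) f' ∧
      ∀ p n : ℕ, (p : ℤ) + n ≠ t + 1 → f' p n = f p n := by
  obtain ⟨c, hc, hDc, hcu, hcurv⟩ := h.exists_obstruction hA hA01 h02 h11 h01 ht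
  have hcob : c ∈ coboundaries 𝒜 (A.m 0 2) (A.m 1 1) (t + 2) (-t) := by
    have h1 : (⟨c, hc, hDc⟩ : cocycles 𝒜 (A.m 0 2) (A.m 1 1) (t + 2) (-t)) ∈
        (coboundaries 𝒜 (A.m 0 2) (A.m 1 1) (t + 2) (-t)).submoduleOf
          (cocycles 𝒜 (A.m 0 2) (A.m 1 1) (t + 2) (-t)) := by
      rw [← Submodule.Quotient.mk_eq_zero]
      exact Subsingleton.elim _ _
    exact h1
  obtain ⟨b₀, hb₀, hDb₀⟩ := hcob
  rw [show t + 2 - 1 = t + 1 by ring] at hb₀ hDb₀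
  obtain ⟨b, hb, hDb, hbu⟩ := exists_normalized hA hA01 ht hb₀ (by rw [hDb₀]; exact hcu)
  rw [hDb₀] at hDb
  have hb0 := arity_zero_eq_zero hb (by omega)
  -- Only weight `t + 1 ≥ 2` is changed, so `f_01` remains the identity.
  refine ⟨fun p n => f p n + if (p : ℤ) + n = t + 1 then
    ((p.choose 2 : ℕ) + (p : ℤ)).negOnePow • b n else 0, ⟨fun s => ?_, fun s n => ?_, fun x => ?_,
      fun i j hij x l hx => ?_, fun r hr => ?_⟩, fun p n hpn => ?_⟩
  · rw [h.zero, hb0, smul_zero, ite_self, add_zero]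
  · intro d x hx
    rw [add_apply]
    refine Submodule.add_mem _ (h.homog s n d x hx) ?_
    split_ifs with hs
    · refine smul_mem_piece _ (mem_piece_congr ((hb n).1 d x hx) ?_ ?_) <;> omega
    · exact Submodule.zero_mem _
  · rw [if_neg (by push_cast; omega), add_zero, h.one]
  · rw [add_apply, h.unit i j hij x l hx, zero_add]
    split_ifs
    · rw [smul_apply, hbu (l + 1) j x l (by omega) hx, smul_zero]
    · rfl
  · rw [hat_add_hatCochain, curvature_add]
    intro u l hl hu
    -- The quadratic term has weight at least `2 (t + 1)`, which exceeds `t + 2` because `t ≥ 1`.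
    rw [Pi.sub_apply, Pi.sub_apply, Pi.add_apply, Pi.add_apply,
      convFam_low (hatCochain_low b) (hatCochain_low b) r (by omega) u l hl hu]
    have hβ := isZeroFam_of_isMultiAdd (𝒜 := 𝒜) (isMultiAdd_hatCochain (t + 1) 0 b)
    rcases lt_or_eq_of_le hr with hr | rfl
    · rw [h.low r (by omega) u l hl hu, twistedD_low hβ (hatCochain_low b) (isHomFam_hat_m B)
        (hat_m_low B h01) h.hat_low r (by omega) u l hl hu]
      simp
    · have e1 : (1 : ℤ) + 0 - (t + 1) = -t := by ring
      have h1 := twistedD_hatCochain_eq hA hA01 0 (e1.symm ▸ hb) hb0 u hl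
      rw [e1, hDb, show t + 1 + 1 = t + 2 by ring, zero_add, hcurv u l hl hu] at h1
      have h2 := twistedD_agree (𝒜 := 𝒜) (μ := mulHom (A.m 0 2)) (del := delHom (A.m 1 1))
        (s := t + 1) (δ := 0) (m := hat B.m) (m' := hat A.m) (f := hat f) (f' := idFam)
        hβ hβ (hatCochain_low b) (hatCochain_low b) (AgreeAt.refl _ _) (isHomFam_hat_m B)
        (isHomFam_hat_m A)
        (hat_m_low B h01) (hat_m_low A hA01) (hat_m_agree hA01 h02 h11 h01 2 le_rfl) h.hat_low
        idFam_low h.hat_one u l hl (by omega)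
      -- For `δ = 0` the twisted differential is minus the Hochschild differential, so it cancels
      -- the curvature without a choice of sign.
      rw [h2, h1]
      simp
  · dsimp only
    rw [if_neg hpn, add_zero]

/-- The identity as a family of maps. -/
noncomputable def idMaps (k : Type u) [CommRing k] (M : Type v) [AddCommGroup M] [Module k M] :
    (s t : ℕ) → Multi k M M t
  | 0, 1 => MultilinearMap.ofSubsingleton k M M (0 : Fin 1) LinearMap.id
  | _, _ => 0

omit hA hA01 h02 h11 h01 in
theorem idMaps_eq_zero {s t : ℕ} (h : ¬ (s = 0 ∧ t = 1)) : idMaps k M s t = 0 := by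
  rcases s with _ | s
  · rcases t with _ | _ | t
    · rfl
    · exact absurd ⟨rfl, rfl⟩ h
    · rfl
  · rfl

omit hA hA01 h02 h11 h01 in
theorem hat_idMaps : hat (idMaps k M) = idFam := by
  funext u l
  by_cases h : u = 0 ∧ l.length = 1
  · obtain ⟨rfl, h⟩ := h
    obtain ⟨x, rfl⟩ := List.length_eq_one_iff.1 h
    simp [hat, wordExp, evalWord, idMaps, idFam]
  · rw [hat_eq_zero (idMaps_eq_zero h)]
    rcases u with _ | u
    · rw [idFam_of_length_ne _ fun hl => h ⟨rfl, hl⟩]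
    · rw [idFam_succ]

theorem isMorphismUpTo_idMaps : IsMorphismUpTo A B 2 (idMaps k M) where
  zero s := idMaps_eq_zero (by omega)
  homog s t := by
    by_cases h : s = 0 ∧ t = 1
    · obtain ⟨rfl, rfl⟩ := h
      intro d x hx
      have := hx 0
      simpa [idMaps, piece] using this
    · rw [idMaps_eq_zero h]
      exact fun _ _ _ => Submodule.zero_mem _
  one x := rfl
  unit i j hij x l _ := by
    rw [idMaps_eq_zero (by omega)]
    rfl
  low t ht u l hl hu := by
    rw [hat_idMaps, curvature_idFam_eq hA hA01, hat_m_agree hA01 h02 h11 h01 t ht u l hl hu, sub_self]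
    rfl

/-- If the cohomology vanishes, there is a family satisfying all relations of a morphism. -/
theorem exists_isMorphismUpTo
    (hHH : ∀ r : ℤ, 3 ≤ r → Subsingleton (HH 𝒜 (A.m 0 2) (A.m 1 1) r (2 - r))) :
    ∃ f, ∀ r, IsMorphismUpTo A B r f := by
  -- Stage `n` has the relations up to weight `n + 2`. Passing to the next stage uses the cohomology
  -- in degree `n + 3` and alters only components of weight `n + 2`.
  have step : ∀ (n : ℕ) (f : {f // IsMorphismUpTo A B ((n : ℤ) + 2) f}),
      ∃ f' : {f // IsMorphismUpTo A B ((n + 1 : ℕ) + 2 : ℤ) f},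
        ∀ p q : ℕ, p + q ≠ n + 2 → f'.1 p q = f.1 p q := by
    rintro n ⟨f, hf⟩
    have e1 : (n : ℤ) + 2 = (n + 1) + 1 := by ring
    have e2 : ((n + 1 : ℕ) : ℤ) + 2 = (n + 1) + 2 := by push_cast; ring
    have h1 := hHH ((n : ℤ) + 1 + 2) (by omega)
    rw [show (2 : ℤ) - (n + 1 + 2) = -(n + 1) by ring] at h1
    obtain ⟨f', hf', h2⟩ := IsMorphismUpTo.exists_succ hA hA01 h02 h11 h01 (by omega) h1 (e1 ▸ hf)
    exact ⟨⟨f', e2.symm ▸ hf'⟩, fun p q hpq => h2 p q (by omega)⟩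
  choose S hS using step
  obtain ⟨F, hF⟩ : ∃ F : (n : ℕ) → {f // IsMorphismUpTo A B ((n : ℤ) + 2) f},
      ∀ n, F (n + 1) = S n (F n) :=
    ⟨fun n => Nat.rec ⟨idMaps k M, by
      simpa using isMorphismUpTo_idMaps hA hA01 h02 h11 h01⟩ (fun n f => S n f) n, fun n => rfl⟩
  -- From stage `p + q` on, the component `(p, q)` is no longer altered; the limit takes it from
  -- that stage.
  have hstab : ∀ p q n, p + q ≤ n → (F n).1 p q = (F (p + q)).1 p q := by
    intro p q n hn
    induction n, hn using Nat.le_induction with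
    | base => rfl
    | succ n hn ih => rw [hF, hS n _ p q (by omega), ih]
  refine ⟨fun p q => (F (p + q)).1 p q, fun r => ⟨fun s => (F _).2.zero s, fun s t => (F _).2.homog s t,
    fun x => (F _).2.one x, fun i j hij x l hx => (F _).2.unit i j hij x l hx, fun t ht => ?_⟩⟩
  -- Curvature in weight `t` involves components of weight at most `t + 1`, all of which have
  -- stabilized at stage `t + 1`.
  have h1 := curvature_agree (𝒜 := 𝒜) (μ := mulHom (A.m 0 2)) (del := delHom (A.m 1 1)) (s := t)
    (m := hat B.m) (f := hat fun p q => (F (p + q)).1 p q) (f' := hat (F (t + 1).toNat).1)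
    (isHomFam_hat_m B) fun t' ht' u l hl hu => by
      rw [hat, hat, evalWord, evalWord, hstab _ _ (t + 1).toNat (by omega)]
  intro u l hl hu
  rw [h1 u l hl hu]
  exact (F (t + 1).toNat).2.low t (by omega) u l hl hu

end Step

end Obstruction

/-! ### Isomorphisms on the second page -/

section Equivalence

variable {k : Type u} [CommRing k]
variable {M : Type v} [AddCommGroup M] [Module k M]
variable {N : Type w} [AddCommGroup N] [Module k N]

theorem homologyMap_bijective {d : M →ₗ[k] M} {d' : N →ₗ[k] N} {g : M →ₗ[k] N}
    (hg : ∀ x, g (d x) = d' (g x)) (h : Function.Bijective g) :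
    Function.Bijective (homologyMap g hg) := by
  constructor
  · rw [injective_iff_map_eq_zero]
    intro x hx
    obtain ⟨⟨x, hxd⟩, rfl⟩ := Submodule.Quotient.mk_surjective _ x
    obtain ⟨y, hy⟩ := (Submodule.Quotient.mk_eq_zero _).1 hx
    obtain ⟨y, rfl⟩ := h.2 y
    refine (Submodule.Quotient.mk_eq_zero _).2 ⟨y, h.1 ?_⟩
    rw [hg]
    exact hy
  · intro y
    obtain ⟨⟨y, hyd⟩, rfl⟩ := Submodule.Quotient.mk_surjective _ y
    obtain ⟨x, rfl⟩ := h.2 y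
    rw [LinearMap.mem_ker, ← hg] at hyd
    exact ⟨Submodule.Quotient.mk ⟨x, h.1 (hyd.trans (map_zero g).symm)⟩, rfl⟩

variable {𝒜 : ℕ × ℤ → Submodule k M} [DirectSum.Decomposition 𝒜]
variable {ℬ : ℕ × ℤ → Submodule k N} [DirectSum.Decomposition ℬ]

theorem DAInfHom.isE2Equivalence_of_bijective {A : DAInf 𝒜} {B : DAInf ℬ} (F : DAInfHom A B)
    (h : Function.Bijective (lin (F.f 0 1))) : F.IsE2Equivalence :=
  homologyMap_bijective F.hVer_comm (homologyMap_bijective F.comm_vertical h)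

end Equivalence

end DerivedAInf

/-! ### The main theorem -/

theorem theorem3p8 {k : Type*} [CommRing k] {M : Type*} [AddCommGroup M] [Module k M]
    (𝒜 : ℕ × ℤ → Submodule k M) [DirectSum.Decomposition 𝒜]
    (h2 : ∀ x : M, (2 : ℤ) • x = 0 → x = 0)
    (A : DerivedAInf.DAInf 𝒜) (hA : A.IsBidga) (hA01 : A.m 0 1 = 0)
    (hHH : ∀ r : ℤ, 3 ≤ r →
      Subsingleton (DerivedAInf.HH 𝒜 (A.m 0 2) (A.m 1 1) r (2 - r))) :
    ∀ B : DerivedAInf.DAInf 𝒜,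
      B.m 0 2 = A.m 0 2 → B.m 1 1 = A.m 1 1 → B.m 0 1 = 0 →
        ∃ F : DerivedAInf.DAInfHom B A, F.IsE2Equivalence := by
  intro B h02 h11 h01
  obtain ⟨f, hf⟩ := DerivedAInf.exists_isMorphismUpTo hA hA01 h02 h11 h01 hHH
  have hunit : B.unit = A.unit := DerivedAInf.unit_eq h02
  refine ⟨⟨f, (hf 0).zero, (hf 0).homog, fun u v hv x => ?_, ?_, ?_⟩, ?_⟩
  · obtain ⟨G, -, hG, hG'⟩ := DerivedAInf.exists_defect (B := B) hA hA01 f (hf 0).zero u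
    -- Vanishing of the curvature gives the relation on homogeneous words only; multilinearity of
    -- the defect extends it to all arguments.
    have h0 : G v = 0 := by
      refine DerivedAInf.multilinear_eq_zero_of_word (𝒜 := 𝒜) G v fun l hl hlv => ?_
      rw [hG l hl (by omega), (hf (u + v)).low (u + v) le_rfl u l hl (by rw [hlv])]
      exact smul_zero _
    have h3 := hG' v hv x
    rw [h0] at h3
    exact sub_eq_zero.1 h3.symm
  · rw [(hf 0).one, ← hunit]
    rfl
  · rw [hunit]
    exact (hf 0).unit
  · refine DerivedAInf.DAInfHom.isE2Equivalence_of_bijective _ ?_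
    -- The construction never alters `f_01`, which is the identity and so induces isomorphisms on
    -- both homologies.
    have h3 : ⇑(DerivedAInf.lin (f 0 1)) = id := funext fun x => (hf 0).one fun _ => x
    change Function.Bijective (DerivedAInf.lin (f 0 1))
    rw [h3]
    exact Function.bijective_id
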